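/- \textbf{Theorem (Compactness lemma).} Let $d\ge 1$, $0<s<1$ and $\frac{4s}{d}<\alpha<2^\star$, where $2^\star=\frac{4s}{d-2s}$ if $d>2s$ and $2^\star=\infty$ if $d\le 2s$. Put $$s_c=\frac d2-\frac{2s}{\alpha},\qquad \alpha_c=\frac{2d}{d-2s_c}=\frac{d\alpha}{2s}.$$ Here $\|u\|_{\dot H^\gamma}=\||\nabla|^\gamma u\|_{L^2(\mathbb R^d)}$ for complex-valued $u$ on $\mathbb R^d$, where $|\nabla|^\gamma$ is the Fourier multiplier with symbol $|\xi|^\gamma$ and $(-\Delta)^\gamma=|\nabla|^{2\gamma}$; $\dot H^{s_c}\cap\dot H^s$ is the space of tempered distributions with locally integrable Fourier transform for which both norms are finite; and $L^{\alpha_c}\cap\dot H^s$ is the space of $f\in L^{\alpha_c}$ with $|\nabla|^s f\in L^2$, where $|\nabla|^sf$ is understood modulo polynomials. For non-zero $f$ put $$H(f)=\frac{\|f\|_{L^{\alpha+2}}^{\alpha+2}}{\|f\|_{\dot H^{s_c}}^{\alpha}\|f\|_{\dot H^s}^2}\quad (f\in \dot H^{s_c}\cap\dot H^s),\qquad K(f)=\frac{\|f\|_{L^{\alpha+2}}^{\alpha+2}}{\|f\|_{L^{\alpha_c}}^{\alpha}\|f\|_{\dot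 H^s}^2}\quad (f\in L^{\alpha_c}\cap\dot H^s).$$ Let $\mathcal G$ be the set of maximizers $g$ of $H$ over $(\dot H^{s_c}\cap\dot H^s)\setminus\{0\}$ that solve $(-\Delta)^s g+(-\Delta)^{s_c}g-|g|^\alpha g=0$, and let $\mathcal H$ be the set of maximizers $h$ of $K$ over $(L^{\alpha_c}\cap\dot H^s)\setminus\{0\}$ that solve $(-\Delta)^s h+|h|^{\alpha_c-2}h-|h|^\alpha h=0$, both equations in the sense of tempered distributions. Then $\mathcal G$ and $\mathcal H$ are non-empty, all $g\in\mathcal G$ have the same $\dot H^{s_c}$-norm, denoted $S_{\rm gs}$, all $h\in\mathcal H$ have the same $L^{\alpha_c}$-norm, denoted $L_{\rm gs}$, and the following holds. Let $M>0$, $m\ge 0$, and let $(v_n)_{n\ge1}$ be a bounded sequence in $\dot H^{s_c}\cap\dot H^s$ such that $$\limsup_{n\to\infty}\|v_n\|_{\dot H^s}\le M,\qquad \limsup_{n\to\infty}\|v_n\|_{L^{\alpha+2}}\ge m .$$ \begin{itemize} \item There exist a sequence $(x_n)_{n\ge1}$ in $\mathbb R^d$ and $V\in\dot H^{s_c}\cap\dot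 H^s$ such that, up to a subsequence, $v_n(\cdot+x_n)\rightharpoonup V$ weakly in $\dot H^{s_c}\cap\dot H^s$ and $$\|V\|_{\dot H^{s_c}}^\alpha\ge\frac{2}{\alpha+2}\,\frac{m^{\alpha+2}}{M^2}\,S_{\rm gs}^\alpha .$$ \item There exist a sequence $(y_n)_{n\ge1}$ in $\mathbb R^d$ and $W\in L^{\alpha_c}\cap\dot H^s$ such that, up to a subsequence, $v_n(\cdot+y_n)\rightharpoonup W$ weakly in $L^{\alpha_c}\cap\dot H^s$ and $$\|W\|_{L^{\alpha_c}}^\alpha\ge\frac{2}{\alpha+2}\,\frac{m^{\alpha+2}}{M^2}\,L_{\rm gs}^\alpha .$$ \end{itemize} -/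

import Mathlib

open MeasureTheory Filter Topology
open scoped SchwartzMap FourierTransform ENNReal

noncomputable section

namespace FracNLS

/-- The critical Sobolev exponent `s_c = d/2 - 2s/α`. -/
def sc (d : ℕ) (s α : ℝ) : ℝ := d / 2 - 2 * s / α

/-- The critical Lebesgue exponent `α_c = 2d/(d - 2 s_c)`. -/
def alphac (d : ℕ) (s α : ℝ) : ℝ := 2 * d / (d - 2 * sc d s α)

/-- Schwartz functions all of whose derivatives vanish at the origin, that is, the Fourier
transforms of the elements of `𝓢₀`. -/
def flatSchwartz (d : ℕ) : Set 𝓢(EuclideanSpace ℝ (Fin d), ℂ) :=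
  {φ | ∀ k : ℕ, iteratedFDeriv ℝ k (φ : EuclideanSpace ℝ (Fin d) → ℂ) 0 = 0}

/-- `f` is a function defining a tempered distribution, and the function `h` represents its
(distributional) Fourier transform on all test functions of the class `T`:
`⟨f, 𝓕 φ⟩ = ⟨h, φ⟩` for `φ ∈ T`. -/
structure HasFourierOn {d : ℕ} (T : Set 𝓢(EuclideanSpace ℝ (Fin d), ℂ))
    (f h : EuclideanSpace ℝ (Fin d) → ℂ) : Prop where
  meas_left : AEStronglyMeasurable f volume
  tempered : ∀ φ : 𝓢(EuclideanSpace ℝ (Fin d), ℂ), Integrable (fun x => f x * φ x) volume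
  meas_right : AEStronglyMeasurable h volume
  integrable : ∀ φ ∈ T, Integrable (fun ξ => h ξ * φ ξ) volume
  pairing : ∀ φ ∈ T, ∫ x, f x * (𝓕 φ) x = ∫ ξ, h ξ * φ ξ

/-- The Fourier transform of `f` is a (locally integrable) function on the whole space. -/
def HasFourierFunction {d : ℕ} (f : EuclideanSpace ℝ (Fin d) → ℂ) : Prop :=
  ∃ h, HasFourierOn Set.univ f h

/-- `h` is the Fourier transform of `f` away from the origin (that is, modulo polynomials). -/
def HasFourierAway {d : ℕ} (f h : EuclideanSpace ℝ (Fin d) → ℂ) : Prop :=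
  HasFourierOn (flatSchwartz d) f h

/-- The homogeneous Sobolev norm `‖f‖_{Ḣ^γ} = ‖|∇|^γ f‖_{L²} = ‖(2π|ξ|)^γ f̂‖_{L²}`, with value
`∞` if `f` is not in `Ḣ^γ`. (With Mathlib's normalisation of the Fourier transform, the symbol of
`|∇|` is `2π|ξ|`; the function `h` below is unique up to null sets, so that the infimum is only a
way of writing "the value at `h`, if there is such an `h`".) -/
def hdotNorm {d : ℕ} (γ : ℝ) (f : EuclideanSpace ℝ (Fin d) → ℂ) : ℝ≥0∞ :=
  ⨅ (h : EuclideanSpace ℝ (Fin d) → ℂ) (_ : HasFourierAway f h),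
    eLpNorm (fun ξ => (((2 * Real.pi * ‖ξ‖) ^ γ : ℝ) : ℂ) * h ξ) 2 volume

/-- The Lebesgue norm with a real exponent. -/
def lebNorm {d : ℕ} (p : ℝ) (f : EuclideanSpace ℝ (Fin d) → ℂ) : ℝ≥0∞ :=
  eLpNorm f (ENNReal.ofReal p) volume

/-- The space `Ḣ^{s_c} ∩ Ḣ^s`. As `s_c < d/2`, it is the space of the tempered distributions
whose Fourier transform is a locally integrable function and whose two norms are finite
(all of these distributions are functions). -/
def sobSpace (d : ℕ) (s α : ℝ) : Set (EuclideanSpace ℝ (Fin d) → ℂ) :=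
  {f | HasFourierFunction f ∧ hdotNorm (sc d s α) f < ∞ ∧ hdotNorm s f < ∞}

/-- The norm of `Ḣ^{s_c} ∩ Ḣ^s`. -/
def sobSpaceNorm (d : ℕ) (s α : ℝ) (f : EuclideanSpace ℝ (Fin d) → ℂ) : ℝ≥0∞ :=
  hdotNorm (sc d s α) f + hdotNorm s f

/-- The space `L^{α_c} ∩ Ḣ^s`. (A polynomial in `L^{α_c}` is zero, so that the membership in `Ḣ^s`
is to be tested away from the zero frequency; for `s ≥ d/2` the Fourier transform need not be
locally integrable at the origin.) -/
def lebSpace (d : ℕ) (s α : ℝ) : Set (EuclideanSpace ℝ (Fin d) → ℂ) :=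
  {f | MemLp f (ENNReal.ofReal (alphac d s α)) volume ∧ hdotNorm s f < ∞}

/-- The norm of `L^{α_c} ∩ Ḣ^s`. -/
def lebSpaceNorm (d : ℕ) (s α : ℝ) (f : EuclideanSpace ℝ (Fin d) → ℂ) : ℝ≥0∞ :=
  lebNorm (alphac d s α) f + hdotNorm s f

/-- `ℓ` is a bounded linear functional on the space `X` with the (semi)norm `N`. -/
structure IsBoundedFunctional {d : ℕ} (X : Set (EuclideanSpace ℝ (Fin d) → ℂ))
    (N : (EuclideanSpace ℝ (Fin d) → ℂ) → ℝ≥0∞)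
    (ℓ : (EuclideanSpace ℝ (Fin d) → ℂ) → ℂ) : Prop where
  map_add : ∀ f ∈ X, ∀ g ∈ X, ℓ (f + g) = ℓ f + ℓ g
  map_smul : ∀ c : ℂ, ∀ f ∈ X, ℓ (c • f) = c * ℓ f
  bound : ∃ C : ℝ, ∀ f ∈ X, ‖ℓ f‖ ≤ C * (N f).toReal

/-- `u n ⇀ V` weakly in the space `X` with the (semi)norm `N`. -/
structure WeaklyConverges {d : ℕ} (X : Set (EuclideanSpace ℝ (Fin d) → ℂ))
    (N : (EuclideanSpace ℝ (Fin d) → ℂ) → ℝ≥0∞)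
    (u : ℕ → EuclideanSpace ℝ (Fin d) → ℂ) (V : EuclideanSpace ℝ (Fin d) → ℂ) : Prop where
  mem_seq : ∀ n, u n ∈ X
  mem_limit : V ∈ X
  tendsto : ∀ ℓ : (EuclideanSpace ℝ (Fin d) → ℂ) → ℂ, IsBoundedFunctional X N ℓ →
    Tendsto (fun n => ℓ (u n)) atTop (𝓝 (ℓ V))

/-- The Weinstein functional
`H(f) = ‖f‖_{L^{α+2}}^{α+2} / (‖f‖_{Ḣ^{s_c}}^α ‖f‖_{Ḣ^s}^2)`. -/
def weinsteinH (d : ℕ) (s α : ℝ) (f : EuclideanSpace ℝ (Fin d) → ℂ) : ℝ≥0∞ :=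
  lebNorm (α + 2) f ^ (α + 2) / (hdotNorm (sc d s α) f ^ α * hdotNorm s f ^ 2)

/-- The Weinstein functional
`K(f) = ‖f‖_{L^{α+2}}^{α+2} / (‖f‖_{L^{α_c}}^α ‖f‖_{Ḣ^s}^2)`. -/
def weinsteinK (d : ℕ) (s α : ℝ) (f : EuclideanSpace ℝ (Fin d) → ℂ) : ℝ≥0∞ :=
  lebNorm (α + 2) f ^ (α + 2) / (lebNorm (alphac d s α) f ^ α * hdotNorm s f ^ 2)

/-- `(-Δ)^s Q + (-Δ)^{s_c} Q - |Q|^α Q = 0` in the sense of tempered distributions, on the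
Fourier side. -/
def SolvesSobolevEq (d : ℕ) (s α : ℝ) (Q : EuclideanSpace ℝ (Fin d) → ℂ) : Prop :=
  ∃ h, HasFourierAway Q h ∧ ∀ φ : 𝓢(EuclideanSpace ℝ (Fin d), ℂ),
    (∫ ξ, (((2 * Real.pi * ‖ξ‖) ^ (2 * s) : ℝ) : ℂ) * h ξ * φ ξ)
      + (∫ ξ, (((2 * Real.pi * ‖ξ‖) ^ (2 * sc d s α) : ℝ) : ℂ) * h ξ * φ ξ)
      - (∫ x, ((‖Q x‖ ^ α : ℝ) : ℂ) * Q x * (𝓕 φ) x) = 0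

/-- `(-Δ)^s R + |R|^{α_c - 2} R - |R|^α R = 0` in the sense of tempered distributions, on the
Fourier side. -/
def SolvesLebesgueEq (d : ℕ) (s α : ℝ) (R : EuclideanSpace ℝ (Fin d) → ℂ) : Prop :=
  ∃ h, HasFourierAway R h ∧ ∀ φ : 𝓢(EuclideanSpace ℝ (Fin d), ℂ),
    (∫ ξ, (((2 * Real.pi * ‖ξ‖) ^ (2 * s) : ℝ) : ℂ) * h ξ * φ ξ)
      + (∫ x, ((‖R x‖ ^ (alphac d s α - 2) : ℝ) : ℂ) * R x * (𝓕 φ) x)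
      - (∫ x, ((‖R x‖ ^ α : ℝ) : ℂ) * R x * (𝓕 φ) x) = 0

/-- Sobolev ground states: the maximizers of `H` on `(Ḣ^{s_c} ∩ Ḣ^s) \ {0}` that solve
`(-Δ)^s g + (-Δ)^{s_c} g - |g|^α g = 0`. -/
structure IsSobolevGroundState (d : ℕ) (s α : ℝ) (g : EuclideanSpace ℝ (Fin d) → ℂ) : Prop where
  mem : g ∈ sobSpace d s α
  ne_zero : ¬ g =ᵐ[volume] 0
  maximizer : ∀ f ∈ sobSpace d s α, ¬ f =ᵐ[volume] 0 → weinsteinH d s α f ≤ weinsteinH d s α g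
  solves : SolvesSobolevEq d s α g

/-- Lebesgue ground states: the maximizers of `K` on `(L^{α_c} ∩ Ḣ^s) \ {0}` that solve
`(-Δ)^s h + |h|^{α_c - 2} h - |h|^α h = 0`. -/
structure IsLebesgueGroundState (d : ℕ) (s α : ℝ) (h : EuclideanSpace ℝ (Fin d) → ℂ) : Prop where
  mem : h ∈ lebSpace d s α
  ne_zero : ¬ h =ᵐ[volume] 0
  maximizer : ∀ f ∈ lebSpace d s α, ¬ f =ᵐ[volume] 0 → weinsteinK d s α f ≤ weinsteinK d s α h
  solves : SolvesLebesgueEq d s α h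

/-- `S` is the common `Ḣ^{s_c}` norm `S_gs` of all Sobolev ground states (of which there is at
least one). -/
def IsSgs (d : ℕ) (s α S : ℝ) : Prop :=
  (∃ g, IsSobolevGroundState d s α g) ∧
    ∀ g, IsSobolevGroundState d s α g → (hdotNorm (sc d s α) g).toReal = S

/-- `L` is the common `L^{α_c}` norm `L_gs` of all Lebesgue ground states (of which there is at
least one). -/
def IsLgs (d : ℕ) (s α L : ℝ) : Prop :=
  (∃ h, IsLebesgueGroundState d s α h) ∧
    ∀ h, IsLebesgueGroundState d s α h → (lebNorm (alphac d s α) h).toReal = L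

end FracNLS

end

/-!
The proof rests on one compactness statement for sequences in `L^q ∩ Ḣ^s`, which is used twice: to
construct the ground states and to find the concentrating profile of `v_n`. Throughout,
`q = α_c`, so that `2 < q < p` for `p = 2 + 2sq/d = α + 2`.

**Function spaces.** A function `f` with finite `Ḣ^γ` norm is represented by the element
`eh γ f = (2π|ξ|)^γ f̂` of the Hilbert space `L²`; translations of `f` become multiplications by
characters. Since `L^q` contains no non-zero polynomials (`ae_eq_zero_of_flat`), an element of
`L^q ∩ Ḣ^s` is determined by `eh s f`. The inequalities needed are the Gagliardo–Nirenberg inequality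
`‖f‖_p^p ≤ C ‖f‖_q^α ‖f‖_{Ḣ^s}²` (`exists_gagliardo_nirenberg`) and the Sobolev embedding
`Ḣ^{s_c} ⊆ L^q` (`exists_sobolev`). Both follow from `lintegral_rpow_le_of_splitting`, where `f` is
split into a bounded part and a part that is small in `L²`: the bounded part is an average over balls
in the first case and a low-frequency part in the second. The averages also give local compactness:
a bounded sequence in `L^q ∩ Ḣ^s` has a subsequence that converges weakly and almost everywhere
(`exists_extraction`).

**Profiles.** A profile of a bounded sequence is a weak limit of translates of a subsequence. If the
sequence is bounded below in `L^p`, then its averages over small balls do not vanish uniformly, so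
that there is a profile with `‖V‖_q` bounded below (`exists_profile_threshold`). Removing a profile
`V` lowers the limits of `‖v‖_q^q`, `‖v‖_p^p` and `‖v‖_{Ḣ^s}²` by the respective quantities of `V`,
by the Brezis–Lieb lemma, and creates no new profiles (`ConvSeq.peel`). Removing finitely many
profiles leaves a remainder that is small in `L^p`, and summing up gives the key statement
`ConvSeq.exists_profile`: if `lim ‖v‖_p^p ≥ Λ lim ‖v‖_{Ḣ^s}²`, then some non-zero profile satisfies
`‖V‖_p^p ≥ Λ ‖V‖_{Ḣ^s}²`. No full profile decomposition is needed.

**Ground states.** Both functionals have the form `‖f‖_p^p / (b(f)^θ ‖f‖_{Ḣ^s}²)`, and they are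
treated together as a `WeinsteinProblem`. By scaling, a maximizing sequence has
`b = ‖f‖_{Ḣ^s} = 1`. With the supremum `C` of the quotient, the key statement yields a profile with
`‖V‖_p^p ≥ C ‖V‖_{Ḣ^s}²` and `b(V) ≤ 1`, which is a maximizer (`exists_maximizer`). Scaling again turns
its Euler–Lagrange equation into the required equation. Conversely, if a maximizer satisfies the
equation, then comparison with its Euler–Lagrange equation, whose terms are linearly independent
(`sobolev_independent`, `lebesgue_independent`), shows that `b^θ = (α + 2) / (2C)`. Thus
`S_gs^α = (α + 2) / (2C)` and `L_gs^α = (α + 2) / (2C')` with the optimal constants `C` and `C'` of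
the two problems (`exists_isSgs`, `exists_isLgs`).

**Conclusion.** For `m > 0`, pass to a subsequence of `v_n` with `lim ‖v_n‖_p ≥ m` and
`lim ‖v_n‖_{Ḣ^s} ≤ M`. The key statement with `Λ = m^{α+2} / M²` gives a non-zero weak limit `V` of
translates with `Λ ‖V‖_{Ḣ^s}² ≤ ‖V‖_p^p ≤ C ‖V‖_{Ḣ^{s_c}}^α ‖V‖_{Ḣ^s}²`, and likewise with
`‖V‖_q^α` and `C'`. Dividing by `‖V‖_{Ḣ^s}²` proves both lower bounds; for `m = 0` they are trivial.
The weak convergence is obtained for the components `eh s_c` and `eh s` in `L²`, and the Hahn–Banach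
theorem carries it over to all bounded functionals (`weaklyConverges_sob`).
-/

noncomputable section

namespace FracNLS
variable {d : ℕ}

/-! ### Functions with a prescribed Fourier transform -/

/-- The space `ℝ^d`. -/
abbrev Eu (d : ℕ) : Type := EuclideanSpace ℝ (Fin d)

namespace HasFourierOn

variable {S T : Set 𝓢(Eu d, ℂ)} {f g h k : Eu d → ℂ}

theorem mono (hST : S ⊆ T) (hf : HasFourierOn T f h) : HasFourierOn S f h :=
  ⟨hf.meas_left, hf.tempered, hf.meas_right, fun φ hφ => hf.integrable φ (hST hφ),
    fun φ hφ => hf.pairing φ (hST hφ)⟩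

theorem congr (hf : HasFourierOn T f h) (hfg : f =ᵐ[volume] g) (hhk : h =ᵐ[volume] k) :
    HasFourierOn T g k where
  meas_left := hf.meas_left.congr hfg
  tempered φ := (hf.tempered φ).congr (hfg.mono fun x hx => by simp only [hx])
  meas_right := hf.meas_right.congr hhk
  integrable φ hφ := (hf.integrable φ hφ).congr (hhk.mono fun x hx => by simp only [hx])
  pairing φ hφ := by
    have h1 : ∫ x, f x * (𝓕 φ) x = ∫ x, g x * (𝓕 φ) x :=
      integral_congr_ae (hfg.mono fun x hx => by simp only [hx])
    rw [← h1, hf.pairing φ hφ]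
    exact integral_congr_ae (hhk.mono fun x hx => by simp only [hx])

theorem add (hf : HasFourierOn T f h) (hg : HasFourierOn T g k) :
    HasFourierOn T (f + g) (h + k) where
  meas_left := hf.meas_left.add hg.meas_left
  tempered φ := by
    simp only [Pi.add_apply, add_mul]
    exact (hf.tempered φ).add (hg.tempered φ)
  meas_right := hf.meas_right.add hg.meas_right
  integrable φ hφ := by
    simp only [Pi.add_apply, add_mul]
    exact (hf.integrable φ hφ).add (hg.integrable φ hφ)
  pairing φ hφ := by
    simp only [Pi.add_apply, add_mul]
    rw [integral_add (hf.tempered _) (hg.tempered _), hf.pairing φ hφ, hg.pairing φ hφ,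
      integral_add (hf.integrable φ hφ) (hg.integrable φ hφ)]

theorem smul (c : ℂ) (hf : HasFourierOn T f h) : HasFourierOn T (c • f) (c • h) where
  meas_left := hf.meas_left.const_smul c
  tempered φ := by
    simpa only [Pi.smul_apply, smul_eq_mul, mul_assoc] using (hf.tempered φ).const_mul c
  meas_right := hf.meas_right.const_smul c
  integrable φ hφ := by
    simpa only [Pi.smul_apply, smul_eq_mul, mul_assoc] using (hf.integrable φ hφ).const_mul c
  pairing φ hφ := by
    simp only [Pi.smul_apply, smul_eq_mul, mul_assoc, integral_const_mul]
    rw [hf.pairing φ hφ]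

theorem sub (hf : HasFourierOn T f h) (hg : HasFourierOn T g k) :
    HasFourierOn T (f - g) (h - k) := by
  simpa only [neg_smul, one_smul, ← sub_eq_add_neg] using hf.add (hg.smul (-1))

end HasFourierOn

/-- The character `ξ ↦ e^{2πi⟨y, ξ⟩}`. -/
def chr (y ξ : Eu d) : ℂ := (Real.fourierChar (inner ℝ y ξ) : ℂ)

@[simp] theorem norm_chr (y ξ : Eu d) : ‖chr y ξ‖ = 1 := Circle.norm_coe _

theorem contDiff_chr (y : Eu d) : ContDiff ℝ ((⊤ : ℕ∞) : WithTop ℕ∞) (chr y) := by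
  unfold chr
  simp only [Real.fourierChar_apply]
  exact Complex.contDiff_exp.comp ((Complex.ofRealCLM.contDiff.comp
    (contDiff_const.mul (contDiff_const.inner ℝ contDiff_id))).mul
    contDiff_const)

theorem continuous_chr (y : Eu d) : Continuous (chr y) := (contDiff_chr y).continuous

/-- Multiplication of a Schwartz function by a character, realised by translation on the Fourier
side. -/
def chrMul (y : Eu d) (φ : 𝓢(Eu d, ℂ)) : 𝓢(Eu d, ℂ) :=
  𝓕⁻ (SchwartzMap.compSubConstCLM ℂ y (𝓕 φ))

theorem fourier_chrMul (y : Eu d) (φ : 𝓢(Eu d, ℂ)) (x : Eu d) :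
    (𝓕 (chrMul y φ)) x = (𝓕 φ) (x - y) := by
  simp [chrMul]

theorem chrMul_apply (y : Eu d) (φ : 𝓢(Eu d, ℂ)) (ξ : Eu d) :
    chrMul y φ ξ = chr y ξ * φ ξ := by
  have h1 : φ ξ = (𝓕⁻ (𝓕 φ)) ξ := by simp
  rw [h1, chrMul, SchwartzMap.fourierInv_coe, SchwartzMap.fourierInv_coe, Real.fourierInv_eq,
    Real.fourierInv_eq, ← integral_add_right_eq_self _ y, ← integral_const_mul]
  refine integral_congr_ae (Eventually.of_forall fun v => ?_)
  simp only [SchwartzMap.compSubConstCLM_apply, add_sub_cancel_right, inner_add_left,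
    AddChar.map_add_eq_mul, chr, Circle.smul_def, Circle.coe_mul, smul_eq_mul]
  ring

/-- Flatness at the origin is stable under multiplication by a smooth function, by the Leibniz
rule. -/
theorem flat_of_smooth_mul {φ ψ : 𝓢(Eu d, ℂ)} (hφ : φ ∈ flatSchwartz d) {a : Eu d → ℂ}
    (ha : ContDiff ℝ ((⊤ : ℕ∞) : WithTop ℕ∞) a) (hψ : ∀ ξ, ψ ξ = a ξ * φ ξ) :
    ψ ∈ flatSchwartz d := by
  intro k
  have h1 : (ψ : Eu d → ℂ) = fun ξ => a ξ * φ ξ := funext hψ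
  rw [h1, ← norm_eq_zero]
  refine le_antisymm ((norm_iteratedFDeriv_mul_le (n := k) (N := ((⊤ : ℕ∞) : WithTop ℕ∞))
    ha (φ.smooth ⊤) 0 (mod_cast le_top)).trans ?_)
    (norm_nonneg _)
  refine (Finset.sum_eq_zero fun i _ => ?_).le
  rw [hφ (k - i)]
  simp

theorem chrMul_mem_flat (y : Eu d) {φ : 𝓢(Eu d, ℂ)} (hφ : φ ∈ flatSchwartz d) :
    chrMul y φ ∈ flatSchwartz d :=
  flat_of_smooth_mul hφ (contDiff_chr y) (chrMul_apply y φ)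

theorem flat_of_tsupport {φ : 𝓢(Eu d, ℂ)} (hφ : (0 : Eu d) ∉ tsupport φ) :
    φ ∈ flatSchwartz d := fun k => by
  by_contra h
  exact hφ (support_iteratedFDeriv_subset (𝕜 := ℝ) k h)

theorem HasFourierOn.translate {T : Set 𝓢(Eu d, ℂ)} {f h : Eu d → ℂ} (hf : HasFourierOn T f h)
    (y : Eu d) (hT : ∀ φ ∈ T, chrMul y φ ∈ T) :
    HasFourierOn T (fun x => f (x + y)) (fun ξ => chr y ξ * h ξ) where
  meas_left := hf.meas_left.comp_measurePreserving (measurePreserving_add_right volume y)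
  tempered φ := by
    have := (hf.tempered (SchwartzMap.compSubConstCLM ℂ y φ)).comp_add_right y
    simpa using this
  meas_right := (continuous_chr y).aestronglyMeasurable.mul hf.meas_right
  integrable φ hφ := by
    refine (hf.integrable _ (hT φ hφ)).congr (Eventually.of_forall fun ξ => ?_)
    simp only [chrMul_apply]
    ring
  pairing φ hφ := by
    have h1 := hf.pairing _ (hT φ hφ)
    rw [← integral_add_right_eq_self _ y] at h1
    simp only [fourier_chrMul, add_sub_cancel_right, chrMul_apply] at h1
    rw [h1]
    exact integral_congr_ae (Eventually.of_forall fun ξ => by ring)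

/-- The dilated Schwartz function `φ(c ·)`, for `c ≠ 0`. -/
def dil (c : ℝ) (hc : c ≠ 0) (φ : 𝓢(Eu d, ℂ)) : 𝓢(Eu d, ℂ) :=
  SchwartzMap.compCLMOfContinuousLinearEquiv ℂ
    (ContinuousLinearEquiv.smulLeft (M₁ := Eu d) (Units.mk0 c hc)) φ

@[simp] theorem dil_apply (c : ℝ) (hc : c ≠ 0) (φ : 𝓢(Eu d, ℂ)) (x : Eu d) :
    dil c hc φ x = φ (c • x) := rfl

theorem fourier_dil {c : ℝ} (hc : 0 < c) (φ : 𝓢(Eu d, ℂ)) (x : Eu d) :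
    (𝓕 (dil c hc.ne' φ)) x = ((c ^ d : ℝ) : ℂ)⁻¹ * (𝓕 φ) (c⁻¹ • x) := by
  rw [SchwartzMap.fourier_coe, SchwartzMap.fourier_coe, Real.fourier_eq, Real.fourier_eq]
  have := Measure.integral_comp_smul (volume : Measure (Eu d))
    (fun v => Real.fourierChar (-inner ℝ v (c⁻¹ • x)) • φ v) c
  simp only [finrank_euclideanSpace, Fintype.card_fin] at this
  rw [abs_of_pos (by positivity)] at this
  rw [← Complex.ofReal_inv, ← Complex.real_smul, ← this]
  refine integral_congr_ae (Eventually.of_forall fun v => ?_)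
  simp only [dil_apply, inner_smul_left, inner_smul_right, RCLike.conj_to_real]
  rw [inv_mul_cancel_left₀ hc.ne']

theorem dil_mem_flat {c : ℝ} (hc : c ≠ 0) {φ : 𝓢(Eu d, ℂ)} (hφ : φ ∈ flatSchwartz d) :
    dil c hc φ ∈ flatSchwartz d := by
  intro k
  have h1 : ((dil c hc φ : 𝓢(Eu d, ℂ)) : Eu d → ℂ) = fun x => φ (c • x) := rfl
  rw [h1, iteratedFDeriv_comp_const_smul c ((φ.smooth ⊤).of_le (mod_cast le_top))]
  simp [hφ k]

theorem HasFourierOn.dilate {T : Set 𝓢(Eu d, ℂ)} {f h : Eu d → ℂ} (hf : HasFourierOn T f h)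
    {c : ℝ} (hc : 0 < c) (hT : ∀ φ ∈ T, dil c hc.ne' φ ∈ T) :
    HasFourierOn T (fun x => f (c • x)) (fun ξ => ((c ^ d : ℝ) : ℂ)⁻¹ * h (c⁻¹ • ξ)) := by
  have hq : ∀ {c : ℝ}, c ≠ 0 → Measure.QuasiMeasurePreserving (fun x : Eu d => c • x) :=
    fun {c} hc => ⟨measurable_const_smul c, by
      rw [Measure.map_addHaar_smul _ hc]; exact Measure.smul_absolutelyContinuous⟩
  have hcd : (c ^ d : ℝ) ≠ 0 := by positivity
  refine ⟨hf.meas_left.comp_quasiMeasurePreserving (hq hc.ne'), fun φ => ?_,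
    (hf.meas_right.comp_quasiMeasurePreserving (hq (inv_ne_zero hc.ne'))).const_mul _,
    fun φ hφ => ?_, fun φ hφ => ?_⟩
  · have := (hf.tempered (dil c⁻¹ (inv_ne_zero hc.ne') φ)).comp_smul hc.ne'
    simpa [smul_smul, hc.ne'] using this
  · have := ((hf.integrable _ (hT φ hφ)).comp_smul (inv_ne_zero hc.ne')).const_mul
      ((c ^ d : ℝ) : ℂ)⁻¹
    simpa [smul_smul, hc.ne', mul_assoc] using this
  · have h1 := hf.pairing _ (hT φ hφ)
    have h2 := Measure.integral_comp_smul (volume : Measure (Eu d))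
      (fun x => f x * (𝓕 (dil c hc.ne' φ)) x) c
    have h3 := Measure.integral_comp_smul (volume : Measure (Eu d))
      (fun x => h x * dil c hc.ne' φ x) c⁻¹
    simp only [finrank_euclideanSpace, Fintype.card_fin, fourier_dil hc, smul_smul, dil_apply,
      inv_mul_cancel₀ hc.ne', mul_inv_cancel₀ hc.ne', one_smul] at h1 h2 h3
    rw [h1, abs_of_pos (by positivity)] at h2
    rw [abs_of_pos (by positivity)] at h3
    have h4 : ∫ x, f (c • x) * (((c ^ d : ℝ) : ℂ)⁻¹ * (𝓕 φ) x)
        = ((c ^ d : ℝ) : ℂ)⁻¹ * ∫ x, f (c • x) * (𝓕 φ) x := by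
      rw [← integral_const_mul]
      exact integral_congr_ae (Eventually.of_forall fun ξ => by ring)
    simp only [mul_assoc, integral_const_mul]
    rw [h3]
    rw [h4, Complex.real_smul] at h2
    have h5 : ((c ^ d : ℝ) : ℂ) ≠ 0 := by exact_mod_cast hcd
    simp only [inv_pow, inv_inv, Complex.real_smul, ← mul_assoc, inv_mul_cancel₀ h5, one_mul]
    rw [Complex.ofReal_inv] at h2
    exact mul_left_cancel₀ (inv_ne_zero h5) h2

/-! ### Uniqueness of the Fourier transform -/

/-- A smooth compactly supported real function as a complex Schwartz function. -/
def ofRealSchwartz (g : Eu d → ℝ) (hg : ContDiff ℝ ((⊤ : ℕ∞) : WithTop ℕ∞) g)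
    (hc : HasCompactSupport g) : 𝓢(Eu d, ℂ) :=
  HasCompactSupport.toSchwartzMap (f := fun x => (g x : ℂ)) (hc.comp_left Complex.ofReal_zero)
    (Complex.ofRealCLM.contDiff.comp hg)

theorem ofRealSchwartz_apply (g : Eu d → ℝ) (hg : ContDiff ℝ ((⊤ : ℕ∞) : WithTop ℕ∞) g)
    (hc : HasCompactSupport g) (x : Eu d) : ofRealSchwartz g hg hc x = (g x : ℂ) := rfl

theorem tsupport_ofRealSchwartz (g : Eu d → ℝ) (hg : ContDiff ℝ ((⊤ : ℕ∞) : WithTop ℕ∞) g)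
    (hc : HasCompactSupport g) : tsupport (ofRealSchwartz g hg hc) ⊆ tsupport g := by
  refine closure_mono fun x hx => ?_
  intro h
  exact hx (by simp [ofRealSchwartz_apply, h])

/-- A function that vanishes when tested against the Schwartz functions supported in an open set
`U` vanishes almost everywhere in `U`. -/
theorem ae_eq_zero_on_of_forall_integral_mul_eq_zero {U : Set (Eu d)} (hU : IsOpen U)
    {k : Eu d → ℂ}
    (hint : ∀ φ : 𝓢(Eu d, ℂ), tsupport φ ⊆ U → Integrable (fun x => k x * φ x))
    (h0 : ∀ φ : 𝓢(Eu d, ℂ), tsupport φ ⊆ U → ∫ x, k x * φ x = 0) :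
    ∀ᵐ x ∂volume, x ∈ U → k x = 0 := by
  refine hU.ae_eq_zero_of_integral_contDiff_smul_eq_zero ?_ fun g hg hc hgU => ?_
  · intro x hx
    obtain ⟨ε, hε, hball⟩ := Metric.isOpen_iff.mp hU x hx
    let b : ContDiffBump x := ⟨ε / 4, ε / 2, by positivity, by linarith⟩
    have hsub : tsupport b ⊆ U := by
      rw [b.tsupport_eq]
      exact (Metric.closedBall_subset_ball (by change ε / 2 < ε; linarith)).trans hball
    have h1 := hint (ofRealSchwartz b b.contDiff b.hasCompactSupport)
      ((tsupport_ofRealSchwartz _ _ _).trans hsub)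
    refine ⟨Metric.ball x (ε / 4),
      mem_nhdsWithin_of_mem_nhds (Metric.ball_mem_nhds _ (by positivity)), ?_⟩
    refine (h1.integrableOn (s := Metric.ball x (ε / 4))).congr_fun_ae ?_
    refine (ae_restrict_mem Metric.isOpen_ball.measurableSet).mono fun y hy => ?_
    have : b y = 1 := b.one_of_mem_closedBall (Metric.ball_subset_closedBall hy)
    simp [ofRealSchwartz_apply, this]
  · have := h0 (ofRealSchwartz g hg hc) ((tsupport_ofRealSchwartz _ _ _).trans hgU)
    rw [← this]
    refine integral_congr_ae (Eventually.of_forall fun x => ?_)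
    simp only [ofRealSchwartz_apply, Complex.real_smul]
    ring

/-- The Fourier transform away from the origin is unique up to null sets; hence the infimum in
`hdotNorm` is over a single value. -/
theorem HasFourierAway.unique (hd : 0 < d) {f h k : Eu d → ℂ} (hh : HasFourierAway f h)
    (hk : HasFourierAway f k) : h =ᵐ[volume] k := by
  have hflat : ∀ φ : 𝓢(Eu d, ℂ), tsupport φ ⊆ ({0}ᶜ : Set (Eu d)) → φ ∈ flatSchwartz d :=
    fun φ hφ => flat_of_tsupport fun h => hφ h rfl
  have h1 := ae_eq_zero_on_of_forall_integral_mul_eq_zero (U := ({0}ᶜ : Set (Eu d)))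
    isOpen_compl_singleton (k := h - k)
    (fun φ hφ => by
      simp only [Pi.sub_apply, sub_mul]
      exact (hh.integrable φ (hflat φ hφ)).sub (hk.integrable φ (hflat φ hφ)))
    (fun φ hφ => by
      simp only [Pi.sub_apply, sub_mul]
      rw [integral_sub (hh.integrable φ (hflat φ hφ)) (hk.integrable φ (hflat φ hφ)),
        ← hh.pairing φ (hflat φ hφ), ← hk.pairing φ (hflat φ hφ), sub_self])
  have : NeZero d := ⟨hd.ne'⟩
  have h0 : ∀ᵐ x ∂(volume : Measure (Eu d)), x ≠ 0 := by
    simp [ae_iff, measure_singleton]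
  filter_upwards [h1, h0] with x hx hx0
  exact sub_eq_zero.mp (hx hx0)

/-- A function that vanishes when tested against all `𝓕 φ`, `φ` a Schwartz function, is zero. -/
theorem ae_eq_zero_of_integral_mul_fourier {F : Eu d → ℂ}
    (hint : ∀ φ : 𝓢(Eu d, ℂ), Integrable (fun x => F x * φ x))
    (h0 : ∀ φ : 𝓢(Eu d, ℂ), ∫ x, F x * (𝓕 φ) x = 0) : F =ᵐ[volume] 0 := by
  have := ae_eq_zero_on_of_forall_integral_mul_eq_zero isOpen_univ (fun φ _ => hint φ)
    (fun φ _ => by simpa using h0 (𝓕⁻ φ))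
  filter_upwards [this] with x hx using hx trivial

/-! ### Functions without non-zero frequencies -/

theorem MemLp.integrable_mul_schwartz {p : ℝ≥0∞} (hp : 1 ≤ p) {F : Eu d → ℂ}
    (hF : MemLp F p volume) (φ : 𝓢(Eu d, ℂ)) : Integrable (fun x => F x * φ x) := by
  have hpq : ENNReal.HolderConjugate p (1 - p⁻¹)⁻¹ :=
    ENNReal.HolderConjugate.inv_one_sub_inv' hp
  exact memLp_one_iff_integrable.mp (MemLp.mul (p := (1 - p⁻¹)⁻¹) (q := p) (r := 1) hF
    (φ.memLp _) |>.ae_eq (Eventually.of_forall fun x => by simp [mul_comm]))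

/-- A smooth cut-off near the origin, equal to `1` on the unit ball and supported in the ball of
radius `2`. -/
def cutoff (d : ℕ) : 𝓢(Eu d, ℂ) :=
  let b : ContDiffBump (0 : Eu d) := ⟨1, 2, one_pos, one_lt_two⟩
  ofRealSchwartz b b.contDiff b.hasCompactSupport

theorem cutoff_eq_one {x : Eu d} (hx : ‖x‖ ≤ 1) : cutoff d x = 1 := by
  let b : ContDiffBump (0 : Eu d) := ⟨1, 2, one_pos, one_lt_two⟩
  have : b x = 1 := b.one_of_mem_closedBall (by simpa [b] using hx)
  change ((b x : ℝ) : ℂ) = 1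
  rw [this]; simp

/-- The part of `ψ` at frequencies `≲ 1 / c`: the product of `ψ` with `cutoff (c ·)`. -/
def lowPart (c : ℝ) (hc : c ≠ 0) (ψ : 𝓢(Eu d, ℂ)) : 𝓢(Eu d, ℂ) :=
  SchwartzMap.pairing (ContinuousLinearMap.mul ℂ ℂ) ψ (dil c hc (cutoff d))

theorem lowPart_apply (c : ℝ) (hc : c ≠ 0) (ψ : 𝓢(Eu d, ℂ)) (x : Eu d) :
    lowPart c hc ψ x = ψ x * cutoff d (c • x) := rfl

theorem sub_lowPart_mem_flat {c : ℝ} (hc : 0 < c) (ψ : 𝓢(Eu d, ℂ)) :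
    ψ - lowPart c hc.ne' ψ ∈ flatSchwartz d := by
  refine flat_of_tsupport ?_
  rw [notMem_tsupport_iff_eventuallyEq]
  filter_upwards [Metric.ball_mem_nhds (0 : Eu d) (inv_pos.mpr hc)] with x hx
  have : ‖c • x‖ ≤ 1 := by
    rw [norm_smul, Real.norm_of_nonneg hc.le]
    have hx' : ‖x‖ < c⁻¹ := by simpa using hx
    calc c * ‖x‖ ≤ c * c⁻¹ := by gcongr
      _ = 1 := mul_inv_cancel₀ hc.ne'
  simp [lowPart_apply, cutoff_eq_one this]

theorem fourierInv_lowPart (c : ℝ) (hc : c ≠ 0) (ψ : 𝓢(Eu d, ℂ)) (x : Eu d) :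
    (𝓕⁻ (lowPart c hc ψ)) x
      = ∫ t, (𝓕⁻ ψ) t * (𝓕⁻ (dil c hc (cutoff d))) (x - t) := by
  have h1 : 𝓕⁻ (lowPart c hc ψ) = SchwartzMap.convolution (ContinuousLinearMap.mul ℂ ℂ) (𝓕⁻ ψ)
      (𝓕⁻ (dil c hc (cutoff d))) := by
    have := SchwartzMap.fourier_convolution (ContinuousLinearMap.mul ℂ ℂ) (𝓕⁻ ψ)
      (𝓕⁻ (dil c hc (cutoff d)))
    rw [FourierTransform.fourier_fourierInv_eq, FourierTransform.fourier_fourierInv_eq] at this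
    rw [lowPart, ← this, FourierTransform.fourierInv_fourier_eq]
  rw [h1, SchwartzMap.convolution_apply]
  rfl

theorem eLpNorm_comp_dilation {c : ℝ} (hc : 0 < c) {p : ℝ≥0∞} (hp : p ≠ ∞) (f : Eu d → ℂ) :
    eLpNorm (fun x => f (c • x)) p volume
      = ENNReal.ofReal ((c ^ d)⁻¹) ^ (1 / p.toReal) * eLpNorm f p volume := by
  have he : MeasurableEmbedding (fun x : Eu d => c • x) := measurableEmbedding_const_smul₀ hc.ne'
  have h1 := he.eLpNorm_map_measure (g := f) (p := p) (μ := volume)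
  have h2 : Measure.map (fun x : Eu d => c • x) volume
      = ENNReal.ofReal ((c ^ d)⁻¹) • (volume : Measure (Eu d)) := by
    have := Measure.map_addHaar_smul (volume : Measure (Eu d)) hc.ne'
    simp only [finrank_euclideanSpace, Fintype.card_fin] at this
    rw [abs_of_pos (by positivity)] at this
    exact this
  rw [h2] at h1
  have h3 : eLpNorm (fun x => f (c • x)) p volume = eLpNorm (f ∘ fun x : Eu d => c • x) p volume :=
    rfl
  rw [h3, ← h1, eLpNorm_smul_measure_of_ne_top hp, smul_eq_mul, one_div, ENNReal.toReal_inv, one_div]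

theorem lintegral_enorm_mul_le {p q : ℝ≥0∞} [hpq : ENNReal.HolderConjugate p q] {F G : Eu d → ℂ}
    (hF : AEStronglyMeasurable F volume) (hG : AEStronglyMeasurable G volume) :
    ∫⁻ x, ‖F x‖ₑ * ‖G x‖ₑ ≤ eLpNorm F p volume * eLpNorm G q volume := by
  have := eLpNorm_smul_le_mul_eLpNorm (p := p) (q := q) (r := 1) hG hF
  rw [eLpNorm_one_eq_lintegral_enorm] at this
  simpa [enorm_mul] using this

/-- The Fourier transform of the cut-off. -/
def cutoffHat (d : ℕ) : 𝓢(Eu d, ℂ) := 𝓕 (cutoff d)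

/-- The inverse Fourier transform of `cutoff (c ·)` has `L^q` norm of order `c^{d(1/q-1)}`, which
tends to zero as `c → ∞` if `q > 1`. -/
theorem eLpNorm_fourierInv_dil_cutoff {q : ℝ≥0∞} (hqtop : q ≠ ∞) {c : ℝ} (hc : 0 < c) (t : Eu d) :
    eLpNorm (fun x => (𝓕⁻ (dil c hc.ne' (cutoff d))) (-x - t)) q volume
      = ENNReal.ofReal (c ^ ((d : ℝ) * (1 / q.toReal - 1))) * eLpNorm (cutoffHat d) q volume := by
  set G : Eu d → ℂ := ((c ^ d : ℝ) : ℂ)⁻¹ • (fun x => cutoffHat d (c⁻¹ • x)) with hG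
  have h1 : (fun x => (𝓕⁻ (dil c hc.ne' (cutoff d))) (-x - t)) = fun x => G (x + t) := by
    funext x
    have h2 : (𝓕⁻ (dil c hc.ne' (cutoff d))) (-x - t) = (𝓕 (dil c hc.ne' (cutoff d))) (x + t) := by
      have h0 : -(-x - t) = x + t := by abel
      rw [SchwartzMap.fourierInv_coe, SchwartzMap.fourier_coe, Real.fourierInv_eq_fourier_neg, h0]
    rw [h2, fourier_dil hc]
    rfl
  have hGm : AEStronglyMeasurable G volume :=
    (((cutoffHat d).continuous.comp (continuous_const_smul _)).aestronglyMeasurable).const_smul _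
  have h3 : eLpNorm (fun x => G (x + t)) q volume = eLpNorm G q volume :=
    eLpNorm_comp_measurePreserving hGm (measurePreserving_add_right volume t)
  have h4 : ‖((c ^ d : ℝ) : ℂ)⁻¹‖ₑ = ENNReal.ofReal ((c ^ d)⁻¹) := by
    rw [← Complex.ofReal_inv, ← ofReal_norm, Complex.norm_real, Real.norm_of_nonneg (by positivity)]
  rw [h1, h3, hG, eLpNorm_const_smul, eLpNorm_comp_dilation (inv_pos.mpr hc) hqtop, ← mul_assoc, h4,
    ENNReal.ofReal_rpow_of_pos (by positivity), ← ENNReal.ofReal_mul (by positivity)]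
  congr 2
  rw [← Real.rpow_natCast, ← Real.rpow_natCast, Real.inv_rpow hc.le, inv_inv, ← Real.rpow_neg hc.le,
    ← Real.rpow_mul hc.le, ← Real.rpow_add hc]
  congr 1; ring

/-- Hölder's inequality for the pairing of `F` with a convolution `P * D`. -/
theorem enorm_integral_mul_convolution_le {p q : ℝ≥0∞} [ENNReal.HolderConjugate p q]
    {F P D L : Eu d → ℂ} (hF : AEStronglyMeasurable F volume) (hP : Continuous P)
    (hD : Continuous D) (hL : ∀ x, L x = ∫ t, P t * D (-x - t)) {B : ℝ≥0∞}
    (hB : ∀ t, eLpNorm (fun x => D (-x - t)) q volume ≤ B) :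
    ‖∫ x, F x * L x‖ₑ ≤ (∫⁻ t, ‖P t‖ₑ) * (eLpNorm F p volume * B) := by
  have hm : Measurable fun z : Eu d × Eu d => ‖P z.2‖ₑ * ‖D (-z.1 - z.2)‖ₑ :=
    (hP.comp continuous_snd).measurable.enorm.mul
      (hD.comp (continuous_fst.neg.sub continuous_snd)).measurable.enorm
  calc ‖∫ x, F x * L x‖ₑ
      ≤ ∫⁻ x, ‖F x * L x‖ₑ := enorm_integral_le_lintegral_enorm _
    _ ≤ ∫⁻ x, ∫⁻ t, ‖F x‖ₑ * (‖P t‖ₑ * ‖D (-x - t)‖ₑ) := by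
        refine lintegral_mono fun x => ?_
        have h0 : Measurable fun t => ‖P t‖ₑ * ‖D (-x - t)‖ₑ := hm.comp measurable_prodMk_left
        rw [lintegral_const_mul _ h0, enorm_mul]
        gcongr
        rw [hL]
        refine (enorm_integral_le_lintegral_enorm _).trans (le_of_eq ?_)
        simp only [enorm_mul]
    _ = ∫⁻ t, ∫⁻ x, ‖F x‖ₑ * (‖P t‖ₑ * ‖D (-x - t)‖ₑ) :=
        lintegral_lintegral_swap ((hF.enorm.comp_fst (ν := volume)).mul hm.aemeasurable)
    _ = ∫⁻ t, ‖P t‖ₑ * ∫⁻ x, ‖F x‖ₑ * ‖D (-x - t)‖ₑ := by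
        refine lintegral_congr fun t => ?_
        rw [← lintegral_const_mul' _ _ enorm_ne_top]
        exact lintegral_congr fun x => by ring
    _ ≤ ∫⁻ t, ‖P t‖ₑ * (eLpNorm F p volume * B) := by
        refine lintegral_mono fun t => ?_
        gcongr
        exact (lintegral_enorm_mul_le (p := p) (q := q) hF (hD.comp
          (continuous_neg.sub continuous_const)).aestronglyMeasurable).trans (by gcongr; exact hB t)
    _ = (∫⁻ t, ‖P t‖ₑ) * (eLpNorm F p volume * B) := lintegral_mul_const _ hP.measurable.enorm

/-- A function in `L^p`, `1 < p < ∞`, has no mass at the zero frequency: its pairing with the part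
of `𝓕 ψ` that comes from frequencies `≲ 1 / n` tends to zero. -/
theorem tendsto_integral_mul_fourier_lowPart {p : ℝ≥0∞} (hp1 : 1 < p) (hp : p ≠ ∞) {F : Eu d → ℂ}
    (hF : MemLp F p volume) (ψ : 𝓢(Eu d, ℂ)) (hd : 0 < d) :
    Tendsto (fun n : ℕ => ∫ x, F x * (𝓕 (lowPart ((n : ℝ) + 1) (by positivity) ψ)) x)
      atTop (𝓝 0) := by
  have hpq : ENNReal.HolderConjugate p (1 - p⁻¹)⁻¹ :=
    ENNReal.HolderConjugate.inv_one_sub_inv' hp1.le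
  set q : ℝ≥0∞ := (1 - p⁻¹)⁻¹ with hq
  have hq1 : 1 < q := (ENNReal.HolderConjugate.lt_top_iff_one_lt p q).mp hp.lt_top
  have hqtop : q ≠ ∞ := ((ENNReal.HolderConjugate.lt_top_iff_one_lt q p).mpr hp1).ne
  have hqr : 1 < q.toReal := by
    rw [← ENNReal.toReal_one]; exact (ENNReal.toReal_lt_toReal ENNReal.one_ne_top hqtop).mpr hq1
  set A : ℝ≥0∞ := (∫⁻ t, ‖(𝓕⁻ ψ) t‖ₑ) * (eLpNorm F p volume
    * eLpNorm (cutoffHat d) q volume) with hA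
  have hAtop : A ≠ ∞ := by
    have h1 : eLpNorm (cutoffHat d) q volume ≠ ∞ := ((cutoffHat d).memLp q volume).eLpNorm_ne_top
    have h2 : ∫⁻ t, ‖(𝓕⁻ ψ) t‖ₑ ≠ ∞ := ((𝓕⁻ ψ).integrable (μ := volume)).hasFiniteIntegral.ne
    exact ENNReal.mul_ne_top h2 (ENNReal.mul_ne_top hF.eLpNorm_ne_top h1)
  have hbound : ∀ (c : ℝ) (hc : 0 < c), ‖∫ x, F x * (𝓕 (lowPart c hc.ne' ψ)) x‖ₑ
      ≤ ENNReal.ofReal (c ^ ((d : ℝ) * (1 / q.toReal - 1))) * A := by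
    intro c hc
    refine (enorm_integral_mul_convolution_le (p := p) (q := q) hF.1 (𝓕⁻ ψ).continuous
      (𝓕⁻ (dil c hc.ne' (cutoff d))).continuous (fun x => ?_)
      (fun t => (eLpNorm_fourierInv_dil_cutoff hqtop hc t).le)).trans (le_of_eq ?_)
    · rw [← fourierInv_lowPart, SchwartzMap.fourierInv_coe, SchwartzMap.fourier_coe,
        Real.fourierInv_eq_fourier_neg, neg_neg]
    · rw [hA]; ring
  have hlim : Tendsto (fun n : ℕ => ENNReal.ofReal
      (((n : ℝ) + 1) ^ ((d : ℝ) * (1 / q.toReal - 1))) * A) atTop (𝓝 0) := by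
    have h5 : 0 < (d : ℝ) * (1 - 1 / q.toReal) := by
      refine mul_pos (by exact_mod_cast hd) (sub_pos.mpr ?_)
      rw [div_lt_one (by linarith)]; exact hqr
    have h6 := (tendsto_rpow_neg_atTop h5).comp
      (tendsto_atTop_add_const_right atTop (1 : ℝ) tendsto_natCast_atTop_atTop)
    have h7 := ENNReal.Tendsto.mul_const (b := A) (ENNReal.tendsto_ofReal h6) (Or.inr hAtop)
    simp only [ENNReal.ofReal_zero, zero_mul] at h7
    refine h7.congr fun n => ?_
    simp only [Function.comp]
    congr 3; ring
  rw [tendsto_zero_iff_enorm_tendsto_zero]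
  exact tendsto_of_tendsto_of_tendsto_of_le_of_le tendsto_const_nhds hlim (fun _ => zero_le)
    (fun n => hbound _ (by positivity))

/-- Two Lebesgue functions whose Fourier transforms agree away from the origin are equal, even if
the exponents differ: a non-zero polynomial is not the sum of two such functions. -/
theorem ae_eq_zero_of_flat {p₁ p₂ : ℝ≥0∞} (h1 : 1 < p₁) (h1' : p₁ ≠ ∞) (h2 : 1 < p₂) (h2' : p₂ ≠ ∞)
    (hd : 0 < d) {F₁ F₂ : Eu d → ℂ} (hF₁ : MemLp F₁ p₁ volume) (hF₂ : MemLp F₂ p₂ volume)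
    (h0 : ∀ φ ∈ flatSchwartz d, ∫ x, (F₁ x - F₂ x) * (𝓕 φ) x = 0) : F₁ =ᵐ[volume] F₂ := by
  have hint : ∀ φ : 𝓢(Eu d, ℂ), Integrable (fun x => (F₁ x - F₂ x) * φ x) := fun φ => by
    simp only [sub_mul]
    exact (MemLp.integrable_mul_schwartz h1.le hF₁ φ).sub (MemLp.integrable_mul_schwartz h2.le hF₂ φ)
  have := ae_eq_zero_of_integral_mul_fourier hint fun ψ => by
    have hlim := (tendsto_integral_mul_fourier_lowPart h1 h1' hF₁ ψ hd).sub
      (tendsto_integral_mul_fourier_lowPart h2 h2' hF₂ ψ hd)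
    rw [sub_zero] at hlim
    refine tendsto_nhds_unique (tendsto_const_nhds.congr fun n => ?_) hlim
    rw [← integral_sub (MemLp.integrable_mul_schwartz h1.le hF₁ _)
      (MemLp.integrable_mul_schwartz h2.le hF₂ _)]
    have h3 := h0 _ (sub_lowPart_mem_flat (c := (n : ℝ) + 1) (by positivity) ψ)
    have h4 : ∀ x, (𝓕 (ψ - lowPart ((n : ℝ) + 1) (by positivity) ψ)) x
        = (𝓕 ψ) x - (𝓕 (lowPart ((n : ℝ) + 1) (by positivity) ψ)) x := fun x => by
      rw [← FourierTransform.fourierCLM_apply (R := ℂ), map_sub]; rfl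
    simp only [h4, mul_sub] at h3
    rw [integral_sub (hint _) (hint _), sub_eq_zero] at h3
    rw [h3]
    exact integral_congr_ae (Eventually.of_forall fun x => by simp only [sub_mul])
  filter_upwards [this] with x hx using sub_eq_zero.mp hx

/-! ### Homogeneous Sobolev norms as `L²` norms on the Fourier side -/

/-- The Hilbert space `L²(ℝ^d; ℂ)`. -/
abbrev L2 (d : ℕ) : Type := Lp ℂ 2 (volume : Measure (Eu d))

/-- The symbol `(2π|ξ|)^γ` of `|∇|^γ`. -/
def sym (γ : ℝ) (ξ : Eu d) : ℂ := (((2 * Real.pi * ‖ξ‖) ^ γ : ℝ) : ℂ)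

theorem norm_sym (γ : ℝ) (ξ : Eu d) : ‖sym γ ξ‖ = (2 * Real.pi * ‖ξ‖) ^ γ := by
  rw [sym, Complex.norm_real, Real.norm_of_nonneg (by positivity)]

theorem measurable_sym (γ : ℝ) : Measurable (sym γ : Eu d → ℂ) := by
  unfold sym
  exact Complex.measurable_ofReal.comp ((measurable_norm.const_mul _).pow_const _)

theorem ae_ne_zero (hd : 0 < d) : ∀ᵐ x ∂(volume : Measure (Eu d)), x ≠ 0 := by
  have : NeZero d := ⟨hd.ne'⟩
  simp [ae_iff, measure_singleton]

theorem sym_ne_zero (γ : ℝ) {ξ : Eu d} (hξ : ξ ≠ 0) : sym γ ξ ≠ 0 := by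
  rw [← norm_ne_zero_iff, norm_sym]
  have : 0 < ‖ξ‖ := norm_pos_iff.mpr hξ
  positivity

theorem sym_add (γ δ : ℝ) {ξ : Eu d} (hξ : ξ ≠ 0) : sym (γ + δ) ξ = sym γ ξ * sym δ ξ := by
  have : 0 < ‖ξ‖ := norm_pos_iff.mpr hξ
  rw [sym, sym, sym, Real.rpow_add (by positivity)]
  push_cast; rfl

/-- The Fourier transform of `f` away from the origin; the zero function if it is not a
function. -/
def ft (f : Eu d → ℂ) : Eu d → ℂ :=
  open Classical in if H : ∃ h, HasFourierAway f h then H.choose else 0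

theorem hasFourierAway_ft {f : Eu d → ℂ} (H : ∃ h, HasFourierAway f h) :
    HasFourierAway f (ft f) := by
  rw [ft, dif_pos H]
  exact H.choose_spec

theorem ft_ae_eq (hd : 0 < d) {f h : Eu d → ℂ} (hf : HasFourierAway f h) : ft f =ᵐ[volume] h :=
  (hasFourierAway_ft ⟨h, hf⟩).unique hd hf

theorem hdotNorm_eq (hd : 0 < d) (γ : ℝ) {f h : Eu d → ℂ} (hf : HasFourierAway f h) :
    hdotNorm γ f = eLpNorm (fun ξ => sym γ ξ * h ξ) 2 volume := by
  refine le_antisymm (iInf₂_le h hf) (le_iInf₂ fun k hk => le_of_eq ?_)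
  exact eLpNorm_congr_ae ((hf.unique hd hk).mono fun x hx => by simp only [hx, sym])

theorem exists_of_hdotNorm_lt_top {γ : ℝ} {f : Eu d → ℂ} (hf : hdotNorm γ f < ∞) :
    ∃ h, HasFourierAway f h := by
  by_contra! H
  rw [hdotNorm] at hf
  simp [H] at hf

theorem hasFourierAway_of_lt_top {γ : ℝ} {f : Eu d → ℂ} (hf : hdotNorm γ f < ∞) :
    HasFourierAway f (ft f) := hasFourierAway_ft (exists_of_hdotNorm_lt_top hf)

theorem memLp_sym_mul_iff (hd : 0 < d) {γ : ℝ} {f h : Eu d → ℂ} (hf : HasFourierAway f h) :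
    MemLp (fun ξ => sym γ ξ * h ξ) 2 volume ↔ hdotNorm γ f < ∞ := by
  rw [hdotNorm_eq hd γ hf]
  exact ⟨fun h => h.2, fun h => ⟨(measurable_sym γ).aestronglyMeasurable.mul hf.meas_right, h⟩⟩

theorem memLp_sym_mul_ft (hd : 0 < d) {γ : ℝ} {f : Eu d → ℂ} (hf : hdotNorm γ f < ∞) :
    MemLp (fun ξ => sym γ ξ * ft f ξ) 2 volume :=
  (memLp_sym_mul_iff hd (hasFourierAway_of_lt_top hf)).mpr hf

/-- The element `(2π|ξ|)^γ f̂` of `L²`, whose norm is the `Ḣ^γ` norm of `f`; zero if `f` is not in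
`Ḣ^γ`. -/
def eh (γ : ℝ) (f : Eu d → ℂ) : L2 d :=
  open Classical in
  if H : MemLp (fun ξ => sym γ ξ * ft f ξ) 2 volume then H.toLp else 0

section eh
variable {γ : ℝ} {f g : Eu d → ℂ}

theorem coe_eh (hd : 0 < d) (hf : hdotNorm γ f < ∞) :
    eh γ f =ᵐ[volume] fun ξ => sym γ ξ * ft f ξ := by
  rw [eh, dif_pos (memLp_sym_mul_ft hd hf)]
  exact MemLp.coeFn_toLp _

theorem hdotNorm_eq_norm_eh (hd : 0 < d) (hf : hdotNorm γ f < ∞) :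
    hdotNorm γ f = ENNReal.ofReal ‖eh γ f‖ := by
  rw [ofReal_norm, Lp.enorm_def, eLpNorm_congr_ae (coe_eh hd hf)]
  exact hdotNorm_eq hd γ (hasFourierAway_of_lt_top hf)

theorem toReal_hdotNorm (hd : 0 < d) (hf : hdotNorm γ f < ∞) :
    (hdotNorm γ f).toReal = ‖eh γ f‖ := by
  rw [hdotNorm_eq_norm_eh hd hf, ENNReal.toReal_ofReal (norm_nonneg _)]

theorem eh_eq_of_ae (hd : 0 < d) {h : Eu d → ℂ} (hf : HasFourierAway f h) (hfin : hdotNorm γ f < ∞)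
    {G : L2 d} (hG : G =ᵐ[volume] fun ξ => sym γ ξ * h ξ) : eh γ f = G := by
  refine Lp.ext ?_
  filter_upwards [coe_eh hd hfin, hG, ft_ae_eq hd hf] with ξ h1 h2 h3
  rw [h1, h2, h3]

theorem hdotNorm_add_lt_top (hd : 0 < d) (hf : hdotNorm γ f < ∞) (hg : hdotNorm γ g < ∞) :
    hdotNorm γ (f + g) < ∞ := by
  rw [← memLp_sym_mul_iff hd ((hasFourierAway_of_lt_top hf).add (hasFourierAway_of_lt_top hg))]
  refine ((memLp_sym_mul_ft hd hf).add (memLp_sym_mul_ft hd hg)).ae_eq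
    (Eventually.of_forall fun ξ => ?_)
  simp only [Pi.add_apply, mul_add]

theorem eh_add (hd : 0 < d) (hf : hdotNorm γ f < ∞) (hg : hdotNorm γ g < ∞) :
    eh γ (f + g) = eh γ f + eh γ g := by
  refine eh_eq_of_ae hd ((hasFourierAway_of_lt_top hf).add (hasFourierAway_of_lt_top hg))
    (hdotNorm_add_lt_top hd hf hg) ?_
  filter_upwards [Lp.coeFn_add (eh γ f) (eh γ g), coe_eh hd hf, coe_eh hd hg] with ξ h1 h2 h3
  rw [h1, Pi.add_apply, h2, h3, Pi.add_apply, mul_add]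

theorem hdotNorm_smul_lt_top (hd : 0 < d) (c : ℂ) (hf : hdotNorm γ f < ∞) :
    hdotNorm γ (c • f) < ∞ := by
  rw [← memLp_sym_mul_iff hd ((hasFourierAway_of_lt_top hf).smul c)]
  refine ((memLp_sym_mul_ft hd hf).const_smul c).ae_eq (Eventually.of_forall fun ξ => ?_)
  simp only [Pi.smul_apply, smul_eq_mul]
  ring

theorem eh_smul (hd : 0 < d) (c : ℂ) (hf : hdotNorm γ f < ∞) : eh γ (c • f) = c • eh γ f := by
  refine eh_eq_of_ae hd ((hasFourierAway_of_lt_top hf).smul c) (hdotNorm_smul_lt_top hd c hf) ?_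
  filter_upwards [Lp.coeFn_smul c (eh γ f), coe_eh hd hf] with ξ h1 h2
  rw [h1, Pi.smul_apply, h2, Pi.smul_apply, smul_eq_mul, smul_eq_mul]
  ring

theorem sub_eq_add_neg_one_smul (f g : Eu d → ℂ) : f - g = f + (-1 : ℂ) • g := by
  rw [neg_smul, one_smul, sub_eq_add_neg]

theorem hdotNorm_sub_lt_top (hd : 0 < d) (hf : hdotNorm γ f < ∞) (hg : hdotNorm γ g < ∞) :
    hdotNorm γ (f - g) < ∞ := by
  rw [sub_eq_add_neg_one_smul]
  exact hdotNorm_add_lt_top hd hf (hdotNorm_smul_lt_top hd _ hg)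

theorem eh_sub (hd : 0 < d) (hf : hdotNorm γ f < ∞) (hg : hdotNorm γ g < ∞) :
    eh γ (f - g) = eh γ f - eh γ g := by
  rw [sub_eq_add_neg_one_smul, eh_add hd hf (hdotNorm_smul_lt_top hd _ hg), eh_smul hd _ hg,
    neg_smul, one_smul, sub_eq_add_neg]

theorem hdotNorm_congr (h : f =ᵐ[volume] g) : hdotNorm γ f = hdotNorm γ g := by
  have key : ∀ {f g : Eu d → ℂ}, f =ᵐ[volume] g → hdotNorm γ f ≤ hdotNorm γ g := fun h =>
    le_iInf₂ fun k hk => iInf₂_le k (hk.congr h.symm (ae_eq_refl k))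
  exact le_antisymm (key h) (key h.symm)

theorem eh_congr (hd : 0 < d) (hf : hdotNorm γ f < ∞) (h : f =ᵐ[volume] g) : eh γ f = eh γ g := by
  have hg : hdotNorm γ g < ∞ := by rwa [← hdotNorm_congr h]
  exact eh_eq_of_ae hd ((hasFourierAway_of_lt_top hg).congr h.symm (ae_eq_refl _)) hf (coe_eh hd hg)

theorem hasFourierAway_translate (hf : hdotNorm γ f < ∞) (y : Eu d) :
    HasFourierAway (fun x => f (x + y)) (fun ξ => chr y ξ * ft f ξ) :=
  (hasFourierAway_of_lt_top hf).translate y fun _ hφ => chrMul_mem_flat y hφ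

theorem hdotNorm_translate (hd : 0 < d) (hf : hdotNorm γ f < ∞) (y : Eu d) :
    hdotNorm γ (fun x => f (x + y)) = hdotNorm γ f := by
  rw [hdotNorm_eq hd γ (hasFourierAway_translate hf y),
    hdotNorm_eq hd γ (hasFourierAway_of_lt_top hf)]
  refine eLpNorm_congr_norm_ae (Eventually.of_forall fun ξ => ?_)
  simp

theorem coe_eh_translate (hd : 0 < d) (hf : hdotNorm γ f < ∞) (y : Eu d) :
    eh γ (fun x => f (x + y)) =ᵐ[volume] fun ξ => chr y ξ * eh γ f ξ := by
  have h1 : hdotNorm γ (fun x => f (x + y)) < ∞ := by rwa [hdotNorm_translate hd hf y]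
  filter_upwards [coe_eh hd h1, coe_eh hd hf, ft_ae_eq hd (hasFourierAway_translate hf y)]
    with ξ h2 h3 h4
  rw [h2, h3, h4]; ring

end eh

/-! ### Plancherel's identity for differences -/

/-- The `L²` Fourier transform is a Fourier transform in the sense of `HasFourierOn`. -/
theorem hasFourierOn_fourierInv (g : L2 d) :
    HasFourierOn Set.univ ((𝓕⁻ g : L2 d) : Eu d → ℂ) (g : Eu d → ℂ) where
  meas_left := (Lp.memLp _).1
  tempered φ := MemLp.integrable_mul_schwartz one_le_two (Lp.memLp _) φ
  meas_right := (Lp.memLp _).1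
  integrable φ _ := MemLp.integrable_mul_schwartz one_le_two (Lp.memLp _) φ
  pairing φ _ := by
    have h1 := congrArg (fun (T : 𝓢'(Eu d, ℂ)) => T (𝓕 φ)) (Lp.fourierInv_toTemperedDistribution_eq g)
    simp only [TemperedDistribution.fourierInv_apply, FourierTransform.fourierInv_fourier_eq,
      Lp.toTemperedDistribution_apply, smul_eq_mul] at h1
    simp only [mul_comm _ (φ _), mul_comm _ ((𝓕 φ) _)]
    exact h1.symm

theorem norm_chr_sub_one_le (y ξ : Eu d) : ‖chr y ξ - 1‖ ≤ 2 * Real.pi * ‖y‖ * ‖ξ‖ := by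
  have h1 := Real.norm_exp_I_mul_ofReal_sub_one_le (x := 2 * Real.pi * inner ℝ y ξ)
  rw [chr, Real.fourierChar_apply, mul_comm]
  refine h1.trans ?_
  rw [norm_mul, Real.norm_of_nonneg (by positivity : (0:ℝ) ≤ 2 * Real.pi), mul_assoc (2 * Real.pi)]
  gcongr
  exact norm_inner_le_norm y ξ

theorem norm_chr_sub_one_le_two (y ξ : Eu d) : ‖chr y ξ - 1‖ ≤ 2 := by
  refine (norm_sub_le _ _).trans ?_
  simp; norm_num

theorem min_one_le_rpow {x s : ℝ} (hx : 0 ≤ x) (hs0 : 0 ≤ s) (hs1 : s ≤ 1) : min 1 x ≤ x ^ s := by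
  rcases le_total x 1 with h | h
  · rw [min_eq_right h]
    calc x = x ^ (1 : ℝ) := (Real.rpow_one x).symm
      _ ≤ x ^ s := Real.rpow_le_rpow_of_exponent_ge' hx h hs0 hs1
  · rw [min_eq_left h]; exact Real.one_le_rpow h hs0

/-- The bound that makes the differences `f(· + y) - f` of a function in `Ḣ^s` square integrable;
this is where `s ≤ 1` is used. -/
theorem norm_chr_sub_one_le_sym {s : ℝ} (hs0 : 0 ≤ s) (hs1 : s ≤ 1) (y ξ : Eu d) :
    ‖chr y ξ - 1‖ ≤ 2 * ‖y‖ ^ s * ‖sym s ξ‖ := by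
  have h1 : ‖chr y ξ - 1‖ ≤ 2 * min 1 (‖y‖ * (2 * Real.pi * ‖ξ‖)) := by
    rw [mul_min_of_nonneg _ _ zero_le_two]
    refine le_min (by simpa using norm_chr_sub_one_le_two y ξ)
      ((norm_chr_sub_one_le y ξ).trans ?_)
    have : 0 ≤ ‖y‖ * (2 * Real.pi * ‖ξ‖) := by positivity
    linarith
  refine h1.trans ?_
  rw [norm_sym, mul_assoc 2 (‖y‖ ^ s), ← Real.mul_rpow (norm_nonneg _) (by positivity)]
  gcongr
  exact min_one_le_rpow (by positivity) hs0 hs1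

/-- Plancherel's identity for `f(· + y) - f`. The function `f` itself need not be in `L²`; the
difference is identified with the inverse Fourier transform of `(e^{2πi y·ξ} - 1) f̂ ∈ L²` by
`ae_eq_zero_of_flat`. -/
theorem eLpNorm_translate_sub {q : ℝ≥0∞} (hq1 : 1 < q) (hq : q ≠ ∞) (hd : 0 < d) {s : ℝ}
    (hs0 : 0 ≤ s) (hs1 : s ≤ 1) {f : Eu d → ℂ} (hf : MemLp f q volume) (hfs : hdotNorm s f < ∞)
    (y : Eu d) :
    eLpNorm (fun x => f (x + y) - f x) 2 volume
      = eLpNorm (fun ξ => (chr y ξ - 1) * ft f ξ) 2 volume := by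
  have hA := hasFourierAway_of_lt_top hfs
  have hk : MemLp (fun ξ => (chr y ξ - 1) * ft f ξ) 2 volume := by
    refine MemLp.of_le_mul (c := 2 * ‖y‖ ^ s) (memLp_sym_mul_ft hd hfs)
      ((((continuous_chr y).sub continuous_const).aestronglyMeasurable).mul hA.meas_right)
      (Eventually.of_forall fun ξ => ?_)
    rw [norm_mul, norm_mul, ← mul_assoc]
    gcongr
    exact norm_chr_sub_one_le_sym hs0 hs1 y ξ
  have h1 := (hasFourierAway_translate hfs y).sub hA
  have h2 := (hasFourierOn_fourierInv hk.toLp).mono (Set.subset_univ (flatSchwartz d))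
  have hft : MemLp (fun x => f (x + y) - f x) q volume :=
    (hf.comp_measurePreserving (measurePreserving_add_right volume y)).sub hf
  have h3 := ae_eq_zero_of_flat hq1 hq ENNReal.one_lt_two ENNReal.ofNat_ne_top hd hft
    (Lp.memLp (𝓕⁻ hk.toLp : L2 d)) fun φ hφ => by
      simp only [sub_mul (f _ - f _)]
      rw [integral_sub (MemLp.integrable_mul_schwartz hq1.le hft _)
        (MemLp.integrable_mul_schwartz one_le_two (Lp.memLp _) _), h2.pairing φ hφ, sub_eq_zero]
      refine (h1.pairing φ hφ).trans (integral_congr_ae ?_)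
      filter_upwards [hk.coeFn_toLp] with ξ hξ
      rw [hξ, Pi.sub_apply]; ring
  rw [eLpNorm_congr_ae h3, ← eLpNorm_congr_ae hk.coeFn_toLp, ← Lp.enorm_def, ← Lp.enorm_def,
    ← ofReal_norm, ← ofReal_norm]
  congr 1
  exact (Lp.fourierTransformₗᵢ (Eu d) ℂ).symm.norm_map _

/-- On `L^q` the seminorm of `Ḣ^γ` is a norm, as `L^q` contains no polynomials. -/
theorem ae_eq_zero_of_eh_eq_zero {q : ℝ≥0∞} (hq1 : 1 < q) (hq : q ≠ ∞) (hd : 0 < d) {γ : ℝ}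
    {f : Eu d → ℂ} (hf : MemLp f q volume) (hfs : hdotNorm γ f < ∞) (h0 : eh γ f = 0) :
    f =ᵐ[volume] 0 := by
  have hft : ft f =ᵐ[volume] 0 := by
    have h1 := coe_eh hd hfs
    rw [h0] at h1
    filter_upwards [h1, Lp.coeFn_zero ℂ 2 (volume : Measure (Eu d)), ae_ne_zero hd] with ξ h2 h3 h4
    rw [h3] at h2
    exact (mul_eq_zero.mp h2.symm).resolve_left (sym_ne_zero γ h4)
  refine ae_eq_zero_of_flat hq1 hq hq1 hq hd hf MemLp.zero fun φ hφ => ?_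
  simp only [Pi.zero_apply, sub_zero]
  rw [(hasFourierAway_of_lt_top hfs).pairing φ hφ]
  refine integral_eq_zero_of_ae ?_
  filter_upwards [hft] with ξ hξ
  simp [hξ]

/-! ### From level sets to Lebesgue norms -/

theorem lintegral_Ioc_rpow {a t₀ : ℝ} (ha : -1 < a) (ht : 0 < t₀) :
    ∫⁻ t in Set.Ioc 0 t₀, ENNReal.ofReal (t ^ a) = ENNReal.ofReal (t₀ ^ (a + 1) / (a + 1)) := by
  have h1 : IntervalIntegrable (fun t : ℝ => t ^ a) volume 0 t₀ :=
    intervalIntegral.intervalIntegrable_rpow' ha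
  rw [← ofReal_integral_eq_lintegral_ofReal h1.1]
  · rw [← intervalIntegral.integral_of_le ht.le, integral_rpow (Or.inl ha),
      Real.zero_rpow (by linarith), sub_zero]
  · filter_upwards [ae_restrict_mem measurableSet_Ioc] with t ht
    exact Real.rpow_nonneg ht.1.le _

theorem lintegral_Ioi_rpow {a t₀ : ℝ} (ha : a < -1) (ht : 0 < t₀) :
    ∫⁻ t in Set.Ioi t₀, ENNReal.ofReal (t ^ a) = ENNReal.ofReal (-t₀ ^ (a + 1) / (a + 1)) := by
  rw [← ofReal_integral_eq_lintegral_ofReal (integrableOn_Ioi_rpow_of_lt ha ht),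
    integral_Ioi_rpow_of_lt ha ht]
  filter_upwards [ae_restrict_mem measurableSet_Ioi] with t ht'
  exact Real.rpow_nonneg (ht.trans ht').le _

/-- The constant of the level-set estimate `lintegral_rpow_le_of_splitting`. -/
def levelConst (γ β K : ℝ) : ℝ :=
  4 * (β + 2) * K * (1 / β + 1 / (β / γ - β)) * 2 ^ β

theorem levelConst_nonneg {γ β K : ℝ} (hγ0 : 0 < γ) (hγ1 : γ < 1) (hβ : 0 < β) (hK : 0 ≤ K) :
    0 ≤ levelConst γ β K := by
  have h1 : 0 < β / γ - β := by
    rw [sub_pos, lt_div_iff₀ hγ0]; nlinarith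
  unfold levelConst
  positivity

/-- The integral of the weight `t^{β-1} min(1, x² (t / 2A)^{-β/γ})` is at most a multiple of
`A^β x^{2γ}`. The integral converges at zero as `β > 0` and at infinity as `γ < 1`. -/
theorem lintegral_weight_le {γ β A K x : ℝ} (hγ0 : 0 < γ) (hγ1 : γ < 1) (hβ : 0 < β) (hA : 0 < A)
    (hK : 0 ≤ K) (hx : 0 < x) :
    ∫⁻ t in Set.Ioi (0 : ℝ), ENNReal.ofReal (t ^ (β - 1)) *
        ENNReal.ofReal (K * min 1 ((x / (t / (2 * A)) ^ (β / (2 * γ))) ^ 2))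
      ≤ ENNReal.ofReal (K * (1 / β + 1 / (β / γ - β)) * (2 * A) ^ β * x ^ (2 * γ)) := by
  have h1 : 0 < β / γ - β := by
    rw [sub_pos, lt_div_iff₀ hγ0]; nlinarith
  -- the point at which the minimum switches from `1` to the other term
  set t₀ : ℝ := 2 * A * x ^ (2 * γ / β) with ht₀
  have ht₀pos : 0 < t₀ := by positivity
  have e1 : t₀ ^ β = (2 * A) ^ β * x ^ (2 * γ) := by
    rw [ht₀, Real.mul_rpow (by positivity) (by positivity), ← Real.rpow_mul hx.le]
    congr 2; field_simp
  have e2 : t₀ ^ (β - β / γ) * (2 * A) ^ (β / γ) * x ^ 2 = (2 * A) ^ β * x ^ (2 * γ) := by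
    have e3 : (2 * A) ^ β = (2 * A) ^ (β - β / γ) * (2 * A) ^ (β / γ) := by
      rw [← Real.rpow_add (by positivity)]; congr 1; ring
    have e4 : x ^ (2 * γ) = x ^ (2 * γ / β * (β - β / γ)) * x ^ 2 := by
      rw [← Real.rpow_natCast x 2, ← Real.rpow_add hx]; congr 1; push_cast; field_simp; ring
    rw [ht₀, Real.mul_rpow (by positivity) (by positivity), ← Real.rpow_mul hx.le, e3, e4]
    ring
  rw [← Set.Ioc_union_Ioi_eq_Ioi ht₀pos.le,
    lintegral_union measurableSet_Ioi (Set.Ioc_disjoint_Ioi le_rfl)]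
  have b1 : ∫⁻ t in Set.Ioc 0 t₀, ENNReal.ofReal (t ^ (β - 1)) *
        ENNReal.ofReal (K * min 1 ((x / (t / (2 * A)) ^ (β / (2 * γ))) ^ 2))
      ≤ ENNReal.ofReal (K * ((2 * A) ^ β * x ^ (2 * γ)) / β) := by
    calc _ ≤ ∫⁻ t in Set.Ioc 0 t₀, ENNReal.ofReal (t ^ (β - 1)) * ENNReal.ofReal K := by
          refine lintegral_mono fun t => ?_
          gcongr
          exact mul_le_of_le_one_right hK (min_le_left _ _)
      _ = _ := by
          rw [lintegral_mul_const' _ _ ENNReal.ofReal_ne_top, lintegral_Ioc_rpow (by linarith) ht₀pos,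
            ← ENNReal.ofReal_mul (by rw [sub_add_cancel]; positivity), sub_add_cancel, e1]
          congr 1; ring
  have b2 : ∫⁻ t in Set.Ioi t₀, ENNReal.ofReal (t ^ (β - 1)) *
        ENNReal.ofReal (K * min 1 ((x / (t / (2 * A)) ^ (β / (2 * γ))) ^ 2))
      ≤ ENNReal.ofReal (K * ((2 * A) ^ β * x ^ (2 * γ)) / (β / γ - β)) := by
    calc _ ≤ ∫⁻ t in Set.Ioi t₀, ENNReal.ofReal (t ^ (β - β / γ - 1)) *
            ENNReal.ofReal (K * (x ^ 2 * (2 * A) ^ (β / γ))) := by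
          refine setLIntegral_mono' measurableSet_Ioi fun t ht => ?_
          have htpos : 0 < t := ht₀pos.trans ht
          rw [← ENNReal.ofReal_mul (by positivity), ← ENNReal.ofReal_mul (by positivity)]
          refine ENNReal.ofReal_le_ofReal ?_
          calc t ^ (β - 1) * (K * min 1 ((x / (t / (2 * A)) ^ (β / (2 * γ))) ^ 2))
              ≤ t ^ (β - 1) * (K * ((x / (t / (2 * A)) ^ (β / (2 * γ))) ^ 2)) := by
                gcongr; exact min_le_right _ _
            _ = t ^ (β - β / γ - 1) * (K * (x ^ 2 * (2 * A) ^ (β / γ))) := by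
                have e3 : ((t / (2 * A)) ^ (β / (2 * γ))) ^ 2 = t ^ (β / γ) / (2 * A) ^ (β / γ) := by
                  rw [← Real.rpow_natCast, ← Real.rpow_mul (by positivity),
                    ← Real.div_rpow htpos.le (by positivity)]
                  congr 1; push_cast; field_simp
                have e4 : t ^ (β - 1) = t ^ (β - β / γ - 1) * t ^ (β / γ) := by
                  rw [← Real.rpow_add htpos]; congr 1; ring
                rw [div_pow, e3, e4]
                have : 0 < t ^ (β / γ) := by positivity
                field_simp
      _ = _ := by
          rw [lintegral_mul_const' _ _ ENNReal.ofReal_ne_top, lintegral_Ioi_rpow (by linarith) ht₀pos,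
            sub_add_cancel, neg_div, ← div_neg, neg_sub, ← ENNReal.ofReal_mul (by positivity)]
          congr 1
          rw [← e2]; ring
  refine (add_le_add b1 b2).trans (le_of_eq ?_)
  rw [← ENNReal.ofReal_add (by positivity) (by positivity)]
  congr 1; ring

/-- If for every `R > 0` the function `f` is the sum of a function bounded by `A R^{2γ/β}` and
of a function whose `L²` norm is controlled by the frequencies `≳ R` of `h`, then the
`L^{β+2}` norm of `f` is controlled by `A` and the `L²` norm of `|ξ|^γ h`: the level set
`{|f| > t}` is estimated by Chebyshev's inequality, with `R` chosen so that the bounded part is at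
most `t / 2`. -/
theorem lintegral_rpow_le_of_splitting {γ β A K : ℝ} (hd : 0 < d) (hγ0 : 0 < γ) (hγ1 : γ < 1)
    (hβ : 0 < β) (hA : 0 < A) (hK : 0 ≤ K) {f h : Eu d → ℂ} (hf : AEStronglyMeasurable f volume)
    (hh : AEStronglyMeasurable h volume)
    (H : ∀ R : ℝ, 0 < R → ∃ w : Eu d → ℂ, AEStronglyMeasurable w volume ∧
      (∀ᵐ x, ‖f x - w x‖ ≤ A * R ^ (2 * γ / β)) ∧
      ∫⁻ x, ‖w x‖ₑ ^ (2 : ℝ) ≤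
        ∫⁻ ξ, ENNReal.ofReal (K * min 1 ((‖ξ‖ / R) ^ 2)) * ‖h ξ‖ₑ ^ (2 : ℝ)) :
    ∫⁻ x, ‖f x‖ₑ ^ (β + 2) ≤ ENNReal.ofReal (levelConst γ β K * A ^ β) *
      ∫⁻ ξ, ENNReal.ofReal (‖ξ‖ ^ (2 * γ)) * ‖h ξ‖ₑ ^ (2 : ℝ) := by
  have h1 : 0 < β / γ - β := by
    rw [sub_pos, lt_div_iff₀ hγ0]; nlinarith
  -- the choice `A R^{2γ/β} = t / 2` of the threshold at the level `t`
  set R : ℝ → ℝ := fun t => (t / (2 * A)) ^ (β / (2 * γ)) with hR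
  have hlevel : ∀ t : ℝ, 0 < t → volume {x | t < ‖f x‖} * ENNReal.ofReal (t ^ (β + 2 - 1))
      ≤ 4 * ∫⁻ ξ, ENNReal.ofReal (t ^ (β - 1)) *
        (ENNReal.ofReal (K * min 1 ((‖ξ‖ / R t) ^ 2)) * ‖h ξ‖ₑ ^ (2 : ℝ)) := by
    intro t ht
    obtain ⟨w, hw, hfw, hw2⟩ := H (R t) (by positivity)
    have hRt : A * R t ^ (2 * γ / β) = t / 2 := by
      rw [hR, ← Real.rpow_mul (by positivity)]
      have : β / (2 * γ) * (2 * γ / β) = 1 := by field_simp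
      rw [this, Real.rpow_one]; field_simp
    have hsub : volume {x | t < ‖f x‖}
        ≤ volume {x | ENNReal.ofReal ((t / 2) ^ (2 : ℝ)) ≤ ‖w x‖ₑ ^ (2 : ℝ)} := by
      refine measure_mono_ae (hfw.mono fun x hx hfx => ?_)
      have hfx' : t < ‖f x‖ := hfx
      rw [hRt] at hx
      have h2 : t / 2 ≤ ‖w x‖ := by
        have := norm_sub_norm_le (f x) (w x)
        linarith
      change ENNReal.ofReal ((t / 2) ^ (2 : ℝ)) ≤ ‖w x‖ₑ ^ (2 : ℝ)
      rw [← ofReal_norm, ENNReal.ofReal_rpow_of_nonneg (norm_nonneg _) zero_le_two]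
      exact ENNReal.ofReal_le_ofReal (by gcongr)
    have hcheb := mul_meas_ge_le_lintegral₀ (hw.enorm.pow_const (2 : ℝ))
      (ENNReal.ofReal ((t / 2) ^ (2 : ℝ)))
    have hsplit : ENNReal.ofReal (t ^ (β + 2 - 1))
        = 4 * ENNReal.ofReal (t ^ (β - 1)) * ENNReal.ofReal ((t / 2) ^ (2 : ℝ)) := by
      have h4 : (4 : ℝ≥0∞) = ENNReal.ofReal 4 := by norm_num
      rw [h4, ← ENNReal.ofReal_mul (by norm_num), ← ENNReal.ofReal_mul (by positivity)]
      congr 1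
      have : β + 2 - 1 = (β - 1) + 2 := by ring
      rw [this, Real.rpow_add ht, Real.div_rpow ht.le zero_le_two]
      norm_num; ring
    calc volume {x | t < ‖f x‖} * ENNReal.ofReal (t ^ (β + 2 - 1))
        ≤ volume {x | ENNReal.ofReal ((t / 2) ^ (2 : ℝ)) ≤ ‖w x‖ₑ ^ (2 : ℝ)}
            * ENNReal.ofReal (t ^ (β + 2 - 1)) := by gcongr
      _ = 4 * (ENNReal.ofReal (t ^ (β - 1)) * (ENNReal.ofReal ((t / 2) ^ (2 : ℝ)) *
            volume {x | ENNReal.ofReal ((t / 2) ^ (2 : ℝ)) ≤ ‖w x‖ₑ ^ (2 : ℝ)})) := by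
          rw [hsplit]; ring
      _ ≤ 4 * (ENNReal.ofReal (t ^ (β - 1)) *
            ∫⁻ ξ, ENNReal.ofReal (K * min 1 ((‖ξ‖ / R t) ^ 2)) * ‖h ξ‖ₑ ^ (2 : ℝ)) := by
          gcongr; exact hcheb.trans hw2
      _ = _ := by rw [lintegral_const_mul' _ _ ENNReal.ofReal_ne_top]
  have hcake : ∫⁻ x, ‖f x‖ₑ ^ (β + 2) = ENNReal.ofReal (β + 2) *
      ∫⁻ t in Set.Ioi (0 : ℝ), volume {x | t < ‖f x‖} * ENNReal.ofReal (t ^ (β + 2 - 1)) := by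
    rw [← lintegral_rpow_eq_lintegral_meas_lt_mul volume (Eventually.of_forall fun x => norm_nonneg _)
      hf.norm.aemeasurable (by linarith)]
    refine lintegral_congr fun x => ?_
    rw [← ofReal_norm, ENNReal.ofReal_rpow_of_nonneg (norm_nonneg _) (by linarith)]
  have hmeas : AEMeasurable (fun z : ℝ × Eu d => ENNReal.ofReal (z.1 ^ (β - 1)) *
      (ENNReal.ofReal (K * min 1 ((‖z.2‖ / R z.1) ^ 2)) * ‖h z.2‖ₑ ^ (2 : ℝ)))
      ((volume.restrict (Set.Ioi (0 : ℝ))).prod volume) := by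
    refine AEMeasurable.mul (Measurable.aemeasurable ?_)
      (AEMeasurable.mul (Measurable.aemeasurable ?_) ?_)
    · exact (measurable_fst.pow_const _).ennreal_ofReal
    · refine Measurable.ennreal_ofReal (Measurable.const_mul ?_ _)
      refine measurable_const.min (Measurable.pow_const ?_ 2)
      exact (measurable_norm.comp measurable_snd).div ((measurable_fst.div_const _).pow_const _)
    · exact (hh.enorm.comp_snd).pow_const _
  calc ∫⁻ x, ‖f x‖ₑ ^ (β + 2)
      ≤ ENNReal.ofReal (β + 2) * ∫⁻ t in Set.Ioi (0 : ℝ), 4 * ∫⁻ ξ, ENNReal.ofReal (t ^ (β - 1)) *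
        (ENNReal.ofReal (K * min 1 ((‖ξ‖ / R t) ^ 2)) * ‖h ξ‖ₑ ^ (2 : ℝ)) := by
        rw [hcake]
        gcongr 1
        exact setLIntegral_mono' measurableSet_Ioi fun t ht => hlevel t ht
    _ = ENNReal.ofReal (β + 2) * (4 * ∫⁻ ξ, (∫⁻ t in Set.Ioi (0 : ℝ), ENNReal.ofReal (t ^ (β - 1)) *
        ENNReal.ofReal (K * min 1 ((‖ξ‖ / R t) ^ 2))) * ‖h ξ‖ₑ ^ (2 : ℝ)) := by
        rw [lintegral_const_mul' _ _ (by norm_num), lintegral_lintegral_swap hmeas]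
        congr 2
        refine lintegral_congr fun ξ => ?_
        rw [← lintegral_mul_const' _ _ (by simp)]
        exact lintegral_congr fun t => by ring
    _ ≤ ENNReal.ofReal (β + 2) * (4 * ∫⁻ ξ, ENNReal.ofReal (K * (1 / β + 1 / (β / γ - β)) * (2 * A) ^ β)
          * (ENNReal.ofReal (‖ξ‖ ^ (2 * γ)) * ‖h ξ‖ₑ ^ (2 : ℝ))) := by
        gcongr 2
        refine lintegral_mono_ae ((ae_ne_zero hd).mono fun ξ hξ => ?_)
        rw [← mul_assoc, ← ENNReal.ofReal_mul (by positivity)]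
        gcongr
        exact lintegral_weight_le hγ0 hγ1 hβ hA hK (norm_pos_iff.mpr hξ)
    _ = _ := by
        rw [lintegral_const_mul' _ _ ENNReal.ofReal_ne_top, ← mul_assoc, ← mul_assoc]
        congr 1
        have h4 : (4 : ℝ≥0∞) = ENNReal.ofReal 4 := by norm_num
        rw [h4, ← ENNReal.ofReal_mul (by positivity), ← ENNReal.ofReal_mul (by positivity)]
        congr 1
        rw [levelConst, Real.mul_rpow zero_le_two hA.le]
        ring

/-! ### Lebesgue norms as real integrals -/

/-- The integral `∫ |f|^p`, that is, `‖f‖_p^p` for `f ∈ L^p`. The Bochner integral is zero if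
`|f|^p` is not integrable. -/
def ip (p : ℝ) (f : Eu d → ℂ) : ℝ := ∫ x, ‖f x‖ ^ p

theorem ip_nonneg (p : ℝ) (f : Eu d → ℂ) : 0 ≤ ip p f :=
  integral_nonneg fun _ => Real.rpow_nonneg (norm_nonneg _) _

section ip
variable {p : ℝ} {f g : Eu d → ℂ}

theorem integrable_norm_rpow (hp : 0 < p) (hf : MemLp f (ENNReal.ofReal p) volume) :
    Integrable (fun x => ‖f x‖ ^ p) := by
  have := hf.integrable_norm_rpow (by simpa using hp) ENNReal.ofReal_ne_top
  rwa [ENNReal.toReal_ofReal hp.le] at this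

theorem lintegral_eq_ofReal_ip (hp : 0 < p) (hf : MemLp f (ENNReal.ofReal p) volume) :
    ∫⁻ x, ‖f x‖ₑ ^ p = ENNReal.ofReal (ip p f) := by
  rw [ip, ofReal_integral_eq_lintegral_ofReal (integrable_norm_rpow hp hf)
    (Eventually.of_forall fun x => Real.rpow_nonneg (norm_nonneg _) _)]
  refine lintegral_congr fun x => ?_
  rw [← ofReal_norm, ENNReal.ofReal_rpow_of_nonneg (norm_nonneg _) hp.le]

theorem memLp_of_lintegral_lt_top (hp : 0 < p) (hf : AEStronglyMeasurable f volume)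
    (h : ∫⁻ x, ‖f x‖ₑ ^ p < ∞) : MemLp f (ENNReal.ofReal p) volume := by
  refine ⟨hf, ?_⟩
  rw [eLpNorm_lt_top_iff_lintegral_rpow_enorm_lt_top (by simpa using hp) ENNReal.ofReal_ne_top,
    ENNReal.toReal_ofReal hp.le]
  exact h

theorem ip_le_of_lintegral_le (hp : 0 < p) (hf : AEStronglyMeasurable f volume) {C : ℝ}
    (hC : 0 ≤ C) (h : ∫⁻ x, ‖f x‖ₑ ^ p ≤ ENNReal.ofReal C) :
    MemLp f (ENNReal.ofReal p) volume ∧ ip p f ≤ C := by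
  have h1 := memLp_of_lintegral_lt_top hp hf (h.trans_lt ENNReal.ofReal_lt_top)
  refine ⟨h1, ?_⟩
  rw [lintegral_eq_ofReal_ip hp h1] at h
  exact (ENNReal.ofReal_le_ofReal_iff hC).mp h

theorem lebNorm_rpow (hp : 0 < p) (hf : MemLp f (ENNReal.ofReal p) volume) :
    lebNorm p f ^ p = ENNReal.ofReal (ip p f) := by
  have h1 := eLpNorm_eq_lintegral_rpow_enorm_toReal (μ := volume) (f := f)
    (by simpa using hp : ENNReal.ofReal p ≠ 0) ENNReal.ofReal_ne_top
  rw [ENNReal.toReal_ofReal hp.le] at h1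
  rw [lebNorm, h1, ← ENNReal.rpow_mul, one_div_mul_cancel hp.ne', ENNReal.rpow_one,
    lintegral_eq_ofReal_ip hp hf]

theorem lebNorm_eq (hp : 0 < p) (hf : MemLp f (ENNReal.ofReal p) volume) :
    lebNorm p f = ENNReal.ofReal (ip p f ^ (1 / p)) := by
  rw [← ENNReal.ofReal_rpow_of_nonneg (ip_nonneg _ _) (by positivity), ← lebNorm_rpow hp hf,
    ← ENNReal.rpow_mul, mul_one_div_cancel hp.ne', ENNReal.rpow_one]

theorem ip_congr (h : f =ᵐ[volume] g) : ip p f = ip p g :=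
  integral_congr_ae (h.mono fun x hx => by simp only [hx])

theorem ip_translate (f : Eu d → ℂ) (y : Eu d) : ip p (fun x => f (x + y)) = ip p f :=
  integral_add_right_eq_self (fun x => ‖f x‖ ^ p) y

theorem ip_eq_zero_iff (hp : 0 < p) (hf : MemLp f (ENNReal.ofReal p) volume) :
    ip p f = 0 ↔ f =ᵐ[volume] 0 := by
  rw [ip, integral_eq_zero_iff_of_nonneg (fun x => Real.rpow_nonneg (norm_nonneg _) _)
    (integrable_norm_rpow hp hf)]
  constructor
  · intro h
    filter_upwards [h] with x hx
    have : ‖f x‖ = 0 := (Real.rpow_eq_zero (norm_nonneg _) hp.ne').mp hx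
    simpa using this
  · intro h
    filter_upwards [h] with x hx
    simp [hx, hp.ne']

theorem ip_smul (c : ℂ) : ip p (c • f) = ‖c‖ ^ p * ip p f := by
  rw [ip, ip, ← integral_const_mul]
  refine integral_congr_ae (Eventually.of_forall fun x => ?_)
  simp only [Pi.smul_apply, smul_eq_mul, norm_mul]
  exact Real.mul_rpow (norm_nonneg _) (norm_nonneg _)

end ip

/-! ### Averages over balls -/

/-- The uniform probability measure on the ball of radius `r` around the origin. -/
def ballMeas (d : ℕ) (r : ℝ) : Measure (Eu d) :=
  (volume (Metric.ball (0 : Eu d) r))⁻¹ • volume.restrict (Metric.ball 0 r)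

/-- The average of `f` over the ball of radius `r` around `x`. -/
def avg (r : ℝ) (f : Eu d → ℂ) (x : Eu d) : ℂ := ∫ y, f (x + y) ∂(ballMeas d r)

theorem isProbabilityMeasure_ballMeas {r : ℝ} (hr : 0 < r) :
    IsProbabilityMeasure (ballMeas d r) := by
  constructor
  rw [ballMeas, Measure.smul_apply, Measure.restrict_apply_univ, smul_eq_mul]
  exact ENNReal.inv_mul_cancel (Metric.measure_ball_pos volume 0 hr).ne' measure_ball_lt_top.ne

theorem ballMeas_ac (r : ℝ) : ballMeas d r ≪ volume :=
  Measure.smul_absolutelyContinuous.trans Measure.restrict_le_self.absolutelyContinuous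

theorem ae_mem_ballMeas (r : ℝ) : ∀ᵐ y ∂(ballMeas d r), y ∈ Metric.ball (0 : Eu d) r :=
  Measure.ae_smul_measure (ae_restrict_mem Metric.isOpen_ball.measurableSet) _

/-- Jensen's inequality for the power `q ≥ 1`. -/
theorem enorm_integral_rpow_le {Ω : Type*} [MeasurableSpace Ω] {μ : Measure Ω}
    [IsProbabilityMeasure μ] {q : ℝ} (hq : 1 ≤ q) {g : Ω → ℂ} (hg : AEStronglyMeasurable g μ) :
    ‖∫ y, g y ∂μ‖ₑ ^ q ≤ ∫⁻ y, ‖g y‖ₑ ^ q ∂μ := by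
  have hq0 : 0 < q := by linarith
  have h1 : eLpNorm g 1 μ ≤ eLpNorm g (ENNReal.ofReal q) μ :=
    eLpNorm_le_eLpNorm_of_exponent_le (by simpa using hq) hg
  rw [eLpNorm_one_eq_lintegral_enorm, eLpNorm_eq_lintegral_rpow_enorm_toReal
    (by simpa using hq0) ENNReal.ofReal_ne_top, ENNReal.toReal_ofReal hq0.le] at h1
  calc ‖∫ y, g y ∂μ‖ₑ ^ q ≤ ((∫⁻ y, ‖g y‖ₑ ^ q ∂μ) ^ (1 / q)) ^ q := by
        gcongr; exact (enorm_integral_le_lintegral_enorm g).trans h1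
    _ = ∫⁻ y, ‖g y‖ₑ ^ q ∂μ := by
        rw [← ENNReal.rpow_mul, one_div_mul_cancel hq0.ne', ENNReal.rpow_one]

section avg
variable {f g : Eu d → ℂ} {r : ℝ}

theorem aesm_comp_add_ballMeas (hf : AEStronglyMeasurable f volume) (x : Eu d) :
    AEStronglyMeasurable (fun y => f (x + y)) (ballMeas d r) :=
  (hf.comp_measurePreserving (measurePreserving_add_left volume x)).mono_ac (ballMeas_ac r)

theorem aesm_uncurry_add (hf : AEStronglyMeasurable f volume) {μ : Measure (Eu d)} [SFinite μ] :
    AEStronglyMeasurable (fun z : Eu d × Eu d => f (z.1 + z.2)) (volume.prod μ) := by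
  refine hf.comp_quasiMeasurePreserving ?_
  exact (Measure.quasiMeasurePreserving_fst (μ := volume) (ν := μ)).comp
    (measurePreserving_add_prod volume μ).quasiMeasurePreserving

instance : SFinite (ballMeas d r) := by unfold ballMeas; infer_instance

theorem aesm_avg (hf : AEStronglyMeasurable f volume) : AEStronglyMeasurable (avg r f) volume :=
  (aesm_uncurry_add (μ := ballMeas d r) hf).integral_prod_right'

theorem enorm_avg_rpow_le (hr : 0 < r) {q : ℝ} (hq : 1 ≤ q) (hf : AEStronglyMeasurable f volume)
    (x : Eu d) : ‖avg r f x‖ₑ ^ q ≤ (volume (Metric.ball (0 : Eu d) r))⁻¹ * ∫⁻ y, ‖f y‖ₑ ^ q := by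
  have := isProbabilityMeasure_ballMeas (d := d) hr
  refine (enorm_integral_rpow_le hq (aesm_comp_add_ballMeas hf x)).trans ?_
  rw [ballMeas, lintegral_smul_measure, smul_eq_mul]
  refine mul_le_mul_right ((setLIntegral_le_lintegral _ _).trans (le_of_eq ?_)) _
  exact lintegral_add_left_eq_self (fun y => ‖f y‖ₑ ^ q) x

/-- Averaging over balls is a contraction of `L^q`. -/
theorem lintegral_avg_rpow_le (hr : 0 < r) {q : ℝ} (hq : 1 ≤ q)
    (hf : AEStronglyMeasurable f volume) :
    ∫⁻ x, ‖avg r f x‖ₑ ^ q ≤ ∫⁻ x, ‖f x‖ₑ ^ q := by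
  have := isProbabilityMeasure_ballMeas (d := d) hr
  calc ∫⁻ x, ‖avg r f x‖ₑ ^ q ≤ ∫⁻ x, ∫⁻ y, ‖f (x + y)‖ₑ ^ q ∂(ballMeas d r) :=
        lintegral_mono fun x => enorm_integral_rpow_le hq (aesm_comp_add_ballMeas hf x)
    _ = ∫⁻ y, ∫⁻ x, ‖f (x + y)‖ₑ ^ q ∂volume ∂(ballMeas d r) :=
        lintegral_lintegral_swap ((aesm_uncurry_add hf).enorm.pow_const q)
    _ = ∫⁻ x, ‖f x‖ₑ ^ q := by
        simp only [lintegral_add_right_eq_self (fun x => ‖f x‖ₑ ^ q)]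
        simp

theorem integrable_comp_add_ballMeas (hr : 0 < r) (hf : LocallyIntegrable f volume) (x : Eu d) :
    Integrable (fun y => f (x + y)) (ballMeas d r) := by
  have h1 : IntegrableOn f (Metric.closedBall x r) :=
    hf.integrableOn_isCompact (isCompact_closedBall x r)
  have h2 : IntegrableOn (fun y => f (x + y)) (Metric.ball 0 r) := by
    have h3 := ((measurePreserving_add_left volume x).integrableOn_comp_preimage
      (measurableEmbedding_addLeft x) (f := f) (s := Metric.ball x r)).mpr
      (h1.mono_set Metric.ball_subset_closedBall)
    have h4 : (fun y => x + y) ⁻¹' Metric.ball x r = Metric.ball 0 r := by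
      ext y; simp
    rwa [h4] at h3
  exact Integrable.smul_measure h2 (ENNReal.inv_ne_top.mpr (Metric.measure_ball_pos volume 0 hr).ne')

theorem avg_translate (x y : Eu d) : avg r (fun z => f (z + y)) x = avg r f (x + y) := by
  simp only [avg]
  refine integral_congr_ae (Eventually.of_forall fun z => ?_)
  simp only
  congr 1; abel

theorem norm_chr_sub_one_sq_le {y : Eu d} (hy : ‖y‖ ≤ r) (ξ : Eu d) :
    ‖chr y ξ - 1‖ ^ (2 : ℝ) ≤ (2 * Real.pi) ^ 2 * min 1 ((‖ξ‖ / r⁻¹) ^ 2) := by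
  have h1 := norm_chr_sub_one_le_two y ξ
  have h2 := norm_chr_sub_one_le y ξ
  have h3 : (2 : ℝ) ≤ 2 * Real.pi := by linarith [Real.pi_gt_three]
  have h4 : ‖chr y ξ - 1‖ ≤ 2 * Real.pi * (‖ξ‖ / r⁻¹) := by
    refine h2.trans ?_
    rw [div_inv_eq_mul, mul_assoc, mul_comm ‖ξ‖]
    gcongr
  rw [mul_min_of_nonneg _ _ (by positivity), mul_one, ← mul_pow]
  have h5 : ‖chr y ξ - 1‖ ^ (2 : ℝ) = ‖chr y ξ - 1‖ ^ 2 := by norm_cast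
  rw [h5]
  exact le_min (by gcongr; exact h1.trans h3) (by gcongr)

/-- The distance in `L²` from `f` to its averages over balls of radius `r` is controlled by the
frequencies `≳ 1 / r` of `f`, the lower ones being damped by `(r|ξ|)²`. -/
theorem lintegral_sub_avg_le (hd : 0 < d) (hr : 0 < r) {q : ℝ≥0∞} (hq1 : 1 < q) (hq : q ≠ ∞)
    {s : ℝ} (hs0 : 0 ≤ s) (hs1 : s ≤ 1) (hf : MemLp f q volume) (hfs : hdotNorm s f < ∞) :
    ∫⁻ x, ‖f x - avg r f x‖ₑ ^ (2 : ℝ) ≤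
      ∫⁻ ξ, ENNReal.ofReal ((2 * Real.pi) ^ 2 * min 1 ((‖ξ‖ / r⁻¹) ^ 2)) * ‖ft f ξ‖ₑ ^ (2 : ℝ) := by
  have := isProbabilityMeasure_ballMeas (d := d) hr
  have hft := (hasFourierAway_of_lt_top hfs).meas_right
  have hdiff : ∀ y : Eu d, ∫⁻ x, ‖f (x + y) - f x‖ₑ ^ (2 : ℝ)
      = ∫⁻ ξ, ‖chr y ξ - 1‖ₑ ^ (2 : ℝ) * ‖ft f ξ‖ₑ ^ (2 : ℝ) := fun y => by
    have h1 := eLpNorm_translate_sub hq1 hq hd hs0 hs1 hf hfs y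
    rw [eLpNorm_eq_lintegral_rpow_enorm_toReal two_ne_zero ENNReal.ofNat_ne_top,
      eLpNorm_eq_lintegral_rpow_enorm_toReal two_ne_zero ENNReal.ofNat_ne_top,
      ENNReal.toReal_ofNat] at h1
    rw [ENNReal.rpow_left_injective (x := 1 / (2:ℝ)) (by norm_num) h1]
    refine lintegral_congr fun ξ => ?_
    rw [enorm_mul, ENNReal.mul_rpow_of_nonneg _ _ zero_le_two]
  calc ∫⁻ x, ‖f x - avg r f x‖ₑ ^ (2 : ℝ)
      ≤ ∫⁻ x, ∫⁻ y, ‖f (x + y) - f x‖ₑ ^ (2 : ℝ) ∂(ballMeas d r) := by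
        refine lintegral_mono fun x => ?_
        have h1 : avg r f x - f x = ∫ y, (f (x + y) - f x) ∂(ballMeas d r) := by
          rw [integral_sub (integrable_comp_add_ballMeas hr (hf.locallyIntegrable hq1.le) x)
            (integrable_const _)]
          simp [avg]
        rw [← enorm_neg, neg_sub, h1]
        exact enorm_integral_rpow_le one_le_two ((aesm_comp_add_ballMeas hf.1 x).sub
          aestronglyMeasurable_const)
    _ = ∫⁻ y, ∫⁻ x, ‖f (x + y) - f x‖ₑ ^ (2 : ℝ) ∂volume ∂(ballMeas d r) :=
        lintegral_lintegral_swap (((aesm_uncurry_add hf.1).sub hf.1.comp_fst).enorm.pow_const _)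
    _ ≤ ∫⁻ _ : Eu d, (∫⁻ ξ, ENNReal.ofReal ((2 * Real.pi) ^ 2 * min 1 ((‖ξ‖ / r⁻¹) ^ 2))
          * ‖ft f ξ‖ₑ ^ (2 : ℝ)) ∂(ballMeas d r) := by
        refine lintegral_mono_ae ((ae_mem_ballMeas r).mono fun y hy => ?_)
        rw [hdiff]
        refine lintegral_mono fun ξ => ?_
        gcongr
        rw [← ofReal_norm, ENNReal.ofReal_rpow_of_nonneg (norm_nonneg _) zero_le_two]
        exact ENNReal.ofReal_le_ofReal (norm_chr_sub_one_sq_le (mem_ball_zero_iff.mp hy).le ξ)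
    _ = _ := by simp

end avg

/-! ### The Gagliardo–Nirenberg and Sobolev inequalities -/

theorem lintegral_norm_rpow_mul_ft_le (hd : 0 < d) {γ : ℝ} (hγ : 0 ≤ γ) {f : Eu d → ℂ}
    (hf : hdotNorm γ f < ∞) :
    ∫⁻ ξ, ENNReal.ofReal (‖ξ‖ ^ (2 * γ)) * ‖ft f ξ‖ₑ ^ (2 : ℝ) ≤ ENNReal.ofReal (‖eh γ f‖ ^ 2) := by
  have h1 : ENNReal.ofReal (‖eh γ f‖ ^ 2) = ∫⁻ ξ, ‖sym γ ξ * ft f ξ‖ₑ ^ (2 : ℝ) := by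
    rw [ENNReal.ofReal_pow (norm_nonneg _), ofReal_norm, Lp.enorm_def, ← ENNReal.rpow_natCast,
      eLpNorm_congr_ae (coe_eh hd hf),
      eLpNorm_eq_lintegral_rpow_enorm_toReal two_ne_zero ENNReal.ofNat_ne_top, ← ENNReal.rpow_mul]
    simp
  rw [h1]
  refine lintegral_mono fun ξ => ?_
  rw [enorm_mul, ENNReal.mul_rpow_of_nonneg _ _ zero_le_two]
  gcongr
  rw [← ofReal_norm, ENNReal.ofReal_rpow_of_nonneg (norm_nonneg _) zero_le_two, norm_sym,
    ← Real.rpow_mul (by positivity), mul_comm γ 2]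
  refine ENNReal.ofReal_le_ofReal ?_
  gcongr
  have : (1 : ℝ) ≤ 2 * Real.pi := by linarith [Real.pi_gt_three]
  exact le_mul_of_one_le_left (norm_nonneg _) this

/-- The volume of the unit ball. -/
def ballVol (d : ℕ) : ℝ := (volume (Metric.ball (0 : Eu d) 1)).toReal

theorem ballVol_pos (d : ℕ) : 0 < ballVol d :=
  ENNReal.toReal_pos (Metric.measure_ball_pos volume 0 one_pos).ne' measure_ball_lt_top.ne

theorem volume_ball_eq {r : ℝ} (hr : 0 < r) :
    volume (Metric.ball (0 : Eu d) r) = ENNReal.ofReal (r ^ d * ballVol d) := by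
  rw [Measure.addHaar_ball_of_pos _ _ hr, ENNReal.ofReal_mul (by positivity), ballVol,
    ENNReal.ofReal_toReal measure_ball_lt_top.ne]
  simp

/-- The averages of a function in `L^q` are bounded: `|A_r f| ≤ C r^{-d/q} ‖f‖_q`. -/
theorem norm_avg_le {r q : ℝ} (hr : 0 < r) (hq : 1 ≤ q) {f : Eu d → ℂ}
    (hf : MemLp f (ENNReal.ofReal q) volume) (x : Eu d) :
    ‖avg r f x‖ ≤ (ip q f / ballVol d) ^ (1 / q) * (r⁻¹) ^ (d / q) := by
  have hq0 : 0 < q := by linarith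
  have hb := ballVol_pos d
  have h1 := enorm_avg_rpow_le hr hq hf.1 x
  rw [lintegral_eq_ofReal_ip hq0 hf, volume_ball_eq hr, ← ENNReal.ofReal_inv_of_pos (by positivity),
    ← ENNReal.ofReal_mul (by positivity), ← ofReal_norm,
    ENNReal.ofReal_rpow_of_nonneg (norm_nonneg _) hq0.le,
    ENNReal.ofReal_le_ofReal_iff (mul_nonneg (by positivity) (ip_nonneg _ _))] at h1
  have h2 : (r ^ d * ballVol d)⁻¹ * ip q f = (ip q f / ballVol d) * (r⁻¹) ^ d := by
    rw [mul_inv, inv_pow]; ring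
  rw [h2] at h1
  have h3 := Real.rpow_le_rpow (by positivity) h1 (by positivity : 0 ≤ 1 / q)
  rw [← Real.rpow_mul (norm_nonneg _), mul_one_div_cancel hq0.ne', Real.rpow_one,
    Real.mul_rpow (div_nonneg (ip_nonneg _ _) hb.le) (by positivity), ← Real.rpow_natCast (r⁻¹),
    ← Real.rpow_mul (by positivity), mul_one_div] at h3
  exact h3

/-- The Gagliardo–Nirenberg inequality for `L^q ∩ Ḣ^s`. The splitting of
`lintegral_rpow_le_of_splitting` is `f = A_r f + (f - A_r f)` with `r = 1 / R`; being defined on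
the space side, it makes sense for functions whose Fourier transform is singular at the origin. -/
theorem exists_gagliardo_nirenberg (hd : 0 < d) {s q : ℝ} (hs0 : 0 < s) (hs1 : s < 1) (hq : 1 < q) :
    ∃ C : ℝ, 0 ≤ C ∧ ∀ f : Eu d → ℂ, MemLp f (ENNReal.ofReal q) volume → hdotNorm s f < ∞ →
      MemLp f (ENNReal.ofReal (2 * s * q / d + 2)) volume ∧
      ip (2 * s * q / d + 2) f ≤ C * ip q f ^ (2 * s / d) * ‖eh s f‖ ^ 2 := by
  have hd' : (0 : ℝ) < d := by exact_mod_cast hd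
  have hb := ballVol_pos d
  have hq0 : 0 < q := by linarith
  set β : ℝ := 2 * s * q / d with hβ
  have hβ0 : 0 < β := by positivity
  have hK : (0 : ℝ) ≤ (2 * Real.pi) ^ 2 := by positivity
  have hL := levelConst_nonneg hs0 hs1 hβ0 hK
  refine ⟨levelConst s β ((2 * Real.pi) ^ 2) * (ballVol d)⁻¹ ^ (2 * s / d), by positivity,
    fun f hf hfs => ?_⟩
  rcases (ip_nonneg q f).eq_or_lt with hI | hI
  · have h0 : f =ᵐ[volume] 0 := (ip_eq_zero_iff hq0 hf).mp hI.symm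
    refine ⟨(MemLp.zero (ε := ℂ)).ae_eq h0.symm, ?_⟩
    have h1 : ip (β + 2) f = 0 := by
      rw [ip_congr h0]; simp [ip, Real.zero_rpow (by positivity : β + 2 ≠ 0)]
    rw [h1]
    have := ip_nonneg q f
    positivity
  · set A : ℝ := (ip q f / ballVol d) ^ (1 / q) with hA
    have hA0 : 0 < A := by positivity
    have key := lintegral_rpow_le_of_splitting hd hs0 hs1 hβ0 hA0 hK hf.1
      (hasFourierAway_of_lt_top hfs).meas_right fun R hR => by
        refine ⟨fun x => f x - avg R⁻¹ f x, hf.1.sub (aesm_avg hf.1),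
          Eventually.of_forall fun x => ?_, ?_⟩
        · rw [sub_sub_cancel]
          have h1 := norm_avg_le (inv_pos.mpr hR) hq.le hf x
          have h2 : 2 * s / β = d / q := by rw [hβ]; field_simp
          rwa [inv_inv, ← h2] at h1
        · have := lintegral_sub_avg_le hd (inv_pos.mpr hR) (by simpa using hq) ENNReal.ofReal_ne_top
            hs0.le hs1.le hf hfs
          rwa [inv_inv] at this
    refine ip_le_of_lintegral_le (by positivity) hf.1 (by positivity) (key.trans ?_)
    refine (mul_le_mul_right (lintegral_norm_rpow_mul_ft_le hd hs0.le hfs) _).trans ?_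
    rw [← ENNReal.ofReal_mul (by positivity)]
    refine ENNReal.ofReal_le_ofReal (le_of_eq ?_)
    congr 1
    rw [mul_assoc]
    congr 1
    rw [hA, ← Real.rpow_mul (by positivity), div_eq_mul_inv, mul_comm (ip q f),
      ← Real.mul_rpow (by positivity) hI.le]
    congr 1
    rw [hβ]; field_simp

/-- The restriction to the frequencies below `R` of the symbol of `|∇|^{-γ}`. -/
def lowSym (γ R : ℝ) : Eu d → ℂ := Set.indicator (Metric.ball 0 R) (sym (-γ))

theorem measurable_lowSym (γ R : ℝ) : Measurable (lowSym γ R : Eu d → ℂ) :=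
  (measurable_sym _).indicator Metric.isOpen_ball.measurableSet

/-- The singularity `|ξ|^{-γ}` is square integrable at the origin for `2γ < d`. -/
theorem memLp_lowSym (hd : 0 < d) {γ R : ℝ} (hγ : 2 * γ < d) :
    MemLp (lowSym γ R : Eu d → ℂ) 2 volume := by
  rw [lowSym, memLp_indicator_iff_restrict Metric.isOpen_ball.measurableSet,
    memLp_two_iff_integrable_sq_norm (measurable_sym _).aestronglyMeasurable]
  refine integrableOn_ball_of_norm_le_rpow (C := (2 * Real.pi) ^ (-(2 * γ))) (α := 2 * γ)
    (by simpa using Nat.one_le_of_lt hd) (by simpa using hγ) (Eventually.of_forall fun ξ => ?_)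
    ((measurable_sym _).norm.pow_const 2).aestronglyMeasurable
  rw [Real.norm_of_nonneg (by positivity), norm_sym, ← Real.rpow_natCast,
    ← Real.rpow_mul (by positivity), ← Real.mul_rpow (by positivity) (norm_nonneg _)]
  refine le_of_eq ?_
  congr 1; push_cast; ring

theorem eLpNorm_lowSym {γ R : ℝ} (hR : 0 < R) :
    eLpNorm (lowSym γ R : Eu d → ℂ) 2 volume
      = ENNReal.ofReal (R ^ ((d : ℝ) / 2 - γ)) * eLpNorm (lowSym γ 1 : Eu d → ℂ) 2 volume := by
  have h1 : (lowSym γ R : Eu d → ℂ) = ((R ^ (-γ) : ℝ) : ℂ) • fun ξ => lowSym γ 1 (R⁻¹ • ξ) := by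
    funext ξ
    have h2 : ξ ∈ Metric.ball (0 : Eu d) R ↔ R⁻¹ • ξ ∈ Metric.ball (0 : Eu d) 1 := by
      rw [mem_ball_zero_iff, mem_ball_zero_iff, norm_smul, norm_inv, Real.norm_of_nonneg hR.le,
        inv_mul_lt_iff₀ hR, mul_one]
    simp only [Pi.smul_apply, smul_eq_mul, lowSym]
    by_cases h : ξ ∈ Metric.ball (0 : Eu d) R
    · rw [Set.indicator_of_mem h, Set.indicator_of_mem (h2.mp h), sym, sym, ← Complex.ofReal_mul,
        ← Real.mul_rpow hR.le (by positivity), norm_smul, norm_inv, Real.norm_of_nonneg hR.le]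
      congr 2; field_simp
    · rw [Set.indicator_of_notMem h, Set.indicator_of_notMem (fun h3 => h (h2.mpr h3)), mul_zero]
  have h4 : ‖((R ^ (-γ) : ℝ) : ℂ)‖ₑ = ENNReal.ofReal (R ^ (-γ)) := by
    rw [← ofReal_norm, Complex.norm_real, Real.norm_of_nonneg (by positivity)]
  rw [h1, eLpNorm_const_smul, eLpNorm_comp_dilation (inv_pos.mpr hR) ENNReal.ofNat_ne_top,
    ← mul_assoc, h4, ENNReal.ofReal_rpow_of_pos (by positivity), ← ENNReal.ofReal_mul (by positivity)]
  congr 2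
  rw [inv_pow, inv_inv, ← Real.rpow_natCast, ← Real.rpow_mul hR.le, ← Real.rpow_add hR]
  congr 1; simp; ring

theorem lowSym_mul_sym {γ R : ℝ} {ξ : Eu d} (hξ : ξ ≠ 0) (a : ℂ) :
    lowSym γ R ξ * (sym γ ξ * a) = Set.indicator (Metric.ball 0 R) (fun _ => a) ξ := by
  rw [lowSym]
  by_cases h : ξ ∈ Metric.ball (0 : Eu d) R
  · rw [Set.indicator_of_mem h, Set.indicator_of_mem h, ← mul_assoc, ← sym_add _ _ hξ,
      neg_add_cancel]
    simp [sym]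
  · rw [Set.indicator_of_notMem h, Set.indicator_of_notMem h, zero_mul]

/-- The pairing identity of `HasFourierOn` for the inverse Fourier integral of an integrable
function. -/
theorem integral_fourierInv_mul {g : Eu d → ℂ} (hg : Integrable g) (φ : 𝓢(Eu d, ℂ)) :
    ∫ x, (𝓕⁻ g) x * (𝓕 φ) x = ∫ ξ, g ξ * φ ξ := by
  have hL : Continuous fun p : Eu d × Eu d => (-innerₗ (Eu d)) p.1 p.2 := by
    simp only [LinearMap.neg_apply]
    exact continuous_inner.neg
  have h1 := VectorFourier.integral_fourierIntegral_smul_eq_flip (L := -innerₗ (Eu d))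
    (μ := volume) (ν := volume) Real.continuous_fourierChar hL hg (𝓕 φ).integrable
  have h2 : (-innerₗ (Eu d)).flip = -innerₗ (Eu d) := by
    ext x y; simp [real_inner_comm]
  rw [h2] at h1
  refine h1.trans (integral_congr_ae (Eventually.of_forall fun ξ => ?_))
  have h3 : (𝓕⁻ ((𝓕 φ : 𝓢(Eu d, ℂ)) : Eu d → ℂ)) ξ = φ ξ := by
    rw [← SchwartzMap.fourierInv_coe]; simp
  have h4 : VectorFourier.fourierIntegral Real.fourierChar volume (-innerₗ (Eu d))
      ((𝓕 φ : 𝓢(Eu d, ℂ)) : Eu d → ℂ) ξ = φ ξ := h3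
  simp only [h4, smul_eq_mul]

/-- The Sobolev embedding `Ḣ^γ ⊆ L^{2d/(d-2γ)}`, for functions whose Fourier transform is a
function on the whole space. Here `f` is split by a sharp cut-off of its Fourier transform at the
frequency `R`. -/
theorem exists_sobolev (hd : 0 < d) {γ : ℝ} (hγ0 : 0 < γ) (hγ1 : γ < 1) (hγd : 2 * γ < d) :
    ∃ C : ℝ, 0 ≤ C ∧ ∀ f : Eu d → ℂ, HasFourierFunction f → hdotNorm γ f < ∞ →
      MemLp f (ENNReal.ofReal (2 * d / (d - 2 * γ))) volume ∧
      ip (2 * d / (d - 2 * γ)) f ≤ C * ‖eh γ f‖ ^ (2 * d / (d - 2 * γ)) := by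
  have hd' : (0 : ℝ) < d := by exact_mod_cast hd
  have hdγ : 0 < d - 2 * γ := by linarith
  set β : ℝ := 4 * γ / (d - 2 * γ) with hβ
  have hβ0 : 0 < β := by positivity
  have hβ2 : 2 * d / (d - 2 * γ) = β + 2 := by rw [hβ]; field_simp; ring
  rw [hβ2]
  have hL := levelConst_nonneg hγ0 hγ1 hβ0 zero_le_one
  -- The summand `1` only makes `a` visibly positive.
  set a : ℝ := (eLpNorm (lowSym γ 1 : Eu d → ℂ) 2 volume).toReal + 1 with ha
  have ha0 : 0 < a := by positivity
  refine ⟨levelConst γ β 1 * a ^ β, by positivity, fun f ⟨h, hfh⟩ hfγ => ?_⟩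
  have hAway : HasFourierAway f h := hfh.mono (Set.subset_univ _)
  have hS := (memLp_sym_mul_iff hd hAway).mpr hfγ
  have hnorm : eLpNorm (fun ξ => sym γ ξ * h ξ) 2 volume = ENNReal.ofReal ‖eh γ f‖ := by
    rw [← hdotNorm_eq hd γ hAway, hdotNorm_eq_norm_eh hd hfγ]
  rcases (norm_nonneg (eh γ f)).eq_or_lt with hI | hI
  · have hzero : h =ᵐ[volume] 0 := by
      rw [← hI, ENNReal.ofReal_zero, eLpNorm_eq_zero_iff hS.1 two_ne_zero] at hnorm
      filter_upwards [hnorm, ae_ne_zero hd] with ξ h1 h2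
      exact (mul_eq_zero.mp h1).resolve_left (sym_ne_zero γ h2)
    have h0 : f =ᵐ[volume] 0 := by
      refine ae_eq_zero_of_integral_mul_fourier hfh.tempered fun φ => ?_
      rw [hfh.pairing φ trivial]
      exact integral_eq_zero_of_ae (hzero.mono fun ξ hξ => by simp [hξ])
    refine ⟨(MemLp.zero (ε := ℂ)).ae_eq h0.symm, ?_⟩
    have h1 : ip (β + 2) f = 0 := by
      rw [ip_congr h0]; simp [ip, Real.zero_rpow (by positivity : β + 2 ≠ 0)]
    rw [h1]
    positivity
  set A : ℝ := a * ‖eh γ f‖ with hA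
  have hA0 : 0 < A := by positivity
  have key := lintegral_rpow_le_of_splitting hd hγ0 hγ1 hβ0 hA0 zero_le_one hfh.meas_left
    hfh.meas_right fun R hR => by
      set h₁ : Eu d → ℂ := Set.indicator (Metric.ball 0 R) h with hh₁
      set h₂ : Eu d → ℂ := Set.indicator (Metric.ball 0 R)ᶜ h with hh₂
      have hsum : ∀ ξ, h₁ ξ + h₂ ξ = h ξ := fun ξ => by
        rw [hh₁, hh₂, ← Pi.add_apply, Set.indicator_self_add_compl]
      have hlow : (fun ξ => lowSym γ R ξ * (sym γ ξ * h ξ)) =ᵐ[volume] h₁ := by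
        filter_upwards [ae_ne_zero hd] with ξ hξ
        rw [lowSym_mul_sym hξ, hh₁]
        rfl
      -- the low frequencies are integrable, as the product of two functions in `L²`
      have hlow1 : MemLp (fun ξ => lowSym γ R ξ * (sym γ ξ * h ξ)) 1 volume :=
        MemLp.mul (p := 2) (q := 2) hS (memLp_lowSym hd hγd)
      have hint₁ : Integrable h₁ := (memLp_one_iff_integrable.mp hlow1).congr hlow
      have hnorm₁ : ∫⁻ ξ, ‖h₁ ξ‖ₑ ≤ ENNReal.ofReal (A * R ^ (2 * γ / β)) := by
        calc ∫⁻ ξ, ‖h₁ ξ‖ₑ = ∫⁻ ξ, ‖lowSym γ R ξ‖ₑ * ‖sym γ ξ * h ξ‖ₑ :=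
              lintegral_congr_ae (hlow.mono fun ξ hξ => by simp only [← hξ, enorm_mul])
          _ ≤ eLpNorm (lowSym γ R : Eu d → ℂ) 2 volume * eLpNorm (fun ξ => sym γ ξ * h ξ) 2 volume :=
              lintegral_enorm_mul_le (measurable_lowSym γ R).aestronglyMeasurable hS.1
          _ ≤ ENNReal.ofReal (R ^ ((d : ℝ) / 2 - γ)) * ENNReal.ofReal a * ENNReal.ofReal ‖eh γ f‖ := by
              rw [eLpNorm_lowSym hR, hnorm]
              gcongr
              rw [← ENNReal.ofReal_toReal (memLp_lowSym (R := 1) hd hγd).eLpNorm_ne_top]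
              exact ENNReal.ofReal_le_ofReal (by rw [ha]; linarith)
          _ = _ := by
              rw [← ENNReal.ofReal_mul (by positivity), ← ENNReal.ofReal_mul (by positivity), hA]
              have : 2 * γ / β = (d : ℝ) / 2 - γ := by rw [hβ]; field_simp; ring
              rw [this]
              congr 1; ring
      have hpt : ∀ ξ, ‖h₂ ξ‖ₑ ^ (2 : ℝ)
          ≤ ENNReal.ofReal (1 * min 1 ((‖ξ‖ / R) ^ 2)) * ‖h ξ‖ₑ ^ (2 : ℝ) := fun ξ => by
        by_cases hξ : ξ ∈ Metric.ball (0 : Eu d) R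
        · rw [hh₂, Set.indicator_of_notMem (by simpa using hξ)]; simp
        · rw [hh₂, Set.indicator_of_mem (by simpa using hξ)]
          have h3 : 1 ≤ ‖ξ‖ / R := by
            rw [one_le_div hR]; simpa using hξ
          rw [min_eq_left (one_le_pow₀ h3)]
          simp
      have hmem₂ : MemLp h₂ 2 volume := by
        refine MemLp.of_le_mul (c := (2 * Real.pi * R) ^ (-γ)) hS
          (hfh.meas_right.indicator Metric.isOpen_ball.measurableSet.compl)
          (Eventually.of_forall fun ξ => ?_)
        by_cases hξ : ξ ∈ Metric.ball (0 : Eu d) R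
        · rw [hh₂, Set.indicator_of_notMem (by simpa using hξ), norm_zero]
          positivity
        · rw [hh₂, Set.indicator_of_mem (by simpa using hξ), norm_mul, norm_sym, ← mul_assoc]
          have h3 : R ≤ ‖ξ‖ := by simpa using hξ
          refine le_mul_of_one_le_left (norm_nonneg _) ?_
          rw [Real.rpow_neg (by positivity), ← div_eq_inv_mul,
            ← Real.div_rpow (by positivity) (by positivity)]
          refine Real.one_le_rpow ?_ hγ0.le
          rw [one_le_div (by positivity)]
          gcongr
      have hsplit : f =ᵐ[volume] fun x => (𝓕⁻ h₁) x + (𝓕⁻ hmem₂.toLp : L2 d) x := by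
        have hcont : Continuous (𝓕⁻ h₁) :=
          VectorFourier.fourierIntegral_continuous (L := -innerₗ (Eu d)) Real.continuous_fourierChar
            (by simp only [LinearMap.neg_apply]; exact continuous_inner.neg) hint₁
        have hbdd : ∀ x, ‖(𝓕⁻ h₁) x‖ ≤ ∫ ξ, ‖h₁ ξ‖ := fun x =>
          VectorFourier.norm_fourierIntegral_le_integral_norm _ _ _ _ _
        have hi₁ : ∀ φ : 𝓢(Eu d, ℂ), Integrable fun x => (𝓕⁻ h₁) x * φ x := fun φ =>
          φ.integrable.bdd_mul hcont.aestronglyMeasurable (Eventually.of_forall hbdd)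
        have hT := hasFourierOn_fourierInv hmem₂.toLp
        have hz := ae_eq_zero_of_integral_mul_fourier
          (F := fun x => f x - ((𝓕⁻ h₁) x + (𝓕⁻ hmem₂.toLp : L2 d) x)) (fun φ => by
            simp only [sub_mul, add_mul]
            exact (hfh.tempered φ).sub ((hi₁ φ).add (hT.tempered φ))) fun φ => by
            simp only [sub_mul, add_mul]
            have hi₂ : Integrable fun ξ => h₂ ξ * φ ξ :=
              MemLp.integrable_mul_schwartz one_le_two hmem₂ φ
            have hi₃ : Integrable fun x => (𝓕⁻ h₁) x * (𝓕 φ) x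
                + (𝓕⁻ hmem₂.toLp : L2 d) x * (𝓕 φ) x := (hi₁ _).add (hT.tempered _)
            have hi₄ : Integrable fun ξ => h₁ ξ * φ ξ := hint₁.mul_of_top_left (φ.memLp_top)
            rw [integral_sub (hfh.tempered _) hi₃, integral_add (hi₁ _) (hT.tempered _),
              hfh.pairing φ trivial, hT.pairing φ trivial,
              integral_fourierInv_mul hint₁ φ,
              integral_congr_ae (hmem₂.coeFn_toLp.mono fun ξ hξ => by simp only [hξ] :
                (fun ξ => hmem₂.toLp h₂ ξ * φ ξ) =ᵐ[volume] fun ξ => h₂ ξ * φ ξ),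
              ← integral_add hi₄ hi₂, sub_eq_zero]
            exact integral_congr_ae (Eventually.of_forall fun ξ => by simp only [← hsum ξ, add_mul])
        filter_upwards [hz] with x hx using sub_eq_zero.mp hx
      refine ⟨(𝓕⁻ hmem₂.toLp : L2 d), (Lp.memLp _).1, ?_, ?_⟩
      · filter_upwards [hsplit] with x hx
        rw [hx, add_sub_cancel_right]
        have h5 : ‖(𝓕⁻ h₁) x‖ₑ ≤ ENNReal.ofReal (A * R ^ (2 * γ / β)) := by
          refine le_trans ?_ hnorm₁
          rw [Real.fourierInv_eq]
          refine (enorm_integral_le_lintegral_enorm _).trans (le_of_eq (lintegral_congr fun v => ?_))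
          rw [← ofReal_norm, Circle.norm_smul, ofReal_norm]
        rw [← ofReal_norm] at h5
        exact (ENNReal.ofReal_le_ofReal_iff (by positivity)).mp h5
      · have h6 : eLpNorm ((𝓕⁻ hmem₂.toLp : L2 d) : Eu d → ℂ) 2 volume = eLpNorm h₂ 2 volume := by
          rw [← eLpNorm_congr_ae hmem₂.coeFn_toLp, ← Lp.enorm_def, ← Lp.enorm_def,
            ← ofReal_norm, ← ofReal_norm]
          congr 1
          exact (Lp.fourierTransformₗᵢ (Eu d) ℂ).symm.norm_map _
        rw [eLpNorm_eq_lintegral_rpow_enorm_toReal two_ne_zero ENNReal.ofNat_ne_top,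
          eLpNorm_eq_lintegral_rpow_enorm_toReal two_ne_zero ENNReal.ofNat_ne_top,
          ENNReal.toReal_ofNat] at h6
        rw [ENNReal.rpow_left_injective (x := 1 / (2:ℝ)) (by norm_num) h6]
        exact lintegral_mono hpt
  refine ip_le_of_lintegral_le (by positivity) hfh.meas_left (by positivity) (key.trans ?_)
  have hft : ∫⁻ ξ, ENNReal.ofReal (‖ξ‖ ^ (2 * γ)) * ‖h ξ‖ₑ ^ (2 : ℝ)
      = ∫⁻ ξ, ENNReal.ofReal (‖ξ‖ ^ (2 * γ)) * ‖ft f ξ‖ₑ ^ (2 : ℝ) :=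
    lintegral_congr_ae ((ft_ae_eq hd hAway).mono fun ξ hξ => by simp only [hξ])
  rw [hft]
  refine (mul_le_mul_right (lintegral_norm_rpow_mul_ft_le hd hγ0.le hfγ) _).trans ?_
  rw [← ENNReal.ofReal_mul (by positivity)]
  refine ENNReal.ofReal_le_ofReal (le_of_eq ?_)
  rw [hA, Real.mul_rpow ha0.le hI.le, Real.rpow_add hI, ← Real.rpow_natCast ‖eh γ f‖ 2]
  push_cast; ring

/-! ### The Brezis–Lieb lemma -/

theorem exists_add_rpow_le {p : ℝ} (hp : 1 < p) {ε : ℝ} (hε : 0 < ε) :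
    ∃ C : ℝ, 0 ≤ C ∧ ∀ y z : ℝ, 0 ≤ y → 0 ≤ z → (y + z) ^ p ≤ (1 + ε) * y ^ p + C * z ^ p := by
  -- Jensen's inequality with weights `l` and `1 - l`, where `l ^ (1 - p) = 1 + ε`.
  set l : ℝ := (1 + ε) ^ (-(1 / (p - 1))) with hl
  have hp1 : 0 < p - 1 := by linarith
  have hl0 : 0 < l := by positivity
  have hl1 : l < 1 := Real.rpow_lt_one_of_one_lt_of_neg (by linarith) (by
    rw [neg_lt_zero]; positivity)
  have hlp : l * (1 / l) ^ p = 1 + ε := by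
    rw [one_div, ← Real.rpow_neg_one l, ← Real.rpow_mul hl0.le]
    nth_rewrite 1 [← Real.rpow_one l]
    rw [← Real.rpow_add hl0, hl, ← Real.rpow_mul (by linarith)]
    have : -(1 / (p - 1)) * (1 + -1 * p) = 1 := by field_simp; ring
    rw [this, Real.rpow_one]
  have hl2 : 0 < 1 - l := by linarith
  refine ⟨(1 - l) * (1 / (1 - l)) ^ p, by positivity, fun y z hy hz => ?_⟩
  have h1 := (convexOn_rpow hp.le).2 (x := 1 / l * y) (y := 1 / (1 - l) * z)
    (Set.mem_Ici.mpr (by positivity)) (Set.mem_Ici.mpr (by positivity)) hl0.le hl2.le (by ring)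
  simp only [smul_eq_mul] at h1
  rw [Real.mul_rpow (by positivity) hy, Real.mul_rpow (by positivity) hz, ← mul_assoc, ← mul_assoc,
    ← mul_assoc, ← mul_assoc, hlp, mul_one_div_cancel hl0.ne', mul_one_div_cancel hl2.ne', one_mul,
    one_mul] at h1
  exact h1

/-- The elementary inequality behind the Brezis–Lieb lemma. -/
theorem exists_abs_sub_rpow_le {p : ℝ} (hp : 1 < p) {ε : ℝ} (hε : 0 < ε) :
    ∃ C : ℝ, 0 ≤ C ∧ ∀ a b : ℂ, |‖a + b‖ ^ p - ‖a‖ ^ p| ≤ ε * ‖a‖ ^ p + C * ‖b‖ ^ p := by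
  obtain ⟨C, hC, h⟩ := exists_add_rpow_le hp hε
  refine ⟨C, hC, fun a b => ?_⟩
  have hp0 : 0 ≤ p := by linarith
  have h1 := h ‖a‖ ‖b‖ (norm_nonneg _) (norm_nonneg _)
  have h2 := h ‖a + b‖ ‖b‖ (norm_nonneg _) (norm_nonneg _)
  have h3 : ‖a + b‖ ^ p ≤ (‖a‖ + ‖b‖) ^ p := by gcongr; exact norm_add_le _ _
  have h4 : ‖a‖ ^ p ≤ (‖a + b‖ + ‖b‖) ^ p := by
    gcongr
    simpa using norm_sub_le (a + b) b
  have h5 : 0 ≤ ‖a‖ ^ p := by positivity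
  have h6 : 0 ≤ C * ‖b‖ ^ p := by positivity
  rw [abs_le]
  refine ⟨?_, by linarith⟩
  by_contra! hcon
  nlinarith

theorem norm_sub_rpow_le {p : ℝ} (hp : 0 ≤ p) (a b : ℂ) :
    ‖a - b‖ ^ p ≤ 2 ^ p * (‖a‖ ^ p + ‖b‖ ^ p) := by
  have h1 : ‖a - b‖ ≤ 2 * max ‖a‖ ‖b‖ := by
    have := norm_sub_le a b
    have := le_max_left ‖a‖ ‖b‖
    have := le_max_right ‖a‖ ‖b‖
    linarith
  have ha : 0 ≤ ‖a‖ ^ p := by positivity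
  have hb : 0 ≤ ‖b‖ ^ p := by positivity
  calc ‖a - b‖ ^ p ≤ (2 * max ‖a‖ ‖b‖) ^ p := by gcongr
    _ = 2 ^ p * (max ‖a‖ ‖b‖) ^ p := Real.mul_rpow zero_le_two (le_max_of_le_left (norm_nonneg _))
    _ ≤ 2 ^ p * (‖a‖ ^ p + ‖b‖ ^ p) := by
        gcongr
        rcases max_cases ‖a‖ ‖b‖ with ⟨h, _⟩ | ⟨h, _⟩ <;> rw [h] <;> linarith

theorem ip_sub_le {p : ℝ} (hp : 0 < p) {f g : Eu d → ℂ} (hf : MemLp f (ENNReal.ofReal p) volume)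
    (hg : MemLp g (ENNReal.ofReal p) volume) : ip p (f - g) ≤ 2 ^ p * (ip p f + ip p g) := by
  have hF := integrable_norm_rpow hp hf
  have hG := integrable_norm_rpow hp hg
  rw [ip, ip, ip, ← integral_add hF hG, ← integral_const_mul]
  refine integral_mono_of_nonneg (Eventually.of_forall fun x => by positivity)
    ((hF.add hG).const_mul _) (Eventually.of_forall fun x => ?_)
  exact norm_sub_rpow_le hp.le _ _

/-- Fatou's lemma in `L^p`. -/
theorem memLp_of_ae_tendsto {p : ℝ} (hp : 0 < p) {u : ℕ → Eu d → ℂ} {V : Eu d → ℂ}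
    (hu : ∀ n, MemLp (u n) (ENNReal.ofReal p) volume)
    (hae : ∀ᵐ x, Tendsto (fun n => u n x) atTop (𝓝 (V x))) {B : ℝ} (hB : ∀ n, ip p (u n) ≤ B) :
    MemLp V (ENNReal.ofReal p) volume ∧ ip p V ≤ B := by
  have hV : AEStronglyMeasurable V volume := aestronglyMeasurable_of_tendsto_ae atTop
    (fun n => (hu n).1) hae
  have hB0 : 0 ≤ B := (ip_nonneg _ _).trans (hB 0)
  refine ip_le_of_lintegral_le hp hV hB0 ?_
  calc ∫⁻ x, ‖V x‖ₑ ^ p ≤ ∫⁻ x, liminf (fun n => ‖u n x‖ₑ ^ p) atTop := by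
        refine lintegral_mono_ae (hae.mono fun x hx => ?_)
        exact (((ENNReal.continuous_rpow_const (y := p)).tendsto _).comp hx.enorm).liminf_eq.ge
    _ ≤ liminf (fun n => ∫⁻ x, ‖u n x‖ₑ ^ p) atTop :=
        lintegral_liminf_le' fun n => (hu n).1.enorm.pow_const p
    _ ≤ ENNReal.ofReal B := by
        refine liminf_le_of_le (by isBoundedDefault) fun b hb => ?_
        obtain ⟨n, hn⟩ := hb.exists
        rw [lintegral_eq_ofReal_ip hp (hu n)] at hn
        exact hn.trans (ENNReal.ofReal_le_ofReal (hB n))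

/-- The Brezis–Lieb lemma: `‖u_n‖_p^p - ‖u_n - V‖_p^p → ‖V‖_p^p` for a bounded sequence in `L^p`
that converges to `V` almost everywhere. -/
theorem tendsto_ip_sub {p : ℝ} (hp : 1 < p) {u : ℕ → Eu d → ℂ} {V : Eu d → ℂ}
    (hu : ∀ n, MemLp (u n) (ENNReal.ofReal p) volume)
    (hae : ∀ᵐ x, Tendsto (fun n => u n x) atTop (𝓝 (V x))) {B : ℝ} (hB : ∀ n, ip p (u n) ≤ B) :
    Tendsto (fun n => ip p (u n) - ip p (u n - V)) atTop (𝓝 (ip p V)) := by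
  have hp0 : 0 < p := by linarith
  obtain ⟨hV, hVB⟩ := memLp_of_ae_tendsto hp0 hu hae hB
  set B' : ℝ := 2 ^ p * (B + B) with hB'
  have hsub : ∀ n, ip p (u n - V) ≤ B' := fun n => (ip_sub_le hp0 (hu n) hV).trans (by
    rw [hB']; gcongr; exact hB n)
  have hIV := integrable_norm_rpow hp0 hV
  have hIu := fun n => integrable_norm_rpow hp0 (hu n)
  have hIs := fun n => integrable_norm_rpow hp0 ((hu n).sub hV)
  have hB'0 : 0 ≤ B' := (ip_nonneg _ _).trans (hsub 0)
  rw [Metric.tendsto_atTop]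
  intro η hη
  set ε : ℝ := η / (2 * (B' + 1)) with hε
  have hε0 : 0 < ε := by positivity
  obtain ⟨C, hC, hineq⟩ := exists_abs_sub_rpow_le hp hε0
  set g : ℕ → Eu d → ℝ := fun n x => |‖u n x‖ ^ p - ‖(u n - V) x‖ ^ p - ‖V x‖ ^ p| with hg
  -- The excess of `g n` over `ε |u_n - V|^p` is dominated by a multiple of `|V|^p`.
  set W : ℕ → Eu d → ℝ := fun n x => max (g n x - ε * ‖(u n - V) x‖ ^ p) 0 with hW
  have hgI : ∀ n, Integrable (g n) := fun n => (((hIu n).sub (hIs n)).sub hIV).abs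
  have hWI : ∀ n, Integrable (W n) := fun n => ((hgI n).sub ((hIs n).const_mul ε)).pos_part
  have hWb : ∀ n x, ‖W n x‖ ≤ (C + 1) * ‖V x‖ ^ p := fun n x => by
    have h0 : 0 ≤ ‖V x‖ ^ p := by positivity
    rw [hW, Real.norm_of_nonneg (le_max_right _ _)]
    refine max_le ?_ (by positivity)
    have h1 := hineq ((u n - V) x) (V x)
    have h2 : (u n - V) x + V x = u n x := by simp
    rw [h2] at h1
    have h3 := abs_sub (‖u n x‖ ^ p - ‖(u n - V) x‖ ^ p) (‖V x‖ ^ p)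
    rw [abs_of_nonneg h0] at h3
    simp only [hg]
    linarith
  have hW0 : Tendsto (fun n => ∫ x, W n x) atTop (𝓝 0) := by
    have := tendsto_integral_of_dominated_convergence (F := W) (f := fun _ => (0 : ℝ)) (μ := volume)
      (fun x => (C + 1) * ‖V x‖ ^ p) (fun n => (hWI n).1) (hIV.const_mul _)
      (fun n => Eventually.of_forall (hWb n)) (hae.mono fun x hx => ?_)
    · simpa using this
    · have c1 : Tendsto (fun n => ‖u n x‖ ^ p) atTop (𝓝 (‖V x‖ ^ p)) :=
        hx.norm.rpow_const (Or.inr hp0.le)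
      have c2 : Tendsto (fun n => ‖(u n - V) x‖ ^ p) atTop (𝓝 0) := by
        have := (hx.sub_const (V x)).norm.rpow_const (p := p) (Or.inr hp0.le)
        simpa [Real.zero_rpow hp0.ne'] using this
      have c3 := (((c1.sub c2).sub_const (‖V x‖ ^ p)).abs.sub (c2.const_mul ε)).max
        (tendsto_const_nhds (x := (0 : ℝ)))
      simpa [hW, hg] using c3
  obtain ⟨N, hN⟩ := Metric.tendsto_atTop.mp hW0 (η / 2) (by positivity)
  refine ⟨N, fun n hn => ?_⟩
  have h1 : ip p (u n) - ip p (u n - V) - ip p V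
      = ∫ x, (‖u n x‖ ^ p - ‖(u n - V) x‖ ^ p - ‖V x‖ ^ p) := by
    have hI2 : Integrable fun x => ‖u n x‖ ^ p - ‖(u n - V) x‖ ^ p := (hIu n).sub (hIs n)
    rw [integral_sub hI2 hIV, integral_sub (hIu n) (hIs n)]
    rfl
  have h2 : ∫ x, g n x ≤ ∫ x, (W n x + ε * ‖(u n - V) x‖ ^ p) := by
    refine integral_mono (hgI n) ((hWI n).add ((hIs n).const_mul ε)) fun x => ?_
    have := le_max_left (g n x - ε * ‖(u n - V) x‖ ^ p) 0
    simp only [hW]; linarith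
  rw [integral_add (hWI n) ((hIs n).const_mul ε), integral_const_mul] at h2
  have h3 := hN n hn
  rw [Real.dist_eq, sub_zero] at h3
  have h4 : ε * ∫ x, ‖(u n - V) x‖ ^ p ≤ ε * B' := by
    gcongr; exact hsub n
  have h5 : ε * B' < η / 2 := by
    rw [hε, div_mul_eq_mul_div, div_lt_div_iff₀ (by positivity) (by positivity)]
    nlinarith
  rw [Real.dist_eq, h1]
  calc _ ≤ ∫ x, g n x := abs_integral_le_integral_abs
    _ < η := by linarith [le_abs_self (∫ x, W n x)]

/-! ### Weak convergence in `L²` -/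

/-- Weak convergence in the Hilbert space `L²`. -/
def WeakLim (u : ℕ → L2 d) (a : L2 d) : Prop :=
  ∀ g : L2 d, Tendsto (fun n => inner ℂ g (u n)) atTop (𝓝 (inner ℂ g a))

theorem WeakLim.comp {u : ℕ → L2 d} {a : L2 d} (h : WeakLim u a) {φ : ℕ → ℕ} (hφ : StrictMono φ) :
    WeakLim (fun n => u (φ n)) a := fun g => (h g).comp hφ.tendsto_atTop

theorem WeakLim.unique {u : ℕ → L2 d} {a b : L2 d} (ha : WeakLim u a) (hb : WeakLim u b) : a = b :=
  ext_inner_left ℂ fun g => tendsto_nhds_unique (ha g) (hb g)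

theorem WeakLim.sub {u v : ℕ → L2 d} {a b : L2 d} (ha : WeakLim u a) (hb : WeakLim v b) :
    WeakLim (fun n => u n - v n) (a - b) := fun g => by
  simp only [inner_sub_right]
  exact (ha g).sub (hb g)

theorem weakLim_const (a : L2 d) : WeakLim (fun _ => a) a := fun _ => tendsto_const_nhds

/-- Bounded sequences in `L²` are weakly precompact (Banach–Alaoglu). -/
theorem exists_weakLim_subseq {u : ℕ → L2 d} {B : ℝ} (hu : ∀ n, ‖u n‖ ≤ B) :
    ∃ (φ : ℕ → ℕ) (a : L2 d), StrictMono φ ∧ WeakLim (fun n => u (φ n)) a := by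
  have : Fact ((2 : ℝ≥0∞) ≠ ∞) := ⟨ENNReal.ofNat_ne_top⟩
  have : TopologicalSpace.SeparableSpace (L2 d) := inferInstance
  let J := InnerProductSpace.toDual ℂ (L2 d)
  have h1 : ∀ n, (StrongDual.toWeakDual (J (u n))) ∈
      WeakDual.toStrongDual ⁻¹' Metric.closedBall (0 : StrongDual ℂ (L2 d)) B := fun n => by
    simpa using hu n
  obtain ⟨F, -, φ, hφ, hF⟩ := WeakDual.isSeqCompact_closedBall ℂ (L2 d) 0 B h1
  refine ⟨φ, J.symm (WeakDual.toStrongDual F), hφ, fun g => ?_⟩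
  have h2 : Tendsto (fun n => inner ℂ (u (φ n)) g) atTop (𝓝 (WeakDual.toStrongDual F g)) :=
    ((WeakDual.eval_continuous g).tendsto F).comp hF
  have h3 : WeakDual.toStrongDual F g = inner ℂ (J.symm (WeakDual.toStrongDual F)) g := by
    rw [← InnerProductSpace.toDual_apply_apply]; simp [J]
  rw [h3] at h2
  have h4 := (Complex.continuous_conj.tendsto _).comp h2
  simpa [Function.comp_def, inner_conj_symm] using h4

theorem inner_toLp_conj {g : Eu d → ℂ} (hg : MemLp g 2 volume) (U : L2 d) :
    inner ℂ (hg.star.toLp) U = ∫ x, U x * g x := by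
  rw [L2.inner_def]
  refine integral_congr_ae ?_
  filter_upwards [hg.star.coeFn_toLp] with x hx
  rw [hx]
  simp

theorem WeakLim.tendsto_integral {U : ℕ → L2 d} {a : L2 d} (h : WeakLim U a) {g : Eu d → ℂ}
    (hg : MemLp g 2 volume) :
    Tendsto (fun n => ∫ x, U n x * g x) atTop (𝓝 (∫ x, a x * g x)) := by
  simpa only [inner_toLp_conj hg] using h hg.star.toLp

/-- Removing the weak limit from a sequence removes the square of its norm. -/
theorem WeakLim.tendsto_norm_sub_sq {u : ℕ → L2 d} {a : L2 d} (h : WeakLim u a) {M : ℝ}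
    (hM : Tendsto (fun n => ‖u n‖ ^ 2) atTop (𝓝 M)) :
    Tendsto (fun n => ‖u n - a‖ ^ 2) atTop (𝓝 (M - ‖a‖ ^ 2)) := by
  have h1 : ∀ n, ‖u n - a‖ ^ 2 = ‖u n‖ ^ 2 - 2 * (inner ℂ a (u n)).re + ‖a‖ ^ 2 := fun n => by
    rw [norm_sub_sq (𝕜 := ℂ) (u n) a, inner_re_symm]
    rfl
  have h2 : Tendsto (fun n => (inner ℂ a (u n)).re) atTop (𝓝 (‖a‖ ^ 2)) := by
    have := (Complex.continuous_re.tendsto _).comp (h a)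
    rw [inner_self_eq_norm_sq_to_K] at this
    refine this.trans (le_of_eq ?_)
    congr 1
    norm_cast
  simp only [h1]
  have := (hM.sub (h2.const_mul 2)).add_const (‖a‖ ^ 2)
  refine this.trans (le_of_eq ?_)
  congr 1; ring

/-! ### Weak limits of functions with bounded Sobolev norms -/

/-- A function that is flat at the origin vanishes there to first order, which compensates the
singularity `|ξ|^{-s}` in every dimension as `s ≤ 1`. -/
theorem memLp_sym_neg_mul_flat (hd : 0 < d) {s : ℝ} (hs0 : 0 ≤ s) (hs1 : s ≤ 1) {φ : 𝓢(Eu d, ℂ)}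
    (hφ : φ ∈ flatSchwartz d) : MemLp (fun ξ => sym (-s) ξ * φ ξ) 2 volume := by
  have h0 : φ 0 = 0 := by
    have h := hφ 0
    have h' := norm_iteratedFDeriv_zero (𝕜 := ℝ) (f := (φ : Eu d → ℂ)) (x := 0)
    rw [h, norm_zero] at h'
    exact norm_eq_zero.mp h'.symm
  set C : ℝ := SchwartzMap.seminorm ℝ 0 1 φ with hC
  have hC0 : 0 ≤ C := apply_nonneg _ _
  have hlip : ∀ ξ : Eu d, ‖φ ξ‖ ≤ C * ‖ξ‖ := fun ξ => by
    have := Convex.norm_image_sub_le_of_norm_fderiv_le (𝕜 := ℝ) (f := (φ : Eu d → ℂ)) (C := C)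
      (s := Set.univ) (x := 0) (y := ξ) (fun x _ => φ.differentiableAt) (fun x _ => by
        have h2 := φ.norm_iteratedFDeriv_le_seminorm ℝ 1 x
        rwa [norm_iteratedFDeriv_one] at h2) convex_univ trivial trivial
    simpa [h0] using this
  have hpi : (1 : ℝ) ≤ 2 * Real.pi := by linarith [Real.pi_gt_three]
  have hmeas : AEStronglyMeasurable (fun ξ => sym (-s) ξ * φ ξ) volume :=
    (measurable_sym _).aestronglyMeasurable.mul φ.continuous.aestronglyMeasurable
  have hsplit : (fun ξ => sym (-s) ξ * φ ξ)
      = fun ξ => Set.indicator (Metric.ball 0 1) (fun ξ => sym (-s) ξ * φ ξ) ξ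
        + Set.indicator (Metric.ball 0 1)ᶜ (fun ξ => sym (-s) ξ * φ ξ) ξ := by
    funext ξ
    rw [← Pi.add_apply (f := Set.indicator _ _), Set.indicator_self_add_compl]
  rw [hsplit]
  refine MemLp.add ?_ ?_
  · rw [memLp_indicator_iff_restrict Metric.isOpen_ball.measurableSet]
    have : IsFiniteMeasure ((volume : Measure (Eu d)).restrict (Metric.ball 0 1)) :=
      ⟨by rw [Measure.restrict_apply_univ]; exact measure_ball_lt_top⟩
    refine MemLp.of_bound hmeas.restrict C ?_
    filter_upwards [ae_restrict_mem Metric.isOpen_ball.measurableSet,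
      ae_restrict_of_ae (ae_ne_zero hd)] with ξ hξ hξ0
    have hn : 0 < ‖ξ‖ := norm_pos_iff.mpr hξ0
    have hn1 : ‖ξ‖ ≤ 1 := (mem_ball_zero_iff.mp hξ).le
    rw [norm_mul, norm_sym]
    calc (2 * Real.pi * ‖ξ‖) ^ (-s) * ‖φ ξ‖ ≤ ‖ξ‖ ^ (-s) * (C * ‖ξ‖) := by
          exact mul_le_mul (Real.rpow_le_rpow_of_nonpos hn (le_mul_of_one_le_left hn.le hpi)
            (by linarith)) (hlip ξ) (norm_nonneg _) (by positivity)
      _ = C * ‖ξ‖ ^ (1 - s) := by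
          rw [sub_eq_neg_add, Real.rpow_add hn, Real.rpow_one]; ring
      _ ≤ C := mul_le_of_le_one_right hC0 (Real.rpow_le_one hn.le hn1 (by linarith))
  · refine MemLp.of_le (φ.memLp 2 volume) (hmeas.indicator Metric.isOpen_ball.measurableSet.compl)
      (Eventually.of_forall fun ξ => ?_)
    by_cases hξ : ξ ∈ Metric.ball (0 : Eu d) 1
    · rw [Set.indicator_of_notMem (by simpa using hξ), norm_zero]; positivity
    · rw [Set.indicator_of_mem (by simpa using hξ), norm_mul, norm_sym]
      have h1 : 1 ≤ ‖ξ‖ := by simpa using hξ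
      refine mul_le_of_le_one_left (norm_nonneg _) ?_
      exact Real.rpow_le_one_of_one_le_of_nonpos (one_le_mul_of_one_le_of_one_le hpi h1) (by linarith)

theorem memLp_sym_neg_mul_schwartz (hd : 0 < d) {γ : ℝ} (hγ0 : 0 ≤ γ) (hγd : 2 * γ < d)
    (φ : 𝓢(Eu d, ℂ)) : MemLp (fun ξ => sym (-γ) ξ * φ ξ) 2 volume := by
  have hpi : (1 : ℝ) ≤ 2 * Real.pi := by linarith [Real.pi_gt_three]
  have hmeas : AEStronglyMeasurable (fun ξ => sym (-γ) ξ * φ ξ) volume :=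
    (measurable_sym _).aestronglyMeasurable.mul φ.continuous.aestronglyMeasurable
  set C : ℝ := SchwartzMap.seminorm ℝ 0 0 φ with hC
  have hC0 : 0 ≤ C := apply_nonneg _ _
  have h1 : MemLp (fun ξ : Eu d => C * ‖lowSym γ 1 ξ‖) 2 volume :=
    (memLp_lowSym hd hγd).norm.const_mul C
  have h2 : MemLp (fun ξ : Eu d => ‖φ ξ‖) 2 volume := (φ.memLp 2 volume).norm
  have h3 : MemLp (fun ξ : Eu d => C * ‖lowSym γ 1 ξ‖ + ‖φ ξ‖) 2 volume := h1.add h2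
  refine h3.mono hmeas (Eventually.of_forall fun ξ => ?_)
  rw [Real.norm_of_nonneg (by positivity), norm_mul, lowSym]
  by_cases hξ : ξ ∈ Metric.ball (0 : Eu d) 1
  · rw [Set.indicator_of_mem hξ, mul_comm]
    have := φ.norm_le_seminorm ℝ ξ
    have h2 : ‖φ ξ‖ * ‖sym (-γ) ξ‖ ≤ C * ‖sym (-γ) ξ‖ := by gcongr
    linarith [norm_nonneg (φ ξ)]
  · rw [Set.indicator_of_notMem hξ, norm_zero, mul_zero, zero_add, norm_sym]
    have h1 : 1 ≤ ‖ξ‖ := by simpa using hξ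
    refine mul_le_of_le_one_left (norm_nonneg _) ?_
    exact Real.rpow_le_one_of_one_le_of_nonpos (one_le_mul_of_one_le_of_one_le hpi h1) (by linarith)

/-- The graph of the Fourier transform is closed for distributional convergence on the space side
and weak convergence of `|ξ|^γ û_n` on the frequency side. -/
theorem hasFourierOn_of_weakLim (hd : 0 < d) {T : Set 𝓢(Eu d, ℂ)} (hT : flatSchwartz d ⊆ T) {γ : ℝ}
    (hTγ : ∀ φ ∈ T, MemLp (fun ξ => sym (-γ) ξ * φ ξ) 2 volume) {u h : ℕ → Eu d → ℂ}
    {V : Eu d → ℂ} {G : L2 d} (hu : ∀ n, HasFourierOn T (u n) (h n))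
    (hfin : ∀ n, hdotNorm γ (u n) < ∞) (hVm : AEStronglyMeasurable V volume)
    (hVt : ∀ φ : 𝓢(Eu d, ℂ), Integrable (fun x => V x * φ x) volume)
    (hlim : ∀ φ : 𝓢(Eu d, ℂ), Tendsto (fun n => ∫ x, u n x * φ x) atTop (𝓝 (∫ x, V x * φ x)))
    (hG : WeakLim (fun n => eh γ (u n)) G) :
    HasFourierOn T V (fun ξ => sym (-γ) ξ * G ξ) ∧ hdotNorm γ V < ∞ ∧ eh γ V = G := by
  have hF : HasFourierOn T V (fun ξ => sym (-γ) ξ * G ξ) := by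
    refine ⟨hVm, hVt, (measurable_sym _).aestronglyMeasurable.mul (Lp.memLp G).1,
      fun φ hφ => ?_, fun φ hφ => ?_⟩
    · have := memLp_one_iff_integrable.mp (MemLp.mul (p := 2) (q := 2) (Lp.memLp G) (hTγ φ hφ))
      refine this.congr (Eventually.of_forall fun ξ => ?_)
      simp only [Pi.mul_apply]; ring
    · have h1 := hG.tendsto_integral (hTγ φ hφ)
      refine tendsto_nhds_unique (hlim (𝓕 φ)) (h1.congr' (Eventually.of_forall fun n => ?_)) |>.trans
        (integral_congr_ae (Eventually.of_forall fun ξ => by simp only; ring))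
      refine Eq.trans ?_ ((hu n).pairing φ hφ).symm
      refine integral_congr_ae ?_
      filter_upwards [coe_eh hd (hfin n), ft_ae_eq hd ((hu n).mono hT), ae_ne_zero hd]
        with ξ h2 h3 h4
      have h5 : sym γ ξ * sym (-γ) ξ = 1 := by
        rw [← sym_add _ _ h4, add_neg_cancel]; simp [sym]
      rw [h2, h3]
      linear_combination (h n ξ * φ ξ) * h5
  have hF' : HasFourierAway V (fun ξ => sym (-γ) ξ * G ξ) := hF.mono hT
  have hG' : (G : Eu d → ℂ) =ᵐ[volume] fun ξ => sym γ ξ * (sym (-γ) ξ * G ξ) := by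
    filter_upwards [ae_ne_zero hd] with ξ h4
    rw [← mul_assoc, ← sym_add _ _ h4, add_neg_cancel]
    simp [sym]
  have hfinV : hdotNorm γ V < ∞ :=
    (memLp_sym_mul_iff hd hF').mp ((memLp_congr_ae hG').mp (Lp.memLp G))
  exact ⟨hF, hfinV, eh_eq_of_ae hd hF' hfinV hG'⟩

/-! ### Local compactness of bounded sequences -/

theorem lintegral_sub_avg_le_rpow (hd : 0 < d) {r : ℝ} (hr : 0 < r) {q : ℝ≥0∞} (hq1 : 1 < q)
    (hq : q ≠ ∞) {s : ℝ} (hs0 : 0 ≤ s) (hs1 : s ≤ 1) {f : Eu d → ℂ} (hf : MemLp f q volume)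
    (hfs : hdotNorm s f < ∞) :
    ∫⁻ x, ‖f x - avg r f x‖ₑ ^ (2 : ℝ) ≤
      ENNReal.ofReal ((2 * Real.pi) ^ 2 * r ^ (2 * s) * ‖eh s f‖ ^ 2) := by
  refine (lintegral_sub_avg_le hd hr hq1 hq hs0 hs1 hf hfs).trans ?_
  rw [ENNReal.ofReal_mul (by positivity)]
  refine le_trans ?_ (mul_le_mul_right (lintegral_norm_rpow_mul_ft_le hd hs0 hfs) _)
  rw [← lintegral_const_mul' _ _ ENNReal.ofReal_ne_top]
  refine lintegral_mono fun ξ => ?_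
  rw [← mul_assoc, ← ENNReal.ofReal_mul (by positivity)]
  gcongr ENNReal.ofReal ?_ * _
  rw [mul_assoc]
  gcongr
  rw [← Real.mul_rpow hr.le (norm_nonneg _), div_inv_eq_mul, Real.rpow_mul (by positivity), mul_comm]
  have h := min_one_le_rpow (x := (r * ‖ξ‖) ^ 2) (by positivity) hs0 hs1
  rwa [Real.rpow_two]

/-- A positive weight in `L²`: the square root of `(1 + |x|)^{-(d+1)}`. -/
def wt (x : Eu d) : ℝ := (1 + ‖x‖) ^ (-((d : ℝ) + 1) / 2)

theorem wt_pos (x : Eu d) : 0 < wt x := by unfold wt; positivity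

theorem wt_le_one (x : Eu d) : wt x ≤ 1 :=
  Real.rpow_le_one_of_one_le_of_nonpos (by linarith [norm_nonneg x])
    (by have : (0 : ℝ) ≤ d := Nat.cast_nonneg d
        linarith)

theorem measurable_wt : Measurable (wt : Eu d → ℝ) := by
  unfold wt; fun_prop

theorem wt_sq (x : Eu d) : wt x ^ 2 = (1 + ‖x‖) ^ (-((d : ℝ) + 1)) := by
  rw [wt, ← Real.rpow_natCast, ← Real.rpow_mul (by positivity)]
  norm_num

theorem integrable_wt_sq : Integrable (fun x : Eu d => wt x ^ 2) := by
  simp only [wt_sq]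
  exact integrable_one_add_norm (by simp)

/-- Multiplication by the weight. -/
def wmul (f : Eu d → ℂ) (x : Eu d) : ℂ := (wt x : ℂ) * f x

theorem norm_wmul (f : Eu d → ℂ) (x : Eu d) : ‖wmul f x‖ = wt x * ‖f x‖ := by
  rw [wmul, norm_mul, Complex.norm_real, Real.norm_of_nonneg (wt_pos x).le]

theorem aesm_wmul {f : Eu d → ℂ} (hf : AEStronglyMeasurable f volume) :
    AEStronglyMeasurable (wmul f) volume :=
  (Complex.measurable_ofReal.comp measurable_wt).aestronglyMeasurable.mul hf

/-- `L^q`, `q ≥ 2`, embeds into weighted `L²`: `w² |f|² ≤ w² + |f|^q` for a weight `w ≤ 1`. -/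
theorem ip_wmul_le {q : ℝ} (hq : 2 ≤ q) {f : Eu d → ℂ} (hf : MemLp f (ENNReal.ofReal q) volume) :
    MemLp (wmul f) (ENNReal.ofReal 2) volume ∧
      ip 2 (wmul f) ≤ (∫ x : Eu d, wt x ^ 2) + ip q f := by
  have hint := integrable_norm_rpow (by linarith) hf
  refine ip_le_of_lintegral_le two_pos (aesm_wmul hf.1)
    (add_nonneg (integral_nonneg fun x => by positivity) (ip_nonneg _ _)) ?_
  have hI : ENNReal.ofReal (∫ x : Eu d, (wt x ^ 2 + ‖f x‖ ^ q))
      = ∫⁻ x : Eu d, ENNReal.ofReal (wt x ^ 2 + ‖f x‖ ^ q) :=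
    ofReal_integral_eq_lintegral_ofReal (integrable_wt_sq.add hint)
      (Eventually.of_forall fun x => by positivity)
  rw [ip, ← integral_add integrable_wt_sq hint, hI]
  refine lintegral_mono fun x => ?_
  rw [← ofReal_norm, ENNReal.ofReal_rpow_of_nonneg (norm_nonneg _) (by norm_num), norm_wmul]
  refine ENNReal.ofReal_le_ofReal ?_
  rw [Real.rpow_two, mul_pow]
  have h1 : wt x ^ 2 ≤ 1 := pow_le_one₀ (wt_pos x).le (wt_le_one x)
  have h3 : 0 ≤ ‖f x‖ ^ q := by positivity
  rcases le_total ‖f x‖ 1 with h | h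
  · have h2 : ‖f x‖ ^ 2 ≤ 1 := pow_le_one₀ (norm_nonneg _) h
    nlinarith [sq_nonneg (wt x)]
  · have h2 : ‖f x‖ ^ 2 ≤ ‖f x‖ ^ q := by
      rw [← Real.rpow_two]; exact Real.rpow_le_rpow_of_exponent_le h hq
    nlinarith [sq_nonneg (wt x), sq_nonneg ‖f x‖]

theorem norm_toLp_sq {f : Eu d → ℂ} (hf : MemLp f 2 volume) : ‖hf.toLp‖ ^ 2 = ip 2 f := by
  have h : MemLp f (ENNReal.ofReal 2) volume := by simpa using hf
  rw [Lp.norm_toLp]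
  have := lebNorm_eq two_pos h
  rw [lebNorm, ENNReal.ofReal_ofNat] at this
  rw [this, ENNReal.toReal_ofReal (Real.rpow_nonneg (ip_nonneg _ _) _), ← Real.rpow_natCast,
    ← Real.rpow_mul (ip_nonneg _ _)]
  norm_num

/-- Division by the weight. -/
def wdiv (f : Eu d → ℂ) (x : Eu d) : ℂ := (wt x : ℂ)⁻¹ * f x

theorem wdiv_wmul (f : Eu d → ℂ) (x : Eu d) : wdiv (wmul f) x = f x := by
  have : (wt x : ℂ) ≠ 0 := by exact_mod_cast (wt_pos x).ne'
  simp [wdiv, wmul, this]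

theorem aesm_wdiv {f : Eu d → ℂ} (hf : AEStronglyMeasurable f volume) :
    AEStronglyMeasurable (wdiv f) volume :=
  (Complex.measurable_ofReal.comp measurable_wt).inv.aestronglyMeasurable.mul hf

theorem memLp_wdiv {g : Eu d → ℂ} (hg : AEStronglyMeasurable g volume) {C : ℝ}
    (hC : ∀ x, ‖g x‖ ≤ C * wt x ^ 2) : MemLp (wdiv g) 2 volume := by
  have h1 : MemLp (fun x : Eu d => wt x) 2 volume := by
    rw [memLp_two_iff_integrable_sq measurable_wt.aestronglyMeasurable]
    exact integrable_wt_sq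
  refine (h1.const_mul C).mono (aesm_wdiv hg)
    (Eventually.of_forall fun x => ?_)
  rw [wdiv, norm_mul, norm_inv, Complex.norm_real, Real.norm_of_nonneg (wt_pos x).le,
    ← div_eq_inv_mul]
  refine ((div_le_iff₀ (wt_pos x)).mpr ?_).trans (le_abs_self _)
  calc _ ≤ _ := hC x
    _ = _ := by ring

theorem exists_schwartz_le_wt (φ : 𝓢(Eu d, ℂ)) : ∃ C : ℝ, ∀ x, ‖φ x‖ ≤ C * wt x ^ 2 := by
  refine ⟨2 ^ (d + 1) * ((Finset.Iic (d + 1, 0)).sup fun m => SchwartzMap.seminorm ℝ m.1 m.2) φ,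
    fun x => ?_⟩
  have h := SchwartzMap.one_add_le_sup_seminorm_apply (𝕜 := ℝ) (m := (d + 1, 0)) (k := d + 1) (n := 0)
    le_rfl le_rfl φ x
  rw [norm_iteratedFDeriv_zero] at h
  rw [wt_sq, Real.rpow_neg (by positivity), ← div_eq_mul_inv, le_div_iff₀ (by positivity)]
  calc _ = (1 + ‖x‖) ^ (d + 1) * ‖φ x‖ := by
        rw [mul_comm]; congr 1
        exact_mod_cast Real.rpow_natCast (1 + ‖x‖) (d + 1)
    _ ≤ _ := h

theorem indicator_ball_le_wt (x : Eu d) (r : ℝ) (y : Eu d) :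
    ‖Set.indicator (Metric.ball x r) (fun _ => (1 : ℂ)) y‖
      ≤ (1 + ‖x‖ + |r|) ^ ((d : ℝ) + 1) * wt y ^ 2 := by
  by_cases hy : y ∈ Metric.ball x r
  · rw [Set.indicator_of_mem hy, norm_one, wt_sq, Real.rpow_neg (by positivity), ← div_eq_mul_inv,
      le_div_iff₀ (by positivity), one_mul]
    refine Real.rpow_le_rpow (by positivity) ?_ (by positivity)
    have h1 : ‖y‖ ≤ ‖x‖ + ‖y - x‖ := by
      simpa using norm_add_le x (y - x)
    have h2 : ‖y - x‖ < r := by simpa [dist_eq_norm] using hy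
    linarith [le_abs_self r]
  · rw [Set.indicator_of_notMem hy, norm_zero]; positivity

theorem avg_eq_integral (r : ℝ) (f : Eu d → ℂ) (x : Eu d) :
    avg r f x = ((volume (Metric.ball (0 : Eu d) r))⁻¹).toReal •
      ∫ y, f y * Set.indicator (Metric.ball x r) (fun _ => (1 : ℂ)) y := by
  rw [avg, ballMeas, integral_smul_measure, ← integral_indicator Metric.isOpen_ball.measurableSet,
    ← integral_add_left_eq_self
      (fun y => f y * Set.indicator (Metric.ball x r) (fun _ => (1 : ℂ)) y) x]
  congr 1
  refine integral_congr_ae (Eventually.of_forall fun y => ?_)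
  have : x + y ∈ Metric.ball x r ↔ y ∈ Metric.ball (0 : Eu d) r := by simp
  by_cases hy : y ∈ Metric.ball (0 : Eu d) r
  · simp only [Set.indicator_of_mem hy, Set.indicator_of_mem (this.mpr hy), mul_one]
  · simp only [Set.indicator_of_notMem hy, Set.indicator_of_notMem (mt this.mp hy), mul_zero]

theorem tendsto_eLpNorm_wmul {w : ℕ → Eu d → ℂ} {a : Eu d → ℂ}
    (hm : ∀ n, AEStronglyMeasurable (w n) volume) {C : ℝ} (hC : ∀ n x, ‖w n x‖ ≤ C)
    (hlim : ∀ x, Tendsto (fun n => w n x) atTop (𝓝 (a x))) :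
    Tendsto (fun n => eLpNorm (wmul (w n - a)) 2 volume) atTop (𝓝 0) := by
  have ha : ∀ x, ‖a x‖ ≤ C := fun x =>
    le_of_tendsto (hlim x).norm (Eventually.of_forall fun n => hC n x)
  have ham : AEStronglyMeasurable a volume :=
    aestronglyMeasurable_of_tendsto_ae atTop hm (Eventually.of_forall hlim)
  have hC0 : 0 ≤ C := (norm_nonneg _).trans (ha 0)
  have key : Tendsto (fun n => ∫⁻ x, ‖wmul (w n - a) x‖ₑ ^ (2 : ℝ)) atTop
      (𝓝 (∫⁻ _ : Eu d, 0)) := by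
    refine tendsto_lintegral_of_dominated_convergence'
      (fun x => ENNReal.ofReal ((2 * C) ^ 2 * wt x ^ 2))
      (fun n => (aesm_wmul ((hm n).sub ham)).enorm.pow_const _) (fun n => ?_) ?_ ?_
    · refine Eventually.of_forall fun x => ?_
      beta_reduce
      rw [← ofReal_norm, ENNReal.ofReal_rpow_of_nonneg (norm_nonneg _) (by norm_num), norm_wmul,
        Real.rpow_two, mul_pow, mul_comm]
      refine ENNReal.ofReal_le_ofReal ?_
      gcongr
      refine (norm_sub_le _ _).trans ?_
      linarith [hC n x, ha x]
    · exact ((integrable_wt_sq.const_mul _).lintegral_lt_top).ne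
    · refine Eventually.of_forall fun x => ?_
      have h1 : Tendsto (fun n => wmul (w n - a) x) atTop (𝓝 0) := by
        have := ((hlim x).sub_const (a x)).const_mul (wt x : ℂ)
        simpa [wmul] using this
      have h2 := (ENNReal.continuous_rpow_const (y := (2 : ℝ))).tendsto _ |>.comp h1.enorm
      simpa [Function.comp_def] using h2
  have h3 := ((ENNReal.continuous_rpow_const (y := (1 / 2 : ℝ))).tendsto _).comp key
  have h4 : ∀ n, eLpNorm (wmul (w n - a)) 2 volume
      = (∫⁻ x, ‖wmul (w n - a) x‖ₑ ^ (2 : ℝ)) ^ (1 / 2 : ℝ) := fun n => by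
    rw [eLpNorm_eq_lintegral_rpow_enorm_toReal two_ne_zero ENNReal.ofNat_ne_top]
    norm_num
  simp only [h4]
  simpa [Function.comp_def] using h3

theorem wmul_sub (f g : Eu d → ℂ) : wmul (f - g) = wmul f - wmul g := by
  funext x; simp [wmul, mul_sub]

theorem eLpNorm_wmul_le (f : Eu d → ℂ) : eLpNorm (wmul f) 2 volume ≤ eLpNorm f 2 volume :=
  eLpNorm_mono fun x => by
    rw [norm_wmul]; exact mul_le_of_le_one_left (norm_nonneg _) (wt_le_one x)

/-- The averages of `u n` over small balls are close to `u n` in `L²`, uniformly in `n`; hence a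
sequence whose averages converge pointwise is Cauchy in weighted `L²`. -/
theorem cauchySeq_wmul (hd : 0 < d) {s q : ℝ} (hs0 : 0 < s) (hs1 : s < 1) (hq : 2 ≤ q)
    {u : ℕ → Eu d → ℂ} {B B' : ℝ} (hu : ∀ n, MemLp (u n) (ENNReal.ofReal q) volume)
    (hfs : ∀ n, hdotNorm s (u n) < ∞) (hB : ∀ n, ip q (u n) ≤ B) (hB' : ∀ n, ‖eh s (u n)‖ ≤ B')
    {a : ℝ → Eu d → ℂ}
    (havg : ∀ r > 0, ∀ x, Tendsto (fun n => avg r (u n) x) atTop (𝓝 (a r x)))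
    (hU : ∀ n, MemLp (wmul (u n)) 2 volume) : CauchySeq fun n => (hU n).toLp := by
  rw [EMetric.cauchySeq_iff]
  intro ε hε
  have hq1 : 1 < ENNReal.ofReal q := by
    rw [ENNReal.one_lt_ofReal]; linarith
  have hε4 : 0 < ε / 4 := ENNReal.div_pos hε.ne' (by norm_num)
  have hlim : Tendsto (fun r : ℝ => ENNReal.ofReal ((2 * Real.pi) ^ 2 * r ^ (2 * s) * B' ^ 2)
      ^ (1 / 2 : ℝ)) (𝓝[>] 0) (𝓝 0) := by
    have h1 : Tendsto (fun r : ℝ => (2 * Real.pi) ^ 2 * r ^ (2 * s) * B' ^ 2) (𝓝[>] 0)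
        (𝓝 ((2 * Real.pi) ^ 2 * 0 ^ (2 * s) * B' ^ 2)) := by
      refine Tendsto.mono_left ?_ nhdsWithin_le_nhds
      exact (((Real.continuousAt_rpow_const 0 (2 * s) (Or.inr (by linarith))).tendsto).const_mul
        _).mul_const _
    have h2 := ((ENNReal.continuous_rpow_const (y := (1 / 2 : ℝ))).tendsto _).comp
      (ENNReal.tendsto_ofReal h1)
    rw [Real.zero_rpow (by linarith)] at h2
    simpa [Function.comp_def] using h2
  -- a radius for which all averages are within `ε / 4`
  obtain ⟨r, hr1, hr⟩ := ((hlim.eventually_lt_const hε4).and self_mem_nhdsWithin).exists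
  replace hr : 0 < r := hr
  have hclose : ∀ n, eLpNorm (wmul (u n - avg r (u n))) 2 volume < ε / 4 := fun n => by
    refine (eLpNorm_wmul_le _).trans_lt (lt_of_le_of_lt ?_ hr1)
    rw [eLpNorm_eq_lintegral_rpow_enorm_toReal two_ne_zero ENNReal.ofNat_ne_top]
    simp only [ENNReal.toReal_ofNat]
    gcongr
    refine (lintegral_sub_avg_le_rpow hd hr hq1 ENNReal.ofReal_ne_top hs0.le hs1.le (hu n)
      (hfs n)).trans (ENNReal.ofReal_le_ofReal ?_)
    gcongr
    exact hB' n
  have hB0 : 0 ≤ B := (ip_nonneg _ _).trans (hB 0)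
  have havgconv := tendsto_eLpNorm_wmul (fun n => aesm_avg (r := r) (hu n).1)
    (C := (B / ballVol d) ^ (1 / q) * (r⁻¹) ^ (d / q)) (fun n x => by
      refine (norm_avg_le hr (by linarith) (hu n) x).trans ?_
      have := ballVol_pos d
      have := ip_nonneg q (u n)
      gcongr
      exact hB n) (havg r hr)
  obtain ⟨N, hN⟩ := eventually_atTop.mp (havgconv.eventually_lt_const hε4)
  have ham : AEStronglyMeasurable (a r) volume :=
    aestronglyMeasurable_of_tendsto_ae atTop (fun n => aesm_avg (r := r) (hu n).1)
      (Eventually.of_forall (havg r hr))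
  have hhalf : ∀ n, N ≤ n → eLpNorm (wmul (u n - a r)) 2 volume < ε / 2 := fun n hn => by
    have h1 : wmul (u n - a r) = wmul (u n - avg r (u n)) + wmul (avg r (u n) - a r) := by
      simp only [wmul_sub]; abel
    have hm := aesm_avg (r := r) (hu n).1
    rw [h1]
    refine (eLpNorm_add_le (aesm_wmul ((hu n).1.sub hm)) (aesm_wmul (hm.sub ham))
      (by norm_num)).trans_lt ((ENNReal.add_lt_add (hclose n) (hN n hn)).trans_eq ?_)
    rw [← two_mul, ENNReal.div_eq_inv_mul, ENNReal.div_eq_inv_mul, ← mul_assoc]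
    congr 1
    rw [show (4 : ℝ≥0∞) = 2 * 2 by norm_num, ENNReal.mul_inv (by norm_num) (by norm_num),
      ← mul_assoc, ENNReal.mul_inv_cancel (by norm_num) (by norm_num), one_mul]
  refine ⟨N, fun m hm n hn => ?_⟩
  rw [Lp.edist_toLp_toLp]
  have h1 : wmul (u m) - wmul (u n) = wmul (u m - a r) - wmul (u n - a r) := by
    simp only [wmul_sub]; abel
  rw [h1]
  refine (eLpNorm_sub_le (aesm_wmul ((hu m).1.sub ham)) (aesm_wmul ((hu n).1.sub ham))
    (by norm_num)).trans_lt ((ENNReal.add_lt_add (hhalf m hm) (hhalf n hn)).trans_eq ?_)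
  exact ENNReal.add_halves ε

/-- A bounded sequence in `L^q ∩ Ḣ^s` has a subsequence that converges to some `V` in `L^q ∩ Ḣ^s`
weakly in `Ḣ^s`, in the sense of distributions, and almost everywhere, and whose averages over
balls converge pointwise. -/
theorem exists_extraction (hd : 0 < d) {s q : ℝ} (hs0 : 0 < s) (hs1 : s < 1) (hq : 2 ≤ q)
    {u : ℕ → Eu d → ℂ} {B B' : ℝ} (hu : ∀ n, MemLp (u n) (ENNReal.ofReal q) volume)
    (hfs : ∀ n, hdotNorm s (u n) < ∞) (hB : ∀ n, ip q (u n) ≤ B)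
    (hB' : ∀ n, ‖eh s (u n)‖ ≤ B') :
    ∃ (φ : ℕ → ℕ) (V : Eu d → ℂ), StrictMono φ ∧ MemLp V (ENNReal.ofReal q) volume ∧
      hdotNorm s V < ∞ ∧ WeakLim (fun n => eh s (u (φ n))) (eh s V) ∧
      (∀ᵐ x, Tendsto (fun n => u (φ n) x) atTop (𝓝 (V x))) ∧
      (∀ ψ : 𝓢(Eu d, ℂ), Tendsto (fun n => ∫ x, u (φ n) x * ψ x) atTop (𝓝 (∫ x, V x * ψ x))) ∧
      ∀ r > 0, ∀ x, Tendsto (fun n => avg r (u (φ n)) x) atTop (𝓝 (avg r V x)) := by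
  have hU : ∀ n, MemLp (wmul (u n)) 2 volume := fun n => by
    simpa using (ip_wmul_le hq (hu n)).1
  have hUb : ∀ n, ‖(hU n).toLp‖ ≤ √((∫ x : Eu d, wt x ^ 2) + B) := fun n => by
    refine Real.le_sqrt_of_sq_le ?_
    rw [norm_toLp_sq]
    linarith [(ip_wmul_le hq (hu n)).2, hB n]
  -- Weak limits `a` of the weighted functions and `G` of the elements `(2π|ξ|)^s û_n` of `L²`; the
  -- limit sought is `a` divided by the weight.
  obtain ⟨φ₁, a, hφ₁, ha⟩ := exists_weakLim_subseq hUb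
  obtain ⟨φ₂, G, hφ₂, hG⟩ := exists_weakLim_subseq (u := fun n => eh s (u (φ₁ n)))
    (fun n => hB' _)
  replace ha := ha.comp hφ₂
  have hVm : AEStronglyMeasurable (wdiv a) volume := aesm_wdiv (Lp.memLp a).1
  have htest : ∀ g : Eu d → ℂ, AEStronglyMeasurable g volume →
      (∃ C : ℝ, ∀ x, ‖g x‖ ≤ C * wt x ^ 2) →
      Tendsto (fun n => ∫ x, u (φ₁ (φ₂ n)) x * g x) atTop (𝓝 (∫ x, wdiv a x * g x)) := by
    rintro g hg ⟨C, hC⟩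
    have h1 := ha.tendsto_integral (memLp_wdiv hg hC)
    have h2 : ∫ x, a x * wdiv g x = ∫ x, wdiv a x * g x :=
      integral_congr_ae (Eventually.of_forall fun x => by simp only [wdiv]; ring)
    rw [h2] at h1
    refine h1.congr fun n => integral_congr_ae ?_
    filter_upwards [(hU (φ₁ (φ₂ n))).coeFn_toLp] with x hx
    have h3 : (wt x : ℂ) ≠ 0 := by exact_mod_cast (wt_pos x).ne'
    rw [hx, wmul, wdiv]
    field_simp
  have havg : ∀ r > 0, ∀ x, Tendsto (fun n => avg r (u (φ₁ (φ₂ n))) x) atTop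
      (𝓝 (avg r (wdiv a) x)) := fun r hr x => by
    simp only [avg_eq_integral]
    refine Tendsto.const_smul (htest _ ?_ ⟨_, indicator_ball_le_wt x r⟩) _
    exact (measurable_const.indicator Metric.isOpen_ball.measurableSet).aestronglyMeasurable
  have hcau := cauchySeq_wmul hd hs0 hs1 hq (fun n => hu (φ₁ (φ₂ n))) (fun n => hfs _)
    (fun n => hB _) (fun n => hB' _) havg (fun n => hU _)
  obtain ⟨a', ha'⟩ := cauchySeq_tendsto_of_complete hcau
  -- the strong limit is the weak limit
  have haa : a' = a := by
    refine WeakLim.unique (fun g => ?_) ha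
    exact ((continuous_const.inner continuous_id).tendsto a').comp ha'
  rw [haa] at ha'
  obtain ⟨φ₃, hφ₃, hae⟩ := (tendstoInMeasure_of_tendsto_Lp ha').exists_seq_tendsto_ae
  have hae' : ∀ᵐ x, Tendsto (fun n => u (φ₁ (φ₂ (φ₃ n))) x) atTop (𝓝 (wdiv a x)) := by
    filter_upwards [hae, ae_all_iff.mpr fun n => (hU (φ₁ (φ₂ (φ₃ n)))).coeFn_toLp] with x h1 h2
    have h3 := h1.const_mul (wt x : ℂ)⁻¹
    refine h3.congr fun n => ?_
    rw [h2 n]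
    exact wdiv_wmul _ _
  have hV := memLp_of_ae_tendsto (by linarith : (0 : ℝ) < q) (fun n => hu (φ₁ (φ₂ (φ₃ n)))) hae'
    (fun n => hB _)
  have hq1 : 1 ≤ ENNReal.ofReal q := by
    rw [ENNReal.one_le_ofReal]; linarith
  have hdist : ∀ ψ : 𝓢(Eu d, ℂ), Tendsto (fun n => ∫ x, u (φ₁ (φ₂ n)) x * ψ x) atTop
      (𝓝 (∫ x, wdiv a x * ψ x)) := fun ψ =>
    htest ψ ψ.continuous.aestronglyMeasurable (exists_schwartz_le_wt ψ)
  obtain ⟨-, hVs, hVG⟩ := hasFourierOn_of_weakLim hd (T := flatSchwartz d) subset_rfl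
    (fun φ hφ => memLp_sym_neg_mul_flat hd hs0.le hs1.le hφ)
    (fun n => hasFourierAway_of_lt_top (hfs (φ₁ (φ₂ n)))) (fun n => hfs _) hVm
    (fun φ => MemLp.integrable_mul_schwartz hq1 hV.1 φ) hdist hG
  refine ⟨fun n => φ₁ (φ₂ (φ₃ n)), wdiv a, hφ₁.comp (hφ₂.comp hφ₃), hV.1, hVs, ?_, hae',
    fun ψ => (hdist ψ).comp hφ₃.tendsto_atTop, fun r hr x => (havg r hr x).comp hφ₃.tendsto_atTop⟩
  rw [hVG]
  exact hG.comp hφ₃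

/-! ### Multiplication by characters in `L²` -/

theorem integral_chr_mul (f : Eu d → ℂ) (y : Eu d) :
    ∫ ξ, chr y ξ * f ξ = ∫ ξ, Real.fourierChar (-(inner ℝ ξ (-y))) • f ξ := by
  refine integral_congr_ae (Eventually.of_forall fun ξ => ?_)
  simp only [chr, Circle.smul_def, smul_eq_mul, inner_neg_right, neg_neg, real_inner_comm]

/-- The Riemann–Lebesgue lemma. -/
theorem tendsto_integral_chr_mul {ι : Type*} {l : Filter ι} (f : Eu d → ℂ) {z : ι → Eu d}
    (hz : Tendsto z l (cocompact (Eu d))) : Tendsto (fun n => ∫ ξ, chr (z n) ξ * f ξ) l (𝓝 0) := by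
  simp only [integral_chr_mul]
  refine (tendsto_integral_exp_inner_smul_cocompact f).comp (Tendsto.comp ?_ hz)
  exact (Homeomorph.neg (Eu d)).isClosedEmbedding.tendsto_cocompact

theorem chr_neg (y ξ : Eu d) : chr (-y) ξ = starRingEnd ℂ (chr y ξ) := by
  simp [chr, AddChar.map_neg_eq_inv]

theorem continuous_chr_left (ξ : Eu d) : Continuous fun y => chr y ξ := by
  have h : (fun y => chr y ξ) = chr ξ := funext fun y => by rw [chr, chr, real_inner_comm]
  rw [h]
  exact continuous_chr ξ

theorem memLp_chr_mul (y : Eu d) (g : L2 d) : MemLp (fun ξ => chr y ξ * g ξ) 2 volume :=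
  (Lp.memLp g).mono ((continuous_chr y).aestronglyMeasurable.mul (Lp.memLp g).1)
    (Eventually.of_forall fun ξ => by rw [norm_mul, norm_chr, one_mul])

/-- Multiplication by the character `ξ ↦ e^{2πi y·ξ}` in `L²`. -/
def chrL2 (y : Eu d) (g : L2 d) : L2 d := (memLp_chr_mul y g).toLp

theorem coe_chrL2 (y : Eu d) (g : L2 d) : chrL2 y g =ᵐ[volume] fun ξ => chr y ξ * g ξ :=
  MemLp.coeFn_toLp _

theorem norm_chrL2 (y : Eu d) (g : L2 d) : ‖chrL2 y g‖ = ‖g‖ := by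
  rw [Lp.norm_def, Lp.norm_def, eLpNorm_congr_ae (coe_chrL2 y g)]
  congr 1
  exact eLpNorm_congr_norm_ae (Eventually.of_forall fun ξ => by rw [norm_mul, norm_chr, one_mul])

theorem chrL2_sub (y : Eu d) (g k : L2 d) : chrL2 y (g - k) = chrL2 y g - chrL2 y k := by
  refine Lp.ext ?_
  filter_upwards [coe_chrL2 y (g - k), coe_chrL2 y g, coe_chrL2 y k, Lp.coeFn_sub g k,
    Lp.coeFn_sub (chrL2 y g) (chrL2 y k)] with ξ h1 h2 h3 h4 h5
  rw [h1, h5, h4, Pi.sub_apply, Pi.sub_apply, h2, h3, mul_sub]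

theorem inner_chrL2 (y : Eu d) (g k : L2 d) :
    inner ℂ g (chrL2 y k) = ∫ ξ, chr y ξ * (inner ℂ (g ξ) (k ξ)) := by
  rw [L2.inner_def]
  refine integral_congr_ae ?_
  filter_upwards [coe_chrL2 y k] with ξ h1
  rw [h1, ← smul_eq_mul, inner_smul_right]

theorem inner_chrL2_left (y : Eu d) (g k : L2 d) :
    inner ℂ (chrL2 y g) k = inner ℂ g (chrL2 (-y) k) := by
  rw [inner_chrL2, L2.inner_def]
  refine integral_congr_ae ?_
  filter_upwards [coe_chrL2 y g] with ξ h1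
  rw [h1, ← smul_eq_mul, inner_smul_left, chr_neg]

/-- Characters that tend to infinity carry any fixed element of `L²` weakly to zero. -/
theorem tendsto_inner_chrL2_cocompact {z : ℕ → Eu d} (hz : Tendsto z atTop (cocompact (Eu d)))
    (g : L2 d) : WeakLim (fun n => chrL2 (z n) g) 0 := fun k => by
  simp only [inner_chrL2, inner_zero_right]
  exact tendsto_integral_chr_mul _ hz

theorem tendsto_inner_chrL2 {z : ℕ → Eu d} {z₀ : Eu d} (hz : Tendsto z atTop (𝓝 z₀)) (g : L2 d) :
    WeakLim (fun n => chrL2 (z n) g) (chrL2 z₀ g) := fun k => by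
  simp only [inner_chrL2]
  refine tendsto_integral_of_dominated_convergence (fun ξ => ‖inner ℂ (k ξ) (g ξ)‖) (fun n => ?_)
    (L2.integrable_inner k g).norm (fun n => ?_) ?_
  · exact (continuous_chr _).aestronglyMeasurable.mul (L2.integrable_inner k g).1
  · exact Eventually.of_forall fun ξ => by rw [norm_mul, norm_chr, one_mul]
  · exact Eventually.of_forall fun ξ =>
      (((continuous_chr_left ξ).tendsto z₀).comp hz).mul_const _

theorem tendsto_chrL2 {z : ℕ → Eu d} {z₀ : Eu d} (hz : Tendsto z atTop (𝓝 z₀)) (g : L2 d) :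
    Tendsto (fun n => chrL2 (z n) g) atTop (𝓝 (chrL2 z₀ g)) := by
  have h1 := (tendsto_inner_chrL2 hz g).tendsto_norm_sub_sq (M := ‖g‖ ^ 2)
    (by simp only [norm_chrL2]; exact tendsto_const_nhds)
  rw [norm_chrL2, sub_self] at h1
  rw [tendsto_iff_norm_sub_tendsto_zero]
  have h2 := h1.sqrt
  simpa [Real.sqrt_sq (norm_nonneg _)] using h2

/-- Multiplication by a convergent sequence of characters preserves weak convergence to zero. -/
theorem WeakLim.chrL2_zero {u : ℕ → L2 d} (hu : WeakLim u 0) {K : ℝ} (hK : ∀ n, ‖u n‖ ≤ K)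
    {z : ℕ → Eu d} {z₀ : Eu d} (hz : Tendsto z atTop (𝓝 z₀)) :
    WeakLim (fun n => chrL2 (z n) (u n)) 0 := fun g => by
  have hz' : Tendsto (fun n => -z n) atTop (𝓝 (-z₀)) := hz.neg
  have h0 : ∀ n, inner ℂ g (chrL2 (z n) (u n)) = inner ℂ (chrL2 (-z n) g - chrL2 (-z₀) g) (u n)
      + inner ℂ (chrL2 (-z₀) g) (u n) := fun n => by
    rw [← inner_add_left, sub_add_cancel, inner_chrL2_left, neg_neg]
  simp only [h0, inner_zero_right]
  have h1 := hu (chrL2 (-z₀) g)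
  rw [inner_zero_right] at h1
  rw [← add_zero (0 : ℂ)]
  refine Tendsto.add ?_ h1
  have h2 := (tendsto_iff_norm_sub_tendsto_zero.mp (tendsto_chrL2 hz' g)).mul_const K
  rw [zero_mul] at h2
  refine squeeze_zero_norm (fun n => ?_) h2
  exact (norm_inner_le_norm _ _).trans (by gcongr; exact hK n)

theorem eh_translate (hd : 0 < d) {γ : ℝ} {f : Eu d → ℂ} (hf : hdotNorm γ f < ∞) (y : Eu d) :
    eh γ (fun x => f (x + y)) = chrL2 y (eh γ f) :=
  Lp.ext ((coe_eh_translate hd hf y).trans (coe_chrL2 y _).symm)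

/-! ### Profiles of bounded sequences -/

/-- The exponents `s`, `q` for which Gagliardo–Nirenberg controls the `L^p` norm with
`p = 2 + 2sq/d` on `L^q ∩ Ḣ^s` and `2 < q < p`. The condition `q < p` means that `q` is below the
Sobolev exponent `2d / (d - 2s)` if `2s < d`. -/
structure Admissible (d : ℕ) (s q : ℝ) : Prop where
  hd : 0 < d
  hs0 : 0 < s
  hs1 : s < 1
  hq : 2 < q
  hqp : q < 2 * s * q / d + 2

/-- The exponent `p = 2 + 2sq/d`, for which `‖f‖_p^p ≲ ‖f‖_q^{2sq/d} ‖f‖_{Ḣ^s}²` is invariant under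
scaling. -/
def pexp (d : ℕ) (s q : ℝ) : ℝ := 2 * s * q / d + 2

/-- Membership in the space `L^q ∩ Ḣ^s`. -/
structure InX (s q : ℝ) (f : Eu d → ℂ) : Prop where
  memLp : MemLp f (ENNReal.ofReal q) volume
  fin : hdotNorm s f < ∞

namespace InX
variable {s q : ℝ} {f g : Eu d → ℂ}

theorem sub (hA : Admissible d s q) (hf : InX s q f) (hg : InX s q g) : InX s q (f - g) :=
  ⟨hf.memLp.sub hg.memLp, hdotNorm_sub_lt_top hA.hd hf.fin hg.fin⟩

theorem translate (hA : Admissible d s q) (hf : InX s q f) (y : Eu d) :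
    InX s q (fun x => f (x + y)) :=
  ⟨hf.memLp.comp_measurePreserving (measurePreserving_add_right volume y),
    by rw [hdotNorm_translate hA.hd hf.fin]; exact hf.fin⟩

theorem memLp_pexp (hA : Admissible d s q) (hf : InX s q f) :
    MemLp f (ENNReal.ofReal (pexp d s q)) volume := by
  obtain ⟨C, -, hC⟩ := exists_gagliardo_nirenberg hA.hd hA.hs0 hA.hs1 (by linarith [hA.hq] : 1 < q)
  exact (hC f hf.memLp hf.fin).1

end InX

theorem Admissible.one_lt_ofReal {s q : ℝ} (hA : Admissible d s q) : 1 < ENNReal.ofReal q := by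
  rw [ENNReal.one_lt_ofReal]; linarith [hA.hq]

theorem Admissible.q_lt_pexp {s q : ℝ} (hA : Admissible d s q) : q < pexp d s q := hA.hqp

/-- `V ∈ L^q ∩ Ḣ^s` is a weak limit in `Ḣ^s` of translates of a subsequence of `v`. The weak
convergence is expressed by the elements `(2π|ξ|)^s f̂` of `L²`. -/
def IsProfile (s q : ℝ) (v : ℕ → Eu d → ℂ) (V : Eu d → ℂ) : Prop :=
  InX s q V ∧ ∃ (σ : ℕ → ℕ) (x : ℕ → Eu d), StrictMono σ ∧
    WeakLim (fun n => eh s (fun y => v (σ n) (y + x n))) (eh s V)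

/-- `v` is a sequence in `L^q ∩ Ḣ^s` along which the three quantities `‖v‖_q^q`, `‖v‖_p^p` and
`‖v‖_{Ḣ^s}²` converge. -/
structure ConvSeq (s q : ℝ) (v : ℕ → Eu d → ℂ) (Q L M : ℝ) : Prop where
  inX : ∀ n, InX s q (v n)
  limQ : Tendsto (fun n => ip q (v n)) atTop (𝓝 Q)
  limL : Tendsto (fun n => ip (pexp d s q) (v n)) atTop (𝓝 L)
  limM : Tendsto (fun n => ‖eh s (v n)‖ ^ 2) atTop (𝓝 M)

section
variable {s q Q L M : ℝ} {v : ℕ → Eu d → ℂ}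

theorem ConvSeq.comp (hv : ConvSeq s q v Q L M) {φ : ℕ → ℕ} (hφ : StrictMono φ) :
    ConvSeq s q (fun n => v (φ n)) Q L M :=
  ⟨fun _ => hv.inX _, hv.limQ.comp hφ.tendsto_atTop, hv.limL.comp hφ.tendsto_atTop,
    hv.limM.comp hφ.tendsto_atTop⟩

theorem ConvSeq.translate (hA : Admissible d s q) (hv : ConvSeq s q v Q L M) (x : ℕ → Eu d) :
    ConvSeq s q (fun n y => v n (y + x n)) Q L M := by
  refine ⟨fun n => (hv.inX n).translate hA _, ?_, ?_, ?_⟩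
  · simpa only [ip_translate] using hv.limQ
  · simpa only [ip_translate] using hv.limL
  · simpa only [eh_translate hA.hd (hv.inX _).fin, norm_chrL2] using hv.limM

theorem ConvSeq.bounds (hv : ConvSeq s q v Q L M) :
    ∃ B, (∀ n, ip q (v n) ≤ B) ∧ (∀ n, ip (pexp d s q) (v n) ≤ B) ∧ ∀ n, ‖eh s (v n)‖ ≤ B := by
  obtain ⟨B₁, h1⟩ := hv.limQ.bddAbove_range
  obtain ⟨B₂, h2⟩ := hv.limL.bddAbove_range
  obtain ⟨B₃, h3⟩ := hv.limM.bddAbove_range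
  refine ⟨max (max B₁ B₂) (B₃ + 1), fun n => ?_, fun n => ?_, fun n => ?_⟩
  · exact (h1 ⟨n, rfl⟩).trans ((le_max_left _ _).trans (le_max_left _ _))
  · exact (h2 ⟨n, rfl⟩).trans ((le_max_right _ _).trans (le_max_left _ _))
  · have : ‖eh s (v n)‖ ^ 2 ≤ B₃ := h3 ⟨n, rfl⟩
    refine le_trans ?_ (le_max_right _ _)
    nlinarith [sq_nonneg (‖eh s (v n)‖ - 1)]

/-- The compactness property `exists_extraction` for a sequence with convergent norms. -/
theorem ConvSeq.exists_limit (hA : Admissible d s q) (hv : ConvSeq s q v Q L M) :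
    ∃ (φ : ℕ → ℕ) (V : Eu d → ℂ), StrictMono φ ∧ InX s q V ∧
      WeakLim (fun n => eh s (v (φ n))) (eh s V) ∧
      (∀ᵐ x, Tendsto (fun n => v (φ n) x) atTop (𝓝 (V x))) ∧
      ∀ r > 0, ∀ x, Tendsto (fun n => avg r (v (φ n)) x) atTop (𝓝 (avg r V x)) := by
  obtain ⟨B, h1, -, h2⟩ := hv.bounds
  obtain ⟨φ, V, hφ, h3, h4, h5, h6, -, h7⟩ := exists_extraction hA.hd hA.hs0 hA.hs1 hA.hq.le
    (fun n => (hv.inX n).memLp) (fun n => (hv.inX n).fin) h1 h2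
  exact ⟨φ, V, hφ, ⟨h3, h4⟩, h5, h6, h7⟩

theorem InX.ae_eq_of_eh_eq (hA : Admissible d s q) {f g : Eu d → ℂ} (hf : InX s q f)
    (hg : InX s q g) (h : eh s f = eh s g) : f =ᵐ[volume] g := by
  have h1 := ae_eq_zero_of_eh_eq_zero hA.one_lt_ofReal ENNReal.ofReal_ne_top hA.hd
    (hf.sub hA hg).memLp (hf.sub hA hg).fin (by rw [eh_sub hA.hd hf.fin hg.fin, h, sub_self])
  filter_upwards [h1] with x hx
  exact sub_eq_zero.mp hx

/-- Weak convergence in `Ḣ^s` implies convergence almost everywhere along a subsequence, as the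
weak limit determines the function. -/
theorem ConvSeq.exists_ae_tendsto (hA : Admissible d s q) (hv : ConvSeq s q v Q L M)
    {V : Eu d → ℂ} (hV : InX s q V) (hlim : WeakLim (fun n => eh s (v n)) (eh s V)) :
    ∃ φ : ℕ → ℕ, StrictMono φ ∧ ∀ᵐ x, Tendsto (fun n => v (φ n) x) atTop (𝓝 (V x)) := by
  obtain ⟨φ, W, hφ, hW, h1, h2, -⟩ := hv.exists_limit hA
  refine ⟨φ, hφ, ?_⟩
  have h3 := hV.ae_eq_of_eh_eq hA hW ((hlim.comp hφ).unique h1)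
  filter_upwards [h2, h3] with x hx hx'
  rwa [hx']

/-- Removing a profile: the three quantities decouple, by the Brezis–Lieb lemma and the Hilbert
space structure, and no new profiles appear. A profile `W` of the remainder arises along
translations `y n` relative to those of `V`. If they have a bounded subsequence, then `W = 0`, as
the remainder tends weakly to zero; otherwise the translates of `V` tend weakly to zero, and `W` is
a profile of the original sequence. -/
theorem ConvSeq.peel (hA : Admissible d s q) (hv : ConvSeq s q v Q L M) {V : Eu d → ℂ}
    (hV : IsProfile s q v V) :
    ∃ w : ℕ → Eu d → ℂ,
      ConvSeq s q w (Q - ip q V) (L - ip (pexp d s q) V) (M - ‖eh s V‖ ^ 2) ∧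
      ∀ W, IsProfile s q w W → IsProfile s q v W ∨ W =ᵐ[volume] 0 := by
  obtain ⟨hVX, σ₀, x₀, hσ₀, hlim₀⟩ := hV
  have hconv₀ := (hv.comp hσ₀).translate hA x₀
  obtain ⟨φ, hφ, hae⟩ := hconv₀.exists_ae_tendsto hA hVX hlim₀
  obtain ⟨σ, x, hσ, hconv, hlim, hae⟩ : ∃ (σ : ℕ → ℕ) (x : ℕ → Eu d), StrictMono σ ∧
      ConvSeq s q (fun n y => v (σ n) (y + x n)) Q L M ∧
      WeakLim (fun n => eh s (fun y => v (σ n) (y + x n))) (eh s V) ∧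
      ∀ᵐ y, Tendsto (fun n => v (σ n) (y + x n)) atTop (𝓝 (V y)) :=
    ⟨σ₀ ∘ φ, x₀ ∘ φ, hσ₀.comp hφ, hconv₀.comp hφ, hlim₀.comp hφ, hae⟩
  obtain ⟨B, hB1, hB2, hB3⟩ := hconv.bounds
  have hq := hA.hq
  have hqp := hA.q_lt_pexp
  have heh : ∀ n, eh s ((fun y => v (σ n) (y + x n)) - V)
      = eh s (fun y => v (σ n) (y + x n)) - eh s V := fun n =>
    eh_sub hA.hd (hconv.inX n).fin hVX.fin
  refine ⟨fun n => (fun y => v (σ n) (y + x n)) - V,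
    ⟨fun n => (hconv.inX n).sub hA hVX, ?_, ?_, ?_⟩, ?_⟩
  · have h1 := tendsto_ip_sub (by linarith) (fun n => (hconv.inX n).memLp) hae hB1
    have h2 := hconv.limQ.sub h1
    simpa using h2
  · have h1 := tendsto_ip_sub (by linarith) (fun n => (hconv.inX n).memLp_pexp hA) hae hB2
    have h2 := hconv.limL.sub h1
    simpa using h2
  · simp only [heh]
    exact hlim.tendsto_norm_sub_sq hconv.limM
  · rintro W ⟨hWX, τ, y, hτ, hW⟩
    set D : ℕ → L2 d := fun n => eh s (fun y => v (σ n) (y + x n)) - eh s V with hD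
    have hD0 : WeakLim D 0 := by
      have := hlim.sub (weakLim_const (eh s V))
      rwa [sub_self] at this
    have hDb : ∀ n, ‖D n‖ ≤ B + ‖eh s V‖ := fun n =>
      (norm_sub_le _ _).trans (by gcongr; exact hB3 n)
    have hW' : WeakLim (fun n => chrL2 (y n) (D (τ n))) (eh s W) := by
      have h1 : ∀ n, eh s (fun z => ((fun y => v (σ (τ n)) (y + x (τ n))) - V) (z + y n))
          = chrL2 (y n) (D (τ n)) := fun n => by
        rw [eh_translate hA.hd ((hconv.inX (τ n)).sub hA hVX).fin, heh]
      simpa only [h1] using hW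
    by_cases hb : ∃ R : ℝ, ∃ᶠ n in atTop, y n ∈ Metric.closedBall (0 : Eu d) R
    · right
      obtain ⟨R, hR⟩ := hb
      obtain ⟨y₀, -, ψ, hψ, hy₀⟩ := tendsto_subseq_of_frequently_bounded
        Metric.isBounded_closedBall hR
      have h1 : WeakLim (fun n => chrL2 (y (ψ n)) (D (τ (ψ n)))) 0 :=
        ((hD0.comp hτ).comp hψ).chrL2_zero (fun n => hDb _) hy₀
      have h2 := (hW'.comp hψ).unique h1
      exact ae_eq_zero_of_eh_eq_zero hA.one_lt_ofReal ENNReal.ofReal_ne_top hA.hd hWX.memLp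
        hWX.fin h2
    · left
      push Not at hb
      have hco : Tendsto y atTop (cocompact (Eu d)) := by
        rw [← Metric.cobounded_eq_cocompact, ← tendsto_norm_atTop_iff_cobounded,
          tendsto_atTop]
        intro R
        filter_upwards [hb R] with n hn
        simpa using (not_le.mp (mt mem_closedBall_zero_iff.mpr hn)).le
      refine ⟨hWX, σ ∘ τ, fun n => y n + x (τ n), hσ.comp hτ, fun g => ?_⟩
      have h1 := tendsto_inner_chrL2_cocompact hco (eh s V) g
      have h2 := (hW' g).add h1
      rw [inner_zero_right, add_zero] at h2
      refine h2.congr fun n => ?_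
      rw [← inner_add_right]
      congr 1
      have h3 : (fun z => v ((σ ∘ τ) n) (z + (y n + x (τ n))))
          = fun z => (fun y => v (σ (τ n)) (y + x (τ n))) (z + y n) := by
        funext z; simp only [Function.comp_apply, add_assoc]
      beta_reduce
      rw [h3, eh_translate hA.hd (hconv.inX (τ n)).fin, hD]
      simp only [chrL2_sub, sub_add_cancel]

end

/-! ### Vanishing and concentration -/

section
variable {s q : ℝ}

theorem ip_le_of_bounded {p K : ℝ} (hq : 0 < q) (hqp : q ≤ p) {f : Eu d → ℂ}
    (hf : MemLp f (ENNReal.ofReal q) volume) (hfp : MemLp f (ENNReal.ofReal p) volume)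
    (hK : ∀ x, ‖f x‖ ≤ K) : ip p f ≤ K ^ (p - q) * ip q f := by
  rw [ip, ip, ← integral_const_mul]
  refine integral_mono (integrable_norm_rpow (by linarith) hfp)
    ((integrable_norm_rpow hq hf).const_mul _) fun x => ?_
  beta_reduce
  rcases (norm_nonneg (f x)).eq_or_lt' with h | h
  · rw [h, Real.zero_rpow hq.ne', Real.zero_rpow (by linarith), mul_zero]
  · calc ‖f x‖ ^ p = ‖f x‖ ^ (p - q) * ‖f x‖ ^ q := by
          rw [← Real.rpow_add h, sub_add_cancel]
      _ ≤ _ := by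
          have := Real.rpow_le_rpow h.le (hK x) (by linarith : 0 ≤ p - q)
          gcongr

/-- Interpolation between `L^{p₀}` and `L^{p₁}`, by comparing `|f|` with a threshold `lam`. The
second power has a negative exponent, so that its coefficient is small for large `lam`. -/
theorem ip_le_interpolate {p₀ p p₁ lam : ℝ} (hp₀ : 0 < p₀) (h01 : p₀ ≤ p) (h1 : p ≤ p₁)
    (hlam : 0 < lam) {f : Eu d → ℂ} (hf : MemLp f (ENNReal.ofReal p₀) volume)
    (hfp : MemLp f (ENNReal.ofReal p) volume) (hf1 : MemLp f (ENNReal.ofReal p₁) volume) :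
    ip p f ≤ lam ^ (p - p₀) * ip p₀ f + lam ^ (p - p₁) * ip p₁ f := by
  have i0 := (integrable_norm_rpow hp₀ hf).const_mul (lam ^ (p - p₀))
  have i1 := (integrable_norm_rpow (by linarith) hf1).const_mul (lam ^ (p - p₁))
  rw [ip, ip, ip, ← integral_const_mul, ← integral_const_mul, ← integral_add i0 i1]
  refine integral_mono (integrable_norm_rpow (by linarith) hfp) (i0.add i1) fun x => ?_
  beta_reduce
  have n0 : 0 ≤ lam ^ (p - p₀) * ‖f x‖ ^ p₀ := by positivity
  have n1 : 0 ≤ lam ^ (p - p₁) * ‖f x‖ ^ p₁ := by positivity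
  rcases (norm_nonneg (f x)).eq_or_lt' with h | h
  · refine le_of_eq_of_le ?_ (add_nonneg n0 n1)
    rw [h, Real.zero_rpow (by linarith)]
  rcases le_total ‖f x‖ lam with hl | hl
  · have : ‖f x‖ ^ p = ‖f x‖ ^ (p - p₀) * ‖f x‖ ^ p₀ := by
      rw [← Real.rpow_add h, sub_add_cancel]
    have h2 := Real.rpow_le_rpow h.le hl (by linarith : 0 ≤ p - p₀)
    have h3 : ‖f x‖ ^ (p - p₀) * ‖f x‖ ^ p₀ ≤ lam ^ (p - p₀) * ‖f x‖ ^ p₀ := by gcongr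
    linarith
  · have : ‖f x‖ ^ p = ‖f x‖ ^ (p - p₁) * ‖f x‖ ^ p₁ := by
      rw [← Real.rpow_add h, sub_add_cancel]
    have h2 := Real.rpow_le_rpow_of_nonpos hlam hl (by linarith : p - p₁ ≤ 0)
    have h3 : ‖f x‖ ^ (p - p₁) * ‖f x‖ ^ p₁ ≤ lam ^ (p - p₁) * ‖f x‖ ^ p₁ := by gcongr
    linarith

theorem avg_memLp_ip_le {p r : ℝ} (hr : 0 < r) (hp : 1 ≤ p) {f : Eu d → ℂ}
    (hf : MemLp f (ENNReal.ofReal p) volume) :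
    MemLp (avg r f) (ENNReal.ofReal p) volume ∧ ip p (avg r f) ≤ ip p f := by
  refine ip_le_of_lintegral_le (by linarith) (aesm_avg hf.1) (ip_nonneg _ _) ?_
  rw [← lintegral_eq_ofReal_ip (by linarith) hf]
  exact lintegral_avg_rpow_le hr hp hf.1

/-- On bounded subsets of `L^q ∩ Ḣ^s`, the `L^p` norm of `f - A_r f` is uniformly small as the
radius `r` of the averages tends to zero. -/
theorem exists_radius (hA : Admissible d s q) {B ε : ℝ} (hB : 0 ≤ B) (hε : 0 < ε) :
    ∃ r > 0, ∀ f : Eu d → ℂ, InX s q f → ip q f ≤ B → ‖eh s f‖ ^ 2 ≤ B →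
      ip (pexp d s q) (f - avg r f) ≤ ε := by
  have hs0 := hA.hs0
  have hq := hA.hq
  have hqp := hA.q_lt_pexp
  set p := pexp d s q with hp
  have hd' : (0 : ℝ) < d := by exact_mod_cast hA.hd
  have hpp : p < pexp d s p := by
    have : 2 * s * q / d < 2 * s * p / d := by gcongr
    have h1 : pexp d s p = 2 * s * p / d + 2 := rfl
    have h2 : p = 2 * s * q / d + 2 := rfl
    rw [h1]; linarith
  -- An exponent above `p` in which bounded sets remain bounded: Gagliardo–Nirenberg is applied to
  -- `L^p ∩ Ḣ^s`.
  set p₁ := pexp d s p with hp₁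
  obtain ⟨C₀, hC₀, hGN₀⟩ := exists_gagliardo_nirenberg hA.hd hs0 hA.hs1 (by linarith : 1 < q)
  obtain ⟨C₁, hC₁, hGN₁⟩ := exists_gagliardo_nirenberg hA.hd hs0 hA.hs1 (by linarith : 1 < p)
  set K₀ : ℝ := C₀ * B ^ (2 * s / d) * B with hK₀
  set K₁ : ℝ := C₁ * K₀ ^ (2 * s / d) * B with hK₁
  have hK₀0 : 0 ≤ K₀ := by positivity
  have hK₁0 : 0 ≤ K₁ := by positivity
  set D : ℝ := 2 ^ p₁ * (K₁ + K₁) with hD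
  -- The threshold makes the contribution of `L^{p₁}` small; the radius then makes that of `L²`
  -- small.
  obtain ⟨lam, hlam, hlam0⟩ : ∃ lam : ℝ, lam ^ (p - p₁) * D < ε / 2 ∧ 0 < lam := by
    have h1 : Tendsto (fun lam : ℝ => lam ^ (p - p₁) * D) atTop (𝓝 (0 * D)) := by
      have := (tendsto_rpow_neg_atTop (y := p₁ - p) (by linarith)).mul_const D
      simpa only [neg_sub] using this
    rw [zero_mul] at h1
    exact ((h1.eventually_lt_const (half_pos hε)).and (eventually_gt_atTop 0)).exists
  obtain ⟨r, hr, hr0⟩ : ∃ r : ℝ, lam ^ (p - 2) * ((2 * Real.pi) ^ 2 * r ^ (2 * s) * B) < ε / 2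
      ∧ 0 < r := by
    have h1 : Tendsto (fun r : ℝ => lam ^ (p - 2) * ((2 * Real.pi) ^ 2 * r ^ (2 * s) * B)) (𝓝[>] 0)
        (𝓝 (lam ^ (p - 2) * ((2 * Real.pi) ^ 2 * 0 ^ (2 * s) * B))) := by
      refine Tendsto.mono_left ?_ nhdsWithin_le_nhds
      exact ((((Real.continuousAt_rpow_const 0 (2 * s) (Or.inr (by linarith))).tendsto).const_mul
        _).mul_const _).const_mul _
    rw [Real.zero_rpow (by linarith), mul_zero, zero_mul, mul_zero] at h1
    exact ((h1.eventually_lt_const (half_pos hε)).and self_mem_nhdsWithin).exists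
  refine ⟨r, hr0, fun f hf hfq hfs => ?_⟩
  obtain ⟨hfp, hfp'⟩ := hGN₀ f hf.memLp hf.fin
  change MemLp f (ENNReal.ofReal p) volume at hfp
  change ip p f ≤ _ at hfp'
  obtain ⟨hfp1, hfp1'⟩ := hGN₁ f hfp hf.fin
  change MemLp f (ENNReal.ofReal p₁) volume at hfp1
  change ip p₁ f ≤ _ at hfp1'
  have hb0 : ip p f ≤ K₀ := by
    refine hfp'.trans ?_
    have := ip_nonneg q f
    rw [hK₀]; gcongr
  have hb1 : ip p₁ f ≤ K₁ := by
    refine hfp1'.trans ?_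
    have := ip_nonneg p f
    rw [hK₁]; gcongr
  obtain ⟨ha0, -⟩ := avg_memLp_ip_le hr0 (by linarith : 1 ≤ p) hfp
  obtain ⟨ha1, ha1'⟩ := avg_memLp_ip_le hr0 (by linarith : 1 ≤ p₁) hfp1
  have h2 := ip_le_of_lintegral_le (p := 2) (f := f - avg r f) two_pos
    (hfp.1.sub (aesm_avg hfp.1)) (by positivity)
    (lintegral_sub_avg_le_rpow hA.hd hr0 hA.one_lt_ofReal ENNReal.ofReal_ne_top hs0.le hA.hs1.le
      hf.memLp hf.fin)
  have h1 : ip p₁ (f - avg r f) ≤ D := by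
    refine (ip_sub_le (by linarith) hfp1 ha1).trans ?_
    rw [hD]; gcongr; exact ha1'.trans hb1
  calc ip p (f - avg r f)
      ≤ lam ^ (p - 2) * ip 2 (f - avg r f) + lam ^ (p - p₁) * ip p₁ (f - avg r f) :=
        ip_le_interpolate two_pos (by linarith) hpp.le hlam0 h2.1 (hfp.sub ha0) (hfp1.sub ha1)
    _ ≤ lam ^ (p - 2) * ((2 * Real.pi) ^ 2 * r ^ (2 * s) * B) + lam ^ (p - p₁) * D := by
        gcongr
        refine h2.2.trans ?_
        gcongr
    _ ≤ ε := by linarith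

/-- If all profiles are small in `L^q`, then the sequence is small in `L^p`. Otherwise the averages
over balls of a fixed radius do not tend to zero uniformly; translating the points at which they
are large to the origin produces a profile with a large average. -/
theorem exists_profile_threshold (hA : Admissible d s q) {B ε : ℝ} (hB : 0 ≤ B) (hε : 0 < ε) :
    ∃ η > 0, ∀ (v : ℕ → Eu d → ℂ) (Q L M : ℝ), ConvSeq s q v Q L M → Q ≤ B → M ≤ B →
      (∀ V, IsProfile s q v V → ip q V < η) → L ≤ ε := by
  have hq := hA.hq
  have hqp := hA.q_lt_pexp
  set p := pexp d s q with hp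
  set c : ℝ := 2 ^ p with hc
  have hc0 : 0 < c := by positivity
  obtain ⟨r, hr, hrad⟩ := exists_radius hA (B := B + 1) (ε := ε / (2 * c)) (by linarith)
    (by positivity)
  obtain ⟨δ, hδ, hδ0⟩ : ∃ δ : ℝ, c * (δ ^ (p - q) * (B + 1)) < ε / 2 ∧ 0 < δ := by
    have h1 : Tendsto (fun δ : ℝ => c * (δ ^ (p - q) * (B + 1))) (𝓝[>] 0)
        (𝓝 (c * (0 ^ (p - q) * (B + 1)))) := by
      refine Tendsto.mono_left ?_ nhdsWithin_le_nhds
      exact (((Real.continuousAt_rpow_const 0 (p - q) (Or.inr (by linarith))).tendsto).mul_const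
        _).const_mul _
    rw [Real.zero_rpow (by linarith), zero_mul, mul_zero] at h1
    exact ((h1.eventually_lt_const (half_pos hε)).and self_mem_nhdsWithin).exists
  obtain ⟨η, hη, hη0⟩ : ∃ η : ℝ, (η / ballVol d) ^ (1 / q) * (r⁻¹) ^ (d / q) < δ ∧ 0 < η := by
    have h1 : Tendsto (fun η : ℝ => (η / ballVol d) ^ (1 / q) * (r⁻¹) ^ (d / q)) (𝓝[>] 0)
        (𝓝 ((0 / ballVol d) ^ (1 / q) * (r⁻¹) ^ (d / q))) := by
      refine Tendsto.mono_left ?_ nhdsWithin_le_nhds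
      have h2 : Tendsto (fun η : ℝ => η / ballVol d) (𝓝 0) (𝓝 (0 / ballVol d)) :=
        tendsto_id.div_const _
      exact (h2.rpow_const (Or.inr (by positivity))).mul_const _
    rw [zero_div, Real.zero_rpow (by positivity), zero_mul] at h1
    exact ((h1.eventually_lt_const hδ0).and self_mem_nhdsWithin).exists
  refine ⟨η, hη0, fun v Q L M hv hQ hM hsmall => ?_⟩
  have hbv := ballVol_pos d
  -- `δ` controls `A_r v_n` in `L^p`, and profiles with `‖V‖_q^q < η` have averages below `δ`.
  have hunif : ∀ᶠ n in atTop, ∀ x, ‖avg r (v n) x‖ ≤ δ := by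
    by_contra hcon
    rw [not_eventually] at hcon
    obtain ⟨σ, hσ, hx⟩ := extraction_of_frequently_atTop hcon
    push Not at hx
    choose x hx using hx
    obtain ⟨φ, V, hφ, hVX, hlim, -, havg⟩ := ((hv.comp hσ).translate hA x).exists_limit hA
    have hprof : IsProfile s q v V := ⟨hVX, σ ∘ φ, x ∘ φ, hσ.comp hφ, hlim⟩
    have h1 : δ ≤ ‖avg r V 0‖ := by
      refine ge_of_tendsto (havg r hr 0).norm (Eventually.of_forall fun n => ?_)
      rw [avg_translate, zero_add]
      exact (hx (φ n)).le
    have h2 := norm_avg_le hr (by linarith) hVX.memLp 0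
    have h3 : (ip q V / ballVol d) ^ (1 / q) * (r⁻¹) ^ (d / q)
        ≤ (η / ballVol d) ^ (1 / q) * (r⁻¹) ^ (d / q) := by
      have := (hsmall V hprof).le
      have := ip_nonneg q V
      gcongr
    linarith
  refine le_of_tendsto hv.limL ?_
  filter_upwards [hunif, hv.limQ.eventually_le_const (show Q < B + 1 by linarith),
    hv.limM.eventually_le_const (show M < B + 1 by linarith)] with n h1 h2 h3
  have hX := hv.inX n
  have hXp := hX.memLp_pexp hA
  obtain ⟨ha0, -⟩ := avg_memLp_ip_le hr (by linarith : 1 ≤ p) hXp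
  obtain ⟨haq, haq'⟩ := avg_memLp_ip_le hr (by linarith : 1 ≤ q) hX.memLp
  have h4 := hrad (v n) hX h2 h3
  have h5 := ip_le_of_bounded (by linarith) hqp.le haq ha0 h1
  have h6 : ip p (v n) ≤ c * (ip p (v n - avg r (v n)) + ip p (avg r (v n))) := by
    have h := ip_sub_le (p := p) (by linarith) (hXp.sub ha0) (ha0.const_smul (-1 : ℂ))
    rw [ip_smul, norm_neg, norm_one, Real.one_rpow, one_mul] at h
    refine le_of_eq_of_le ?_ h
    congr 1
    funext x; simp
  have h7 : ip p (avg r (v n)) ≤ δ ^ (p - q) * (B + 1) :=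
    h5.trans (by gcongr; exact haq'.trans h2)
  calc ip p (v n) ≤ c * (ε / (2 * c) + δ ^ (p - q) * (B + 1)) := h6.trans (by gcongr)
    _ = ε / 2 + c * (δ ^ (p - q) * (B + 1)) := by field_simp
    _ ≤ ε := by linarith

/-- If `‖V‖_p^p ≤ Λ ‖V‖_{Ḣ^s}²` for all profiles, then the same holds for the limits. The proof
removes profiles one by one; each removal lowers `‖v‖_q^q` by a fixed amount, until only small
profiles are left. -/
theorem ConvSeq.limL_le (hA : Admissible d s q) {v : ℕ → Eu d → ℂ} {Q L M Λ : ℝ}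
    (hv : ConvSeq s q v Q L M) (hΛ : 0 ≤ Λ)
    (hprof : ∀ V, IsProfile s q v V → ip (pexp d s q) V ≤ Λ * ‖eh s V‖ ^ 2) : L ≤ Λ * M := by
  refine le_of_forall_pos_le_add fun ε hε => ?_
  set B := max Q M with hB
  have hQ0 : 0 ≤ Q := ge_of_tendsto hv.limQ (Eventually.of_forall fun n => ip_nonneg _ _)
  obtain ⟨η, hη, hthr⟩ := exists_profile_threshold hA (B := B) (hQ0.trans (le_max_left _ _)) hε
  obtain ⟨k, hk⟩ := exists_nat_ge (Q / η)
  rw [div_le_iff₀ hη] at hk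
  have hq := hA.hq
  have hqp := hA.q_lt_pexp
  -- induction on the number `k` of profiles with `‖V‖_q^q ≥ η` that `Q ≤ k η` leaves room for
  have key : ∀ (k : ℕ) (v : ℕ → Eu d → ℂ) (Q L M : ℝ), ConvSeq s q v Q L M → Q ≤ B → M ≤ B →
      Q ≤ k * η → (∀ V, IsProfile s q v V → ip (pexp d s q) V ≤ Λ * ‖eh s V‖ ^ 2) →
      L ≤ Λ * M + ε := by
    intro k
    induction k with
    | zero =>
      intro v Q L M hv hQB hMB hQk hp
      have hM0 : 0 ≤ M := ge_of_tendsto hv.limM (Eventually.of_forall fun n => by positivity)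
      have h1 : L ≤ ε := hthr v Q L M hv hQB hMB fun V hV => by
        by_contra! hcon
        obtain ⟨w, hw, -⟩ := hv.peel hA hV
        have := ge_of_tendsto hw.limQ (Eventually.of_forall fun n => ip_nonneg _ _)
        push_cast at hQk
        linarith
      nlinarith [mul_nonneg hΛ hM0]
    | succ k ih =>
      intro v Q L M hv hQB hMB hQk hp
      have hM0 : 0 ≤ M := ge_of_tendsto hv.limM (Eventually.of_forall fun n => by positivity)
      by_cases hsm : ∀ V, IsProfile s q v V → ip q V < η
      · have := hthr v Q L M hv hQB hMB hsm
        nlinarith [mul_nonneg hΛ hM0]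
      · push Not at hsm
        obtain ⟨V, hV, hVη⟩ := hsm
        obtain ⟨w, hw, hwp⟩ := hv.peel hA hV
        push_cast at hQk
        have h1 := ih w _ _ _ hw (by linarith [ip_nonneg q V]) (by nlinarith [norm_nonneg (eh s V)])
          (by linarith) fun W hW => by
            rcases hwp W hW with h | h
            · exact hp W h
            · rw [(ip_eq_zero_iff (by linarith) (hW.1.memLp_pexp hA)).mpr h]
              positivity
        have h2 := hp V hV
        linarith
  exact key k v Q L M hv (le_max_left _ _) (le_max_right _ _) hk hprof

/-- A sequence with `lim ‖v‖_p^p ≥ Λ lim ‖v‖_{Ḣ^s}²` has a nonzero profile that satisfies the same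
inequality. If all nonzero profiles violate it, then removing one of them, which exists since
`L > 0`, leaves a remainder with `lim ‖w‖_p^p > Λ lim ‖w‖_{Ḣ^s}²`, in contradiction to
`ConvSeq.limL_le`. -/
theorem ConvSeq.exists_profile (hA : Admissible d s q) {v : ℕ → Eu d → ℂ} {Q L M Λ : ℝ}
    (hv : ConvSeq s q v Q L M) (hΛ : 0 ≤ Λ) (hL : 0 < L) (hLM : Λ * M ≤ L) :
    ∃ V, IsProfile s q v V ∧ ¬ V =ᵐ[volume] 0 ∧ Λ * ‖eh s V‖ ^ 2 ≤ ip (pexp d s q) V := by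
  by_contra! hcon
  have hq := hA.hq
  have hqp := hA.q_lt_pexp
  have hall : ∀ V, IsProfile s q v V → ip (pexp d s q) V ≤ Λ * ‖eh s V‖ ^ 2 := fun V hV => by
    by_cases h0 : V =ᵐ[volume] 0
    · rw [(ip_eq_zero_iff (by linarith) (hV.1.memLp_pexp hA)).mpr h0]
      positivity
    · exact (hcon V hV h0).le
  obtain ⟨V, hV, hV0⟩ : ∃ V, IsProfile s q v V ∧ ¬ V =ᵐ[volume] 0 := by
    by_contra! hzero
    refine hL.not_ge (le_of_forall_pos_le_add fun ε hε => ?_)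
    obtain ⟨η, hη, hthr⟩ := exists_profile_threshold hA (B := max (max Q M) 0) (le_max_right _ _) hε
    rw [zero_add]
    refine hthr v Q L M hv ((le_max_left _ _).trans (le_max_left _ _))
      ((le_max_right _ _).trans (le_max_left _ _)) fun V hV => ?_
    rw [(ip_eq_zero_iff (by linarith) hV.1.memLp).mpr (hzero V hV)]
    exact hη
  obtain ⟨w, hw, hwp⟩ := hv.peel hA hV
  have h1 := hw.limL_le hA hΛ fun W hW => by
    rcases hwp W hW with h | h
    · exact hall W h
    · rw [(ip_eq_zero_iff (by linarith) (hW.1.memLp_pexp hA)).mpr h]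
      positivity
  have h2 := hcon V hV hV0
  linarith

end

/-! ### Test directions -/

/-- The function whose Fourier transform is the complex conjugate of `ψ`. The conjugation makes the
inner products with this function complex linear in `ψ`. -/
def testDir (ψ : 𝓢(Eu d, ℂ)) (x : Eu d) : ℂ := starRingEnd ℂ ((𝓕 ψ) x)

theorem memLp_testDir (ψ : 𝓢(Eu d, ℂ)) (p : ℝ≥0∞) : MemLp (testDir ψ) p volume :=
  ((𝓕 ψ).memLp p volume).star

theorem hasFourierOn_testDir (ψ : 𝓢(Eu d, ℂ)) :
    HasFourierOn Set.univ (testDir ψ) (fun ξ => starRingEnd ℂ (ψ ξ)) where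
  meas_left := (memLp_testDir ψ 2).1
  tempered φ := MemLp.integrable_mul_schwartz one_le_two (memLp_testDir ψ 2) φ
  meas_right := ((ψ.memLp 2 volume).star).1
  integrable φ _ := MemLp.integrable_mul_schwartz one_le_two (ψ.memLp 2 volume).star φ
  pairing φ _ := by
    have h := SchwartzMap.integral_inner_fourier_fourier ψ φ
    simp only [RCLike.inner_apply] at h
    simp only [testDir, mul_comm (starRingEnd ℂ _)]
    exact h

theorem memLp_sym_mul_schwartz {γ : ℝ} (hγ0 : 0 ≤ γ) (hγ1 : γ ≤ 1) (ψ : 𝓢(Eu d, ℂ)) :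
    MemLp (fun ξ => sym γ ξ * ψ ξ) 2 volume := by
  set S : ℝ := 2 ^ (d + 2) * ((Finset.Iic (d + 2, 0)).sup fun m => SchwartzMap.seminorm ℝ m.1 m.2) ψ
    with hS
  have h1 : MemLp (fun x : Eu d => wt x) 2 volume := by
    rw [memLp_two_iff_integrable_sq measurable_wt.aestronglyMeasurable]
    exact integrable_wt_sq
  have hpi : (1 : ℝ) ≤ 2 * Real.pi := by linarith [Real.pi_gt_three]
  refine (h1.const_mul (2 * Real.pi * S)).mono ((measurable_sym _).aestronglyMeasurable.mul
    ψ.continuous.aestronglyMeasurable) (Eventually.of_forall fun ξ => ?_)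
  refine le_trans ?_ (le_abs_self _)
  have h := SchwartzMap.one_add_le_sup_seminorm_apply (𝕜 := ℝ) (m := (d + 2, 0)) (k := d + 2) (n := 0)
    le_rfl le_rfl ψ ξ
  rw [norm_iteratedFDeriv_zero] at h
  change _ ≤ S at h
  have hx := norm_nonneg ξ
  have hx1 : 1 ≤ 1 + ‖ξ‖ := by linarith
  have h2 : (2 * Real.pi * ‖ξ‖) ^ γ ≤ 2 * Real.pi * (1 + ‖ξ‖) := by
    calc (2 * Real.pi * ‖ξ‖) ^ γ ≤ (2 * Real.pi * (1 + ‖ξ‖)) ^ γ := by gcongr; linarith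
      _ ≤ (2 * Real.pi * (1 + ‖ξ‖)) ^ (1 : ℝ) :=
        Real.rpow_le_rpow_of_exponent_le (one_le_mul_of_one_le_of_one_le hpi hx1) hγ1
      _ = _ := Real.rpow_one _
  have h3 : 1 ≤ (1 + ‖ξ‖) ^ (d + 1) * wt ξ := by
    have h4 : 1 ≤ (1 + ‖ξ‖) ^ (d + 1) * wt ξ ^ 2 := by
      rw [wt_sq, Real.rpow_neg (by positivity)]
      refine le_of_eq ?_
      rw [← Nat.cast_succ, Real.rpow_natCast, mul_inv_cancel₀ (by positivity)]
    refine h4.trans ?_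
    have h5 := wt_le_one ξ
    have h6 := (wt_pos ξ).le
    gcongr
    nlinarith
  rw [norm_mul, norm_sym]
  calc _ ≤ 2 * Real.pi * (1 + ‖ξ‖) * ‖ψ ξ‖ := by gcongr
    _ ≤ 2 * Real.pi * (1 + ‖ξ‖) * ‖ψ ξ‖ * ((1 + ‖ξ‖) ^ (d + 1) * wt ξ) :=
        le_mul_of_one_le_right (by positivity) h3
    _ = 2 * Real.pi * ((1 + ‖ξ‖) ^ (d + 2) * ‖ψ ξ‖) * wt ξ := by ring
    _ ≤ _ := by
        have := (wt_pos ξ).le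
        gcongr

theorem hdotNorm_testDir (hd : 0 < d) {γ : ℝ} (hγ0 : 0 ≤ γ) (hγ1 : γ ≤ 1) (ψ : 𝓢(Eu d, ℂ)) :
    hdotNorm γ (testDir ψ) < ∞ := by
  rw [← memLp_sym_mul_iff hd ((hasFourierOn_testDir ψ).mono (Set.subset_univ _))]
  refine (memLp_sym_mul_schwartz hγ0 hγ1 ψ).star.ae_eq (Eventually.of_forall fun ξ => ?_)
  simp [sym]

/-- The bilinear pairing of `(2π|ξ|)^{2γ} f̂` with `ψ`, that is, of `(-Δ)^γ f` with `𝓕 ψ`. -/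
def pairS (γ : ℝ) (f : Eu d → ℂ) (ψ : 𝓢(Eu d, ℂ)) : ℂ := ∫ ξ, sym (2 * γ) ξ * ft f ξ * ψ ξ

theorem inner_eh_testDir (hd : 0 < d) {γ : ℝ} (hγ0 : 0 ≤ γ) (hγ1 : γ ≤ 1) (ψ : 𝓢(Eu d, ℂ))
    {f : Eu d → ℂ} (hf : hdotNorm γ f < ∞) :
    inner ℂ (eh γ (testDir ψ)) (eh γ f) = pairS γ f ψ ∧
      Integrable (fun ξ => sym (2 * γ) ξ * ft f ξ * ψ ξ) := by
  have hae : (fun ξ => inner ℂ (eh γ (testDir ψ) ξ) (eh γ f ξ))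
      =ᵐ[volume] fun ξ => sym (2 * γ) ξ * ft f ξ * ψ ξ := by
    filter_upwards [coe_eh hd (hdotNorm_testDir hd hγ0 hγ1 ψ), coe_eh hd hf, ae_ne_zero hd,
      ft_ae_eq hd ((hasFourierOn_testDir ψ).mono (Set.subset_univ _))] with ξ h1 h2 h3 h4
    rw [h1, h2, h4, two_mul, sym_add _ _ h3]
    simp only [RCLike.inner_apply, map_mul, RingHomCompTriple.comp_apply, RingHom.id_apply]
    have : starRingEnd ℂ (sym γ ξ) = sym γ ξ := by simp [sym]
    rw [this]; ring
  exact ⟨by rw [L2.inner_def]; exact integral_congr_ae hae,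
    (L2.integrable_inner _ _).congr hae⟩

/-! ### Derivatives along lines -/

/-- The derivative of `‖f‖_p^p`, by differentiation under the integral sign. -/
theorem hasDerivAt_ip {p : ℝ} (hp : 2 < p) {f g : Eu d → ℂ}
    (hf : MemLp f (ENNReal.ofReal p) volume) (hg : MemLp g (ENNReal.ofReal p) volume) :
    Integrable (fun x => ((‖f x‖ ^ (p - 2) : ℝ) : ℂ) * f x * starRingEnd ℂ (g x)) ∧
    HasDerivAt (fun t : ℝ => ip p (f + (t : ℂ) • g))
      (p * (∫ x, ((‖f x‖ ^ (p - 2) : ℝ) : ℂ) * f x * starRingEnd ℂ (g x)).re) 0 := by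
  have hp0 : 0 < p := by linarith
  set m : Eu d → ℝ := fun x => ‖f x‖ + ‖g x‖ with hm
  have hmp : Integrable (fun x => m x ^ p) := by
    have h := (hf.norm.add hg.norm).integrable_norm_rpow
      (by simpa using hp0) ENNReal.ofReal_ne_top
    refine h.congr (Eventually.of_forall fun x => ?_)
    simp only [Pi.add_apply, ENNReal.toReal_ofReal hp0.le, hm]
    rw [Real.norm_of_nonneg (by positivity)]
  have hbd : ∀ x (w : ℂ), ‖w‖ ≤ m x →
      ‖((‖w‖ ^ (p - 2) : ℝ) : ℂ) * w * starRingEnd ℂ (g x)‖ ≤ m x ^ p := by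
    intro x w hw
    have h0 : 0 ≤ m x := (norm_nonneg _).trans hw
    have hg' : ‖g x‖ ≤ m x := by simp [hm]
    rw [norm_mul, norm_mul, Complex.norm_real, Real.norm_of_nonneg (by positivity),
      RCLike.norm_conj]
    calc ‖w‖ ^ (p - 2) * ‖w‖ * ‖g x‖ ≤ m x ^ (p - 2) * m x * m x := by
          have := Real.rpow_le_rpow (norm_nonneg w) hw (by linarith : 0 ≤ p - 2)
          gcongr
      _ = m x ^ p := by
          rw [mul_assoc, ← sq, ← Real.rpow_two, ← Real.rpow_add_of_nonneg h0 (by linarith) (by norm_num),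
            sub_add_cancel]
  have hcm : AEStronglyMeasurable (fun x => ((‖f x‖ ^ (p - 2) : ℝ) : ℂ) * f x * starRingEnd ℂ (g x))
      volume :=
    ((Complex.measurable_ofReal.comp_aemeasurable
      (hf.1.norm.aemeasurable.pow_const _)).aestronglyMeasurable.mul hf.1).mul
      hg.1.star
  have hint : Integrable (fun x => ((‖f x‖ ^ (p - 2) : ℝ) : ℂ) * f x * starRingEnd ℂ (g x)) :=
    hmp.mono' hcm (Eventually.of_forall fun x => hbd x _ (by simp [hm]))
  refine ⟨hint, ?_⟩
  have key := (hasDerivAt_integral_of_dominated_loc_of_deriv_le (𝕜 := ℝ)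
    (μ := (volume : Measure (Eu d))) (x₀ := (0 : ℝ)) (s := Metric.ball 0 1)
    (F := fun t x => ‖(f + (t : ℂ) • g) x‖ ^ p)
    (F' := fun t x => p * (((‖(f + (t : ℂ) • g) x‖ ^ (p - 2) : ℝ) : ℂ) * (f + (t : ℂ) • g) x
      * starRingEnd ℂ (g x)).re)
    (bound := fun x => p * m x ^ p) (Metric.ball_mem_nhds _ one_pos) ?_ ?_ ?_ ?_
    (hmp.const_mul p) ?_).2
  · refine key.congr_deriv ?_
    simp only [Complex.ofReal_zero, zero_smul, add_zero]
    rw [integral_const_mul]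
    congr 1
    exact integral_re hint
  · exact Eventually.of_forall fun t =>
      ((hf.1.add (hg.1.const_smul (t : ℂ))).norm.aemeasurable.pow_const _).aestronglyMeasurable
  · simpa using integrable_norm_rpow hp0 hf
  · simp only [Complex.ofReal_zero, zero_smul, add_zero]
    exact (hint.re.const_mul p).1
  · refine Eventually.of_forall fun x t ht => ?_
    rw [Real.norm_eq_abs, abs_mul, abs_of_pos hp0]
    gcongr
    refine (Complex.abs_re_le_norm _).trans (hbd x _ ?_)
    have ht' : |t| ≤ 1 := by simpa using (mem_ball_zero_iff.mp ht).le
    simp only [Pi.add_apply, Pi.smul_apply, smul_eq_mul, hm]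
    refine (norm_add_le _ _).trans ?_
    rw [norm_mul, Complex.norm_real, Real.norm_eq_abs]
    have := mul_le_of_le_one_left (norm_nonneg (g x)) ht'
    linarith
  · refine Eventually.of_forall fun x t _ => ?_
    have h1 : HasDerivAt (fun t : ℝ => (f + (t : ℂ) • g) x) (g x) t := by
      have := ((hasDerivAt_id t).ofReal_comp.mul_const (g x)).const_add (f x)
      simpa using this
    have h2 := (hasFDerivAt_norm_rpow ((f + (t : ℂ) • g) x) (by linarith : 1 < p)).comp_hasDerivAt t h1
    refine h2.congr_deriv ?_
    rw [smul_apply, innerSL_apply_apply, smul_eq_mul, mul_assoc p, mul_assoc]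
    congr 1
    rw [Complex.re_ofReal_mul]
    congr 1
    simp [Complex.inner]; ring

theorem hasDerivAt_norm_sq_add_smul (a b : L2 d) :
    HasDerivAt (fun t : ℝ => ‖a + (t : ℂ) • b‖ ^ 2) (2 * (inner ℂ b a).re) 0 := by
  have h : (fun t : ℝ => ‖a + (t : ℂ) • b‖ ^ 2)
      = fun t : ℝ => ‖a‖ ^ 2 + 2 * (inner ℂ b a).re * t + t ^ 2 * ‖b‖ ^ 2 := by
    funext t
    rw [norm_add_sq (𝕜 := ℂ), inner_smul_right, norm_smul, Complex.norm_real, mul_pow,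
      Real.norm_eq_abs, sq_abs]
    have : RCLike.re ((t : ℂ) * inner ℂ a b) = t * (inner ℂ b a).re := by
      have h1 : (inner ℂ b a).re = (inner ℂ a b).re := inner_re_symm (𝕜 := ℂ) b a
      rw [h1]
      exact Complex.re_ofReal_mul _ _
    rw [this]; ring
  rw [h]
  have := (((hasDerivAt_id (0 : ℝ)).const_mul (2 * (inner ℂ b a).re)).const_add (‖a‖ ^ 2)).add
    ((hasDerivAt_pow 2 (0 : ℝ)).mul_const (‖b‖ ^ 2))
  refine this.congr_deriv ?_
  simp

/-! ### Scaling -/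

/-- The rescaled function `κ f(μ x)`. -/
def scl (κ μ : ℝ) (f : Eu d → ℂ) (x : Eu d) : ℂ := (κ : ℂ) * f (μ • x)

section scl
variable {κ μ : ℝ} {f : Eu d → ℂ}

theorem memLp_scl {p : ℝ≥0∞} (hp : p ≠ ∞) (hμ : 0 < μ) (hf : MemLp f p volume) :
    MemLp (scl κ μ f) p volume := by
  refine MemLp.const_mul ⟨?_, ?_⟩ _
  · exact hf.1.comp_quasiMeasurePreserving
      (Measure.quasiMeasurePreserving_smul volume hμ.ne')
  · rw [eLpNorm_comp_dilation hμ hp]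
    exact ENNReal.mul_lt_top (ENNReal.rpow_lt_top_of_nonneg (by positivity) ENNReal.ofReal_ne_top) hf.2

theorem ip_scl (hκ : 0 < κ) (hμ : 0 < μ) (p : ℝ) :
    ip p (scl κ μ f) = κ ^ p * μ ^ (-(d : ℝ)) * ip p f := by
  have h := Measure.integral_comp_smul (volume : Measure (Eu d)) (fun x => κ ^ p * ‖f x‖ ^ p) μ
  rw [ip, ip, mul_assoc, mul_left_comm, ← integral_const_mul]
  have h2 : (fun x => ‖scl κ μ f x‖ ^ p) = fun x => κ ^ p * ‖f (μ • x)‖ ^ p := by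
    funext x
    rw [scl, norm_mul, Complex.norm_real, Real.norm_of_nonneg hκ.le,
      Real.mul_rpow hκ.le (norm_nonneg _)]
  rw [h2, h, finrank_euclideanSpace_fin, abs_of_pos (by positivity), smul_eq_mul,
    Real.rpow_neg hμ.le, Real.rpow_natCast]

theorem hasFourierOn_scl {T : Set 𝓢(Eu d, ℂ)} {h : Eu d → ℂ} (hμ : 0 < μ)
    (hT : ∀ φ ∈ T, dil μ hμ.ne' φ ∈ T) (hf : HasFourierOn T f h) :
    HasFourierOn T (scl κ μ f) (fun ξ => (κ : ℂ) * (((μ ^ d : ℝ) : ℂ)⁻¹ * h (μ⁻¹ • ξ))) :=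
  (hf.dilate hμ hT).smul (κ : ℂ)

theorem hdotNorm_scl (hd : 0 < d) (hκ : 0 < κ) (hμ : 0 < μ) {γ : ℝ} (hf : hdotNorm γ f < ∞) :
    hdotNorm γ (scl κ μ f) < ∞ ∧
      ‖eh γ (scl κ μ f)‖ ^ 2 = κ ^ (2 : ℝ) * μ ^ (2 * γ - d) * ‖eh γ f‖ ^ 2 := by
  have hF := hasFourierAway_of_lt_top hf
  have h1 : HasFourierAway (scl κ μ f) _ :=
    hasFourierOn_scl (κ := κ) hμ (fun φ hφ => dil_mem_flat hμ.ne' hφ) hF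
  have h2 : (fun ξ => sym γ ξ * ((κ : ℂ) * (((μ ^ d : ℝ) : ℂ)⁻¹ * ft f (μ⁻¹ • ξ))))
      = ((κ * μ ^ (γ - d) : ℝ) : ℂ) • fun ξ => (fun ξ => sym γ ξ * ft f ξ) (μ⁻¹ • ξ) := by
    funext ξ
    have h3 : sym γ ξ = ((μ ^ γ : ℝ) : ℂ) * sym γ (μ⁻¹ • ξ) := by
      have hx : μ * (2 * Real.pi * (μ⁻¹ * ‖ξ‖)) = 2 * Real.pi * ‖ξ‖ := by field_simp
      rw [sym, sym, ← Complex.ofReal_mul, ← Real.mul_rpow hμ.le (by positivity), norm_smul,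
        Real.norm_of_nonneg (by positivity), hx]
    rw [Pi.smul_apply, smul_eq_mul, h3, Real.rpow_sub hμ, Real.rpow_natCast]
    push_cast
    field_simp
  have h4 : hdotNorm γ (scl κ μ f)
      = ENNReal.ofReal (κ * μ ^ (γ - d) * μ ^ ((d : ℝ) / 2)) * hdotNorm γ f := by
    rw [hdotNorm_eq hd γ h1, hdotNorm_eq hd γ hF, h2, eLpNorm_const_smul,
      eLpNorm_comp_dilation (inv_pos.mpr hμ) ENNReal.ofNat_ne_top (fun ξ => sym γ ξ * ft f ξ), ← mul_assoc]
    congr 1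
    rw [← ofReal_norm, Complex.norm_real, Real.norm_of_nonneg (by positivity), inv_pow, inv_inv,
      ENNReal.ofReal_rpow_of_nonneg (by positivity) (by positivity),
      ← ENNReal.ofReal_mul (by positivity)]
    congr 2
    rw [← Real.rpow_natCast, ← Real.rpow_mul hμ.le]
    congr 1
    simp; ring
  have h5 : hdotNorm γ (scl κ μ f) < ∞ := by
    rw [h4]; exact ENNReal.mul_lt_top ENNReal.ofReal_lt_top hf
  refine ⟨h5, ?_⟩
  rw [← toReal_hdotNorm hd h5, ← toReal_hdotNorm hd hf, h4, ENNReal.toReal_mul,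
    ENNReal.toReal_ofReal (by positivity), mul_pow, mul_assoc κ, ← Real.rpow_add hμ, mul_pow,
    ← Real.rpow_natCast (μ ^ _), ← Real.rpow_mul hμ.le, ← Real.rpow_natCast κ]
  congr 3
  push_cast; ring

end scl

/-- Two quantities that scale with independent exponents can be given arbitrary positive
factors. -/
theorem exists_scaling {e₁ m₁ e₂ m₂ : ℝ} (hdet : e₁ * m₂ - e₂ * m₁ ≠ 0) {A B : ℝ} (hA : 0 < A)
    (hB : 0 < B) : ∃ κ μ : ℝ, 0 < κ ∧ 0 < μ ∧ κ ^ e₁ * μ ^ m₁ = A ∧ κ ^ e₂ * μ ^ m₂ = B := by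
  set D := e₁ * m₂ - e₂ * m₁ with hD
  refine ⟨Real.exp ((Real.log A * m₂ - Real.log B * m₁) / D),
    Real.exp ((Real.log B * e₁ - Real.log A * e₂) / D), Real.exp_pos _, Real.exp_pos _, ?_, ?_⟩
  · rw [← Real.exp_mul, ← Real.exp_mul, ← Real.exp_add]
    nth_rewrite 3 [← Real.exp_log hA]
    congr 1
    field_simp
    rw [hD]; ring
  · rw [← Real.exp_mul, ← Real.exp_mul, ← Real.exp_add]
    nth_rewrite 3 [← Real.exp_log hB]
    congr 1
    field_simp
    rw [hD]; ring

/-! ### Maximizers of Weinstein functionals -/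

/-- The data common to the two Weinstein functionals `‖f‖_p^p / (b(f)^θ ‖f‖_{Ḣ^s}²)`: the class
`Y ⊆ L^q ∩ Ḣ^s` of admissible functions and the quantity `b`, which is `‖f‖_{Ḣ^{s_c}}²` in one
case and `‖f‖_q^q` in the other. Under the scaling `f ↦ κ f(μ ·)`, `b` is multiplied by
`κ^e μ^m`; the last fields say that the quotient is invariant and that `b` and `‖f‖_{Ḣ^s}²` can be
normalised simultaneously. -/
structure WeinsteinProblem (d : ℕ) (s q : ℝ) (Y : Set (Eu d → ℂ)) (b : (Eu d → ℂ) → ℝ)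
    (θ e m : ℝ) : Prop where
  adm : Admissible d s q
  inX : ∀ f ∈ Y, InX s q f
  nonneg : ∀ f, 0 ≤ b f
  gn : ∃ C, 0 ≤ C ∧ ∀ f ∈ Y, ip (pexp d s q) f ≤ C * b f ^ θ * ‖eh s f‖ ^ 2
  eq_zero : ∀ f ∈ Y, b f = 0 → f =ᵐ[volume] 0
  scale : ∀ f ∈ Y, ∀ κ μ : ℝ, 0 < κ → 0 < μ → scl κ μ f ∈ Y ∧ b (scl κ μ f) = κ ^ e * μ ^ m * b f
  translate : ∀ f ∈ Y, ∀ y : Eu d, (fun x => f (x + y)) ∈ Y ∧ b (fun x => f (x + y)) = b f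
  bounded : ∃ K, ∀ f ∈ Y, b f ≤ 1 → ip q f ≤ K
  closed : ∀ (u : ℕ → Eu d → ℂ) (V : Eu d → ℂ), (∀ n, u n ∈ Y) → (∀ n, b (u n) ≤ 1) →
    (∀ n, ‖eh s (u n)‖ ≤ 1) → InX s q V → WeakLim (fun n => eh s (u n)) (eh s V) →
    V ∈ Y ∧ b V ≤ 1
  nonempty : ∃ f ∈ Y, ¬ f =ᵐ[volume] 0
  θ_pos : 0 < θ
  exp_κ : θ * e + 2 = pexp d s q
  exp_μ : θ * m + (2 * s - d) = -d
  det : e * (2 * s - d) - 2 * m ≠ 0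

namespace WeinsteinProblem
variable {s q θ e m : ℝ} {Y : Set (Eu d → ℂ)} {b : (Eu d → ℂ) → ℝ}

theorem pos (W : WeinsteinProblem d s q Y b θ e m) {f : Eu d → ℂ} (hf : f ∈ Y)
    (h0 : ¬ f =ᵐ[volume] 0) : 0 < b f ∧ 0 < ‖eh s f‖ ^ 2 ∧ 0 < ip (pexp d s q) f := by
  have hA := W.adm
  have hX := W.inX f hf
  have hq := hA.hq
  have hqp := hA.q_lt_pexp
  refine ⟨lt_of_le_of_ne (W.nonneg f) fun h => h0 (W.eq_zero f hf h.symm), ?_, ?_⟩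
  · refine pow_pos (norm_pos_iff.mpr fun h => h0 ?_) 2
    exact ae_eq_zero_of_eh_eq_zero hA.one_lt_ofReal ENNReal.ofReal_ne_top hA.hd hX.memLp hX.fin h
  · refine lt_of_le_of_ne (ip_nonneg _ _) fun h => h0 ?_
    exact (ip_eq_zero_iff (by linarith) (hX.memLp_pexp hA)).mp h.symm

theorem denominator_scl (W : WeinsteinProblem d s q Y b θ e m) {f : Eu d → ℂ} (hf : f ∈ Y)
    {κ μ : ℝ} (hκ : 0 < κ) (hμ : 0 < μ) :
    b (scl κ μ f) ^ θ * ‖eh s (scl κ μ f)‖ ^ 2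
      = κ ^ pexp d s q * μ ^ (-(d : ℝ)) * (b f ^ θ * ‖eh s f‖ ^ 2) := by
  rw [(W.scale f hf κ μ hκ hμ).2, (hdotNorm_scl W.adm.hd hκ hμ (W.inX f hf).fin).2,
    Real.mul_rpow (by positivity) (W.nonneg f), Real.mul_rpow (by positivity) (by positivity),
    ← Real.rpow_mul hκ.le, ← Real.rpow_mul hμ.le, ← W.exp_κ, ← W.exp_μ, Real.rpow_add hκ,
    Real.rpow_add hμ, mul_comm θ e, mul_comm θ m]
  ring

theorem scl_ne_zero (W : WeinsteinProblem d s q Y b θ e m) {f : Eu d → ℂ} (hf : f ∈ Y)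
    (h0 : ¬ f =ᵐ[volume] 0) {κ μ : ℝ} (hκ : 0 < κ) (hμ : 0 < μ) : ¬ scl κ μ f =ᵐ[volume] 0 := by
  intro h
  have h1 := (ip_eq_zero_iff (by linarith [W.adm.hq]) (W.inX _ (W.scale f hf κ μ hκ hμ).1).memLp).mpr h
  rw [ip_scl hκ hμ] at h1
  have h2 : ip q f = 0 := by
    rcases mul_eq_zero.mp h1 with h | h
    · have : 0 < κ ^ q * μ ^ (-(d : ℝ)) := by positivity
      exact absurd h this.ne'
    · exact h
  exact h0 ((ip_eq_zero_iff (by linarith [W.adm.hq]) (W.inX f hf).memLp).mp h2)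

/-- The quotient has a maximizer, and the two norms of the maximizer can be prescribed. A
normalised maximizing sequence has, by `ConvSeq.exists_profile`, a profile `V` with
`‖V‖_p^p ≥ C ‖V‖_{Ḣ^s}²`; as `b(V) ≤ 1`, this profile is a maximizer. -/
theorem exists_maximizer (W : WeinsteinProblem d s q Y b θ e m) :
    ∃ C : ℝ, 0 < C ∧ (∀ f ∈ Y, ip (pexp d s q) f ≤ C * (b f ^ θ * ‖eh s f‖ ^ 2)) ∧
      ∀ A B : ℝ, 0 < A → 0 < B → ∃ V ∈ Y, ¬ V =ᵐ[volume] 0 ∧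
        ip (pexp d s q) V = C * (b V ^ θ * ‖eh s V‖ ^ 2) ∧ b V = B ∧ ‖eh s V‖ ^ 2 = A := by
  have hA := W.adm
  have hq := hA.hq
  have hqp := hA.q_lt_pexp
  have hp0 : 0 < pexp d s q := by linarith
  obtain ⟨C₀, -, hgn⟩ := W.gn
  set S : Set ℝ := {r | ∃ f ∈ Y, ¬ f =ᵐ[volume] 0 ∧
    r = ip (pexp d s q) f / (b f ^ θ * ‖eh s f‖ ^ 2)} with hS
  have hSne : S.Nonempty := by
    obtain ⟨f, hf, h0⟩ := W.nonempty
    exact ⟨_, f, hf, h0, rfl⟩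
  have hSb : BddAbove S := by
    refine ⟨C₀, ?_⟩
    rintro r ⟨f, hf, h0, rfl⟩
    obtain ⟨h1, h2, h3⟩ := W.pos hf h0
    rw [div_le_iff₀ (by positivity), ← mul_assoc]
    exact hgn f hf
  have hSpos : ∀ r ∈ S, 0 < r := by
    rintro r ⟨f, hf, h0, rfl⟩
    obtain ⟨h1, h2, h3⟩ := W.pos hf h0
    positivity
  set C := sSup S with hC
  have hCpos : 0 < C := by
    obtain ⟨r, hr⟩ := hSne
    exact (hSpos r hr).trans_le (le_csSup hSb hr)
  have hCle : ∀ f ∈ Y, ip (pexp d s q) f ≤ C * (b f ^ θ * ‖eh s f‖ ^ 2) := fun f hf => by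
    by_cases h0 : f =ᵐ[volume] 0
    · rw [(ip_eq_zero_iff hp0 ((W.inX f hf).memLp_pexp hA)).mpr h0]
      have := W.nonneg f
      positivity
    · obtain ⟨h1, h2, h3⟩ := W.pos hf h0
      rw [← div_le_iff₀ (by positivity)]
      exact le_csSup hSb ⟨f, hf, h0, rfl⟩
  refine ⟨C, hCpos, hCle, ?_⟩
  have hmax : ∃ V ∈ Y, ¬ V =ᵐ[volume] 0 ∧ ip (pexp d s q) V = C * (b V ^ θ * ‖eh s V‖ ^ 2) := by
    obtain ⟨r, -, hr, hrS⟩ := exists_seq_tendsto_sSup hSne hSb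
    choose f hf h0 hrf using hrS
    have hnorm : ∀ n, ∃ g ∈ Y, b g = 1 ∧ ‖eh s g‖ ^ 2 = 1 ∧ ip (pexp d s q) g = r n := fun n => by
      obtain ⟨h1, h2, h3⟩ := W.pos (hf n) (h0 n)
      obtain ⟨κ, μ, hκ, hμ, hb, ha⟩ := exists_scaling W.det (inv_pos.mpr h1) (inv_pos.mpr h2)
      have hsc := W.scale (f n) (hf n) κ μ hκ hμ
      have hde := W.denominator_scl (hf n) hκ hμ
      have hb1 : b (scl κ μ (f n)) = 1 := by rw [hsc.2, hb, inv_mul_cancel₀ h1.ne']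
      have ha1 : ‖eh s (scl κ μ (f n))‖ ^ 2 = 1 := by
        rw [(hdotNorm_scl hA.hd hκ hμ (W.inX _ (hf n)).fin).2, ha, inv_mul_cancel₀ h2.ne']
      refine ⟨scl κ μ (f n), hsc.1, hb1, ha1, ?_⟩
      rw [hb1, ha1, Real.one_rpow, one_mul] at hde
      rw [ip_scl hκ hμ, hrf n, eq_div_iff (by positivity)]
      linear_combination (-ip (pexp d s q) (f n)) * hde
    choose g hg hgb hga hgr using hnorm
    obtain ⟨K, hK⟩ := W.bounded
    obtain ⟨Q, -, φ, hφ, hQ⟩ := tendsto_subseq_of_bounded (Metric.isBounded_Icc 0 K)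
      (x := fun n => ip q (g n)) (fun n => ⟨ip_nonneg _ _, hK _ (hg n) (hgb n).le⟩)
    have hconv : ConvSeq s q (fun n => g (φ n)) Q C 1 := by
      refine ⟨fun n => W.inX _ (hg _), hQ, ?_, ?_⟩
      · simp only [hgr]
        exact hr.comp hφ.tendsto_atTop
      · simp only [hga]
        exact tendsto_const_nhds
    obtain ⟨V, ⟨hVX, σ, x, hσ, hlim⟩, hV0, hVN⟩ := hconv.exists_profile hA hCpos.le hCpos
      (by rw [mul_one])
    have htr := fun n => W.translate _ (hg (φ (σ n))) (x n)
    obtain ⟨hVY, hVb⟩ := W.closed _ V (fun n => (htr n).1) (fun n => by rw [(htr n).2, hgb])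
      (fun n => by
        rw [eh_translate hA.hd (W.inX _ (hg _)).fin, norm_chrL2]
        nlinarith [hga (φ (σ n)), norm_nonneg (eh s (g (φ (σ n))))]) hVX hlim
    refine ⟨V, hVY, hV0, le_antisymm (hCle V hVY) ?_⟩
    refine le_trans ?_ hVN
    have h1 : b V ^ θ ≤ 1 := Real.rpow_le_one (W.nonneg V) hVb W.θ_pos.le
    gcongr
    exact mul_le_of_le_one_left (by positivity) h1
  intro A B hA0 hB0
  obtain ⟨V, hVY, hV0, hVN⟩ := hmax
  obtain ⟨h1, h2, h3⟩ := W.pos hVY hV0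
  obtain ⟨κ, μ, hκ, hμ, hb, ha⟩ := exists_scaling W.det (div_pos hB0 h1) (div_pos hA0 h2)
  have hsc := W.scale V hVY κ μ hκ hμ
  refine ⟨scl κ μ V, hsc.1, W.scl_ne_zero hVY hV0 hκ hμ, ?_, ?_, ?_⟩
  · rw [W.denominator_scl hVY hκ hμ, ip_scl hκ hμ, hVN]; ring
  · rw [hsc.2, hb, div_mul_cancel₀ _ h1.ne']
  · rw [(hdotNorm_scl hA.hd hκ hμ (W.inX _ hVY).fin).2, ha, div_mul_cancel₀ _ h2.ne']

end WeinsteinProblem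

/-- The first-order condition at a maximum of `N / (b^θ a)`. -/
theorem first_order_condition {N a b : ℝ → ℝ} {N' a' b' C θ : ℝ} (hN : HasDerivAt N N' 0)
    (ha : HasDerivAt a a' 0) (hb : HasDerivAt b b' 0) (hb0 : 0 < b 0) (ha0 : 0 < a 0)
    (hle : ∀ t, N t ≤ C * (b t ^ θ * a t)) (heq : N 0 = C * (b 0 ^ θ * a 0)) :
    N' = N 0 * (θ * b' / b 0 + a' / a 0) := by
  have h1 : HasDerivAt (fun t => C * (b t ^ θ * a t) - N t)
      (C * (b' * θ * b 0 ^ (θ - 1) * a 0 + b 0 ^ θ * a') - N') 0 :=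
    (((hb.rpow_const (Or.inl hb0.ne')).mul ha).const_mul C).sub hN
  have h2 : IsLocalMin (fun t => C * (b t ^ θ * a t) - N t) 0 := by
    refine Eventually.of_forall fun t => ?_
    beta_reduce
    linarith [hle t]
  have h3 := h2.hasDerivAt_eq_zero h1
  rw [Real.rpow_sub_one hb0.ne'] at h3
  rw [heq]
  field_simp at h3 ⊢
  linarith

/-! ### The two Weinstein problems -/

/-- The standing assumptions on the parameters: `4s/d < α < 2^⋆`. -/
structure Params (d : ℕ) (s α : ℝ) : Prop where
  hd : 0 < d
  hs0 : 0 < s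
  hs1 : s < 1
  lower : 4 * s / d < α
  upper : 2 * s < d → α < 4 * s / (d - 2 * s)

namespace Params
variable {s α : ℝ}

theorem d_pos (h : Params d s α) : (0 : ℝ) < d := by exact_mod_cast h.hd

theorem α_pos (h : Params d s α) : 0 < α :=
  lt_trans (div_pos (by linarith [h.hs0]) h.d_pos) h.lower

theorem alphac_eq (h : Params d s α) : alphac d s α = d * α / (2 * s) := by
  have := h.α_pos
  have := h.hs0
  rw [alphac, sc]
  have h1 : (d : ℝ) - 2 * (d / 2 - 2 * s / α) = 4 * s / α := by ring
  rw [h1]; field_simp; ring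

theorem upper' (h : Params d s α) : α * (d - 2 * s) < 4 * s := by
  by_cases hlt : 2 * s < d
  · exact (lt_div_iff₀ (by linarith)).mp (h.upper hlt)
  · have : α * (d - 2 * s) ≤ 0 := mul_nonpos_of_nonneg_of_nonpos h.α_pos.le (by linarith)
    linarith [h.hs0]

theorem sc_pos (h : Params d s α) : 0 < sc d s α := by
  have h1 := (div_lt_iff₀ h.d_pos).mp h.lower
  rw [sc, sub_pos, div_lt_iff₀ h.α_pos]
  linarith

theorem sc_lt (h : Params d s α) : sc d s α < s := by
  have h1 := h.upper'
  have h2 : ((d : ℝ) / 2 - s) < 2 * s / α := by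
    rw [lt_div_iff₀ h.α_pos]; linarith
  rw [sc]; linarith

theorem two_sc_lt (h : Params d s α) : 2 * sc d s α < d := by
  have : 0 < 2 * s / α := div_pos (by linarith [h.hs0]) h.α_pos
  rw [sc]; linarith

theorem pexp_alphac (h : Params d s α) : pexp d s (alphac d s α) = α + 2 := by
  have := h.d_pos
  have := h.hs0
  rw [pexp, h.alphac_eq]; field_simp

theorem two_lt_alphac (h : Params d s α) : 2 < alphac d s α := by
  have h1 := (div_lt_iff₀ h.d_pos).mp h.lower
  rw [h.alphac_eq, lt_div_iff₀ (by linarith [h.hs0])]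
  linarith

theorem alphac_pos (h : Params d s α) : 0 < alphac d s α := by linarith [h.two_lt_alphac]

theorem admissible (h : Params d s α) : Admissible d s (alphac d s α) := by
  refine ⟨h.hd, h.hs0, h.hs1, h.two_lt_alphac, ?_⟩
  have h1 := h.pexp_alphac
  rw [pexp] at h1
  rw [h1, h.alphac_eq, div_lt_iff₀ (by linarith [h.hs0])]
  linarith [h.upper']

theorem alphac_mul (h : Params d s α) : alphac d s α * (2 * s / d) = α := by
  have := h.d_pos
  have := h.hs0
  rw [h.alphac_eq]; field_simp

end Params

theorem WeakLim.norm_le_of_bound {u : ℕ → L2 d} {a : L2 d} (h : WeakLim u a) {B : ℝ}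
    (hB : ∀ n, ‖u n‖ ≤ B) : ‖a‖ ≤ B := by
  have h1 := (h a).norm
  have h2 : ‖inner ℂ a a‖ ≤ ‖a‖ * B := le_of_tendsto h1 (Eventually.of_forall fun n =>
    (norm_inner_le_norm _ _).trans (by gcongr; exact hB n))
  rw [inner_self_eq_norm_sq_to_K] at h2
  simp only [norm_pow, RCLike.norm_ofReal, abs_norm] at h2
  rcases (norm_nonneg a).eq_or_lt' with h0 | h0
  · rw [h0]; exact (norm_nonneg _).trans (hB 0)
  · rw [sq] at h2
    exact le_of_mul_le_mul_left h2 h0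

section
variable {s α : ℝ}

theorem exists_testDir_ne_zero : ∃ ψ : 𝓢(Eu d, ℂ), ¬ testDir ψ =ᵐ[volume] 0 := by
  refine ⟨cutoff d, fun h => ?_⟩
  set F : 𝓢(Eu d, ℂ) := 𝓕 (cutoff d) with hF
  have h1 : (F : Eu d → ℂ) =ᵐ[volume] 0 := by
    filter_upwards [h] with x hx
    simpa [testDir, hF] using hx
  have h2 : (F : Eu d → ℂ) = 0 :=
    (Continuous.ae_eq_iff_eq volume F.continuous continuous_zero).mp h1
  have h3 : F = 0 := by
    ext x; exact congrFun h2 x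
  have h4 : cutoff d = 𝓕⁻ (0 : 𝓢(Eu d, ℂ)) := by
    rw [← h3, hF, FourierTransform.fourierInv_fourier_eq]
  have h5 := cutoff_eq_one (d := d) (x := 0) (by simp)
  rw [h4] at h5
  simp at h5

theorem inX_testDir (hA : Admissible d s (alphac d s α)) (ψ : 𝓢(Eu d, ℂ)) :
    InX s (alphac d s α) (testDir ψ) :=
  ⟨memLp_testDir ψ _, hdotNorm_testDir hA.hd hA.hs0.le hA.hs1.le ψ⟩

theorem inX_iff {f : Eu d → ℂ} : f ∈ lebSpace d s α ↔ InX s (alphac d s α) f :=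
  ⟨fun h => ⟨h.1, h.2⟩, fun h => ⟨h.1, h.2⟩⟩

/-- Bounds in `L^q` pass to weak limits in `Ḣ^s`. -/
theorem ip_le_of_weakLim {q : ℝ} (hA : Admissible d s q) {u : ℕ → Eu d → ℂ} {V : Eu d → ℂ}
    {B B' : ℝ} (hu : ∀ n, InX s q (u n)) (hB : ∀ n, ip q (u n) ≤ B) (hB' : ∀ n, ‖eh s (u n)‖ ≤ B')
    (hV : InX s q V) (hlim : WeakLim (fun n => eh s (u n)) (eh s V)) : ip q V ≤ B := by
  obtain ⟨φ, W, hφ, h1, h2, h3, h4, -⟩ := exists_extraction hA.hd hA.hs0 hA.hs1 hA.hq.le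
    (fun n => (hu n).memLp) (fun n => (hu n).fin) hB hB'
  have h5 := hV.ae_eq_of_eh_eq hA ⟨h1, h2⟩ ((hlim.comp hφ).unique h3)
  rw [ip_congr h5]
  exact (memLp_of_ae_tendsto (by linarith [hA.hq]) (fun n => (hu (φ n)).memLp) h4
    (fun n => hB _)).2

/-- The problem for `‖f‖_p^p / (‖f‖_{L^{α_c}}^α ‖f‖_{Ḣ^s}²)`. -/
theorem lebesgueProblem (h : Params d s α) :
    WeinsteinProblem d s (alphac d s α) (lebSpace d s α) (ip (alphac d s α)) (2 * s / d)
      (alphac d s α) (-d) := by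
  have hA := h.admissible
  have hd := h.d_pos
  have hq := h.two_lt_alphac
  refine ⟨hA, fun f hf => inX_iff.mp hf, fun f => ip_nonneg _ _, ?_, ?_, ?_, ?_, ⟨1, fun f _ hf => hf⟩,
    ?_, ?_, div_pos (by linarith [h.hs0]) hd, ?_, ?_, ?_⟩
  · obtain ⟨C, hC, hgn⟩ := exists_gagliardo_nirenberg hA.hd hA.hs0 hA.hs1
      (by linarith : 1 < alphac d s α)
    exact ⟨C, hC, fun f hf => (hgn f hf.1 hf.2).2⟩
  · exact fun f hf h0 => (ip_eq_zero_iff (by linarith) hf.1).mp h0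
  · intro f hf κ μ hκ hμ
    exact ⟨⟨memLp_scl ENNReal.ofReal_ne_top hμ hf.1, (hdotNorm_scl hA.hd hκ hμ hf.2).1⟩,
      ip_scl hκ hμ _⟩
  · exact fun f hf y => ⟨inX_iff.mpr ((inX_iff.mp hf).translate hA y), ip_translate f y⟩
  · exact fun u V hu hb ha hV hlim => ⟨inX_iff.mpr hV,
      ip_le_of_weakLim hA (fun n => inX_iff.mp (hu n)) hb ha hV hlim⟩
  · obtain ⟨ψ, hψ⟩ := exists_testDir_ne_zero (d := d)
    exact ⟨_, inX_iff.mpr (inX_testDir hA ψ), hψ⟩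
  · rw [pexp]; ring
  · field_simp; ring
  · have h1 := hA.hqp
    have h2 : alphac d s α * d < 2 * s * alphac d s α + 2 * d := by
      have := mul_lt_mul_of_pos_right h1 hd
      rw [add_mul, div_mul_cancel₀ _ hd.ne'] at this
      linarith
    nlinarith

theorem inX_of_sob (h : Params d s α) {f : Eu d → ℂ} (hf : f ∈ sobSpace d s α) :
    InX s (alphac d s α) f := by
  obtain ⟨C, -, hS⟩ := exists_sobolev h.hd h.sc_pos (h.sc_lt.trans h.hs1) h.two_sc_lt
  exact ⟨(hS f hf.1 hf.2.1).1, hf.2.2⟩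

/-- `Ḣ^{s_c} ∩ Ḣ^s` is closed under weak limits of bounded sequences, and weak convergence in `Ḣ^s`
implies that in `Ḣ^{s_c}` along a subsequence. As `2 s_c < d`, the test functions for the Fourier
transform need not be flat at the origin. -/
theorem sob_of_weakLim (h : Params d s α) {u : ℕ → Eu d → ℂ} {V : Eu d → ℂ} {B B' : ℝ}
    (hu : ∀ n, u n ∈ sobSpace d s α) (hB : ∀ n, ‖eh (sc d s α) (u n)‖ ≤ B)
    (hB' : ∀ n, ‖eh s (u n)‖ ≤ B') (hV : InX s (alphac d s α) V)
    (hlim : WeakLim (fun n => eh s (u n)) (eh s V)) :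
    V ∈ sobSpace d s α ∧ ∃ φ : ℕ → ℕ, StrictMono φ ∧
      WeakLim (fun n => eh (sc d s α) (u (φ n))) (eh (sc d s α) V) := by
  have hA := h.admissible
  have hq := h.two_lt_alphac
  have hB0 : 0 ≤ B := (norm_nonneg _).trans (hB 0)
  obtain ⟨C, hC, hS⟩ := exists_sobolev h.hd h.sc_pos (h.sc_lt.trans h.hs1) h.two_sc_lt
  have hip : ∀ n, ip (alphac d s α) (u n) ≤ C * B ^ alphac d s α := fun n => by
    refine (hS (u n) (hu n).1 (hu n).2.1).2.trans ?_
    have := Real.rpow_le_rpow (norm_nonneg _) (hB n) h.alphac_pos.le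
    exact mul_le_mul_of_nonneg_left this hC
  obtain ⟨φ, W, hφ, h1, h2, h3, -, h5, -⟩ := exists_extraction hA.hd hA.hs0 hA.hs1 hA.hq.le
    (fun n => (inX_of_sob h (hu n)).memLp) (fun n => (hu n).2.2) hip hB'
  obtain ⟨φ', G, hφ', hG⟩ := exists_weakLim_subseq (u := fun n => eh (sc d s α) (u (φ n)))
    (fun n => hB _)
  have hVW := hV.ae_eq_of_eh_eq hA ⟨h1, h2⟩ ((hlim.comp hφ).unique h3)
  choose k hk using fun n => (hu n).1
  have hq1 : 1 ≤ ENNReal.ofReal (alphac d s α) := hA.one_lt_ofReal.le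
  obtain ⟨h6, h7, h8⟩ := hasFourierOn_of_weakLim h.hd (T := Set.univ) (Set.subset_univ _)
    (fun φ _ => memLp_sym_neg_mul_schwartz h.hd h.sc_pos.le h.two_sc_lt φ)
    (fun n => hk (φ (φ' n))) (fun n => (hu _).2.1) h1.1
    (fun ψ => MemLp.integrable_mul_schwartz hq1 h1 ψ)
    (fun ψ => (h5 ψ).comp hφ'.tendsto_atTop) hG
  have hVW' : W =ᵐ[volume] V := hVW.symm
  refine ⟨⟨⟨_, h6.congr hVW' EventuallyEq.rfl⟩, by rwa [← hdotNorm_congr hVW'], hV.fin⟩,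
    φ ∘ φ', hφ.comp hφ', ?_⟩
  rw [← eh_congr h.hd h7 hVW', h8]
  exact hG

theorem sob_testDir (h : Params d s α) (ψ : 𝓢(Eu d, ℂ)) : testDir ψ ∈ sobSpace d s α :=
  ⟨⟨_, hasFourierOn_testDir ψ⟩,
    hdotNorm_testDir h.hd h.sc_pos.le (h.sc_lt.trans h.hs1).le ψ,
    hdotNorm_testDir h.hd h.hs0.le h.hs1.le ψ⟩

/-- The problem for `‖f‖_p^p / (‖f‖_{Ḣ^{s_c}}^α ‖f‖_{Ḣ^s}²)`. -/
theorem sobolevProblem (h : Params d s α) :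
    WeinsteinProblem d s (alphac d s α) (sobSpace d s α) (fun f => ‖eh (sc d s α) f‖ ^ 2) (α / 2)
      2 (2 * sc d s α - d) := by
  have hA := h.admissible
  have hd := h.d_pos
  have hα := h.α_pos
  have hq := h.two_lt_alphac
  obtain ⟨C, hC, hS⟩ := exists_sobolev h.hd h.sc_pos (h.sc_lt.trans h.hs1) h.two_sc_lt
  have hS' : ∀ f ∈ sobSpace d s α,
      ip (alphac d s α) f ≤ C * ‖eh (sc d s α) f‖ ^ alphac d s α :=
    fun f hf => (hS f hf.1 hf.2.1).2
  refine ⟨hA, fun f hf => inX_of_sob h hf, fun f => by positivity, ?_, ?_, ?_, ?_,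
    ⟨C, fun f hf hb => ?_⟩, ?_, ?_, by positivity, ?_, ?_, ?_⟩
  · obtain ⟨C', hC', hgn⟩ := exists_gagliardo_nirenberg hA.hd hA.hs0 hA.hs1
      (by linarith : 1 < alphac d s α)
    refine ⟨C' * C ^ (2 * s / d), by positivity, fun f hf => ?_⟩
    have h2s : 0 ≤ 2 * s / d := div_nonneg (by linarith [h.hs0]) hd.le
    have h1 := Real.rpow_le_rpow (ip_nonneg _ _) (hS' f hf) h2s
    rw [Real.mul_rpow hC (by positivity), ← Real.rpow_mul (norm_nonneg _), h.alphac_mul] at h1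
    have h2 : (‖eh (sc d s α) f‖ ^ 2) ^ (α / 2) = ‖eh (sc d s α) f‖ ^ α := by
      rw [← Real.rpow_natCast, ← Real.rpow_mul (norm_nonneg _)]
      congr 1; push_cast; ring
    refine (hgn f (inX_of_sob h hf).memLp hf.2.2).2.trans ?_
    beta_reduce
    rw [h2]
    calc _ ≤ C' * (C ^ (2 * s / d) * ‖eh (sc d s α) f‖ ^ α) * ‖eh s f‖ ^ 2 := by gcongr
      _ = _ := by ring
  · intro f hf h0
    refine ae_eq_zero_of_eh_eq_zero (γ := sc d s α) hA.one_lt_ofReal ENNReal.ofReal_ne_top h.hd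
      (inX_of_sob h hf).memLp hf.2.1 ?_
    exact norm_eq_zero.mp (pow_eq_zero_iff two_ne_zero |>.mp h0)
  · intro f hf κ μ hκ hμ
    obtain ⟨k, hk⟩ := hf.1
    exact ⟨⟨⟨_, hasFourierOn_scl hμ (fun _ _ => Set.mem_univ _) hk⟩,
      (hdotNorm_scl hA.hd hκ hμ hf.2.1).1, (hdotNorm_scl hA.hd hκ hμ hf.2.2).1⟩,
      (hdotNorm_scl hA.hd hκ hμ hf.2.1).2⟩
  · intro f hf y
    obtain ⟨k, hk⟩ := hf.1
    refine ⟨⟨⟨_, hk.translate y fun _ _ => Set.mem_univ _⟩, ?_, ?_⟩, ?_⟩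
    · rw [hdotNorm_translate h.hd hf.2.1]; exact hf.2.1
    · rw [hdotNorm_translate h.hd hf.2.2]; exact hf.2.2
    · beta_reduce
      rw [eh_translate h.hd hf.2.1, norm_chrL2]
  · refine (hS' f hf).trans (mul_le_of_le_one_right hC (Real.rpow_le_one (norm_nonneg _) ?_
      h.alphac_pos.le))
    exact (sq_le_one_iff₀ (norm_nonneg _)).mp hb
  · intro u V hu hb ha hV hlim
    have hb' : ∀ n, ‖eh (sc d s α) (u n)‖ ≤ 1 := fun n =>
      (sq_le_one_iff₀ (norm_nonneg _)).mp (hb n)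
    obtain ⟨h1, φ, -, h2⟩ := sob_of_weakLim h hu hb' ha hV hlim
    exact ⟨h1, (sq_le_one_iff₀ (norm_nonneg _)).mpr (h2.norm_le_of_bound fun n => hb' _)⟩
  · obtain ⟨ψ, hψ⟩ := exists_testDir_ne_zero (d := d)
    exact ⟨_, sob_testDir h ψ, hψ⟩
  · rw [h.pexp_alphac]; ring
  · rw [sc]; field_simp; ring
  · have := h.sc_lt
    intro h0
    linarith

end

/-! ### The Euler–Lagrange equation -/

/-- The pairing of `|f|^β f` with `𝓕 ψ`. -/
def nonl (β : ℝ) (f : Eu d → ℂ) (ψ : 𝓢(Eu d, ℂ)) : ℂ :=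
  ∫ x, ((‖f x‖ ^ β : ℝ) : ℂ) * f x * (𝓕 ψ) x

theorem nonl_smul (β : ℝ) (f : Eu d → ℂ) (c : ℂ) (ψ : 𝓢(Eu d, ℂ)) :
    nonl β f (c • ψ) = c * nonl β f ψ := by
  rw [nonl, nonl, ← integral_const_mul]
  refine integral_congr_ae (Eventually.of_forall fun x => ?_)
  simp only [FourierTransform.fourier_smul, smul_apply, smul_eq_mul]
  ring

theorem pairS_smul (γ : ℝ) (f : Eu d → ℂ) (c : ℂ) (ψ : 𝓢(Eu d, ℂ)) :
    pairS γ f (c • ψ) = c * pairS γ f ψ := by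
  rw [pairS, pairS, ← integral_const_mul]
  refine integral_congr_ae (Eventually.of_forall fun x => ?_)
  simp only [smul_apply, smul_eq_mul]
  ring

/-- `ρ Re (B' f ψ)` is the derivative of `b` at `f` in the direction `testDir ψ`. The factor `ρ` is
split off so that `B' f ψ` is the corresponding term of the equation; complex homogeneity in `ψ`
allows its imaginary part to be recovered. -/
structure IsGradient (Y : Set (Eu d → ℂ)) (b : (Eu d → ℂ) → ℝ) (ρ : ℝ)
    (B' : (Eu d → ℂ) → 𝓢(Eu d, ℂ) → ℂ) : Prop where
  add_mem : ∀ f ∈ Y, ∀ (ψ : 𝓢(Eu d, ℂ)) (t : ℝ), f + (t : ℂ) • testDir ψ ∈ Y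
  deriv : ∀ f ∈ Y, ∀ ψ : 𝓢(Eu d, ℂ),
    HasDerivAt (fun t : ℝ => b (f + (t : ℂ) • testDir ψ)) (ρ * (B' f ψ).re) 0
  map_smul : ∀ f (c : ℂ) ψ, B' f (c • ψ) = c * B' f ψ

theorem hasDerivAt_ip_testDir {p : ℝ} (hp : 2 < p) {f : Eu d → ℂ}
    (hf : MemLp f (ENNReal.ofReal p) volume) (ψ : 𝓢(Eu d, ℂ)) :
    Integrable (fun x => ((‖f x‖ ^ (p - 2) : ℝ) : ℂ) * f x * (𝓕 ψ) x) ∧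
    HasDerivAt (fun t : ℝ => ip p (f + (t : ℂ) • testDir ψ)) (p * (nonl (p - 2) f ψ).re) 0 := by
  have h := hasDerivAt_ip hp hf (memLp_testDir ψ _)
  simpa only [testDir, Complex.conj_conj, nonl] using h

theorem hasDerivAt_eh_testDir (hd : 0 < d) {γ : ℝ} (hγ0 : 0 ≤ γ) (hγ1 : γ ≤ 1) {f : Eu d → ℂ}
    (hf : hdotNorm γ f < ∞) (ψ : 𝓢(Eu d, ℂ)) :
    HasDerivAt (fun t : ℝ => ‖eh γ (f + (t : ℂ) • testDir ψ)‖ ^ 2) (2 * (pairS γ f ψ).re) 0 := by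
  have hψ := hdotNorm_testDir hd hγ0 hγ1 ψ
  have h := hasDerivAt_norm_sq_add_smul (eh γ f) (eh γ (testDir ψ))
  rw [(inner_eh_testDir hd hγ0 hγ1 ψ hf).1] at h
  refine h.congr_of_eventuallyEq (Eventually.of_forall fun t => ?_)
  beta_reduce
  rw [eh_add hd hf (hdotNorm_smul_lt_top hd _ hψ), eh_smul hd _ hψ]

namespace WeinsteinProblem
variable {s q θ e m α ρ : ℝ} {Y : Set (Eu d → ℂ)} {b : (Eu d → ℂ) → ℝ}
  {B' : (Eu d → ℂ) → 𝓢(Eu d, ℂ) → ℂ}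

/-- The Euler–Lagrange equation of a maximizer `V`: the first-order condition in the directions
`testDir ψ` and `testDir (i ψ)`. -/
theorem euler_lagrange (W : WeinsteinProblem d s q Y b θ e m) (G : IsGradient Y b ρ B')
    (hρ : θ * ρ = α) (hp : pexp d s q = α + 2) {C : ℝ}
    (hle : ∀ f ∈ Y, ip (α + 2) f ≤ C * (b f ^ θ * ‖eh s f‖ ^ 2)) {V : Eu d → ℂ} (hV : V ∈ Y)
    (hV0 : ¬ V =ᵐ[volume] 0) (hVN : ip (α + 2) V = C * (b V ^ θ * ‖eh s V‖ ^ 2))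
    (ψ : 𝓢(Eu d, ℂ)) :
    ((α + 2 : ℝ) : ℂ) * nonl α V ψ = (ip (α + 2) V : ℂ) *
      ((α / b V : ℝ) * B' V ψ + (2 / ‖eh s V‖ ^ 2 : ℝ) * pairS s V ψ) := by
  have hA := W.adm
  obtain ⟨hb0, ha0, -⟩ := W.pos hV hV0
  have hX := W.inX V hV
  have hXp := hX.memLp_pexp hA
  have hp2 : 2 < α + 2 := by rw [← hp]; linarith [hA.hq, hA.q_lt_pexp]
  rw [hp] at hXp
  have hreal : ∀ ψ : 𝓢(Eu d, ℂ), (((α + 2 : ℝ) : ℂ) * nonl α V ψ - (ip (α + 2) V : ℂ) *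
      ((α / b V : ℝ) * B' V ψ + (2 / ‖eh s V‖ ^ 2 : ℝ) * pairS s V ψ)).re = 0 := fun ψ => by
    have h1 := first_order_condition (hasDerivAt_ip_testDir hp2 hXp ψ).2
      (hasDerivAt_eh_testDir hA.hd hA.hs0.le hA.hs1.le hX.fin ψ) (G.deriv V hV ψ)
      (by simpa using hb0) (by simpa using ha0) (fun t => hle _ (G.add_mem V hV ψ t))
      (by simpa using hVN)
    simp only [Complex.ofReal_zero, zero_smul, add_zero, add_sub_cancel_right] at h1
    rw [Complex.sub_re, Complex.re_ofReal_mul, Complex.re_ofReal_mul, Complex.add_re,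
      Complex.re_ofReal_mul, Complex.re_ofReal_mul, h1, ← hρ]
    field_simp
    ring
  have h1 := hreal ψ
  have h2 := hreal (Complex.I • ψ)
  rw [nonl_smul, G.map_smul, pairS_smul] at h2
  rw [← sub_eq_zero]
  refine Complex.ext h1 ?_
  rw [Complex.zero_im, ← neg_eq_zero, ← Complex.I_mul_re, ← h2]
  congr 1
  ring

/-- Ground states exist, and `b` takes the same value at all of them. A maximizer whose norms
satisfy `b^θ = (α + 2) / (2 C)` and `α ‖V‖_{Ḣ^s}² = 2 b` has the Euler–Lagrange equation
`(-Δ)^s V + B' V = |V|^α V`. Conversely, the equation and the Euler–Lagrange equation of a ground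
state have proportional coefficients, as the terms are independent by `hind`; the coefficient of
`(-Δ)^s V` yields the value of `b^θ`. -/
theorem exists_groundState (W : WeinsteinProblem d s q Y b θ e m) (G : IsGradient Y b ρ B')
    (hρ : θ * ρ = α) (hα : 0 < α) (hp : pexp d s q = α + 2)
    (hind : ∀ V ∈ Y, ¬ V =ᵐ[volume] 0 → (∀ ψ, pairS s V ψ + B' V ψ - nonl α V ψ = 0) →
      ∀ lam ν : ℝ, (∀ ψ, (lam : ℂ) * pairS s V ψ + (ν : ℂ) * B' V ψ = 0) → lam = 0 ∧ ν = 0) :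
    ∃ C : ℝ, 0 < C ∧ (∀ f ∈ Y, ip (α + 2) f ≤ C * (b f ^ θ * ‖eh s f‖ ^ 2)) ∧
      (∃ V ∈ Y, ¬ V =ᵐ[volume] 0 ∧ ip (α + 2) V = C * (b V ^ θ * ‖eh s V‖ ^ 2) ∧
        ∀ ψ, pairS s V ψ + B' V ψ - nonl α V ψ = 0) ∧
      ∀ V ∈ Y, ¬ V =ᵐ[volume] 0 → ip (α + 2) V = C * (b V ^ θ * ‖eh s V‖ ^ 2) →
        (∀ ψ, pairS s V ψ + B' V ψ - nonl α V ψ = 0) → b V ^ θ = (α + 2) / (2 * C) := by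
  obtain ⟨C, hC, hle, hex⟩ := W.exists_maximizer
  rw [hp] at hle hex
  refine ⟨C, hC, hle, ?_, ?_⟩
  -- normalisation of the maximizer: `b V = β` and `‖V‖_{Ḣ^s}² = 2 β / α`
  · set β : ℝ := ((α + 2) / (2 * C)) ^ (1 / θ) with hβ
    have hβ0 : 0 < β := by positivity
    obtain ⟨V, hV, hV0, hVN, hVb, hVa⟩ := hex (2 * β / α) β (by positivity) hβ0
    refine ⟨V, hV, hV0, hVN, fun ψ => ?_⟩
    have hEL := W.euler_lagrange G hρ hp hle hV hV0 hVN ψ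
    have hβθ : β ^ θ = (α + 2) / (2 * C) := by
      rw [hβ, ← Real.rpow_mul (by positivity), one_div_mul_cancel W.θ_pos.ne', Real.rpow_one]
    rw [hVb, hVa, hβθ] at hVN
    have hN : ip (α + 2) V = (α + 2) * (β / α) := by
      rw [hVN]; field_simp
    have h1 : ip (α + 2) V * (α / β) = α + 2 := by rw [hN]; field_simp
    have h2 : ip (α + 2) V * (2 / (2 * β / α)) = α + 2 := by rw [hN]; field_simp
    rw [hVb, hVa, mul_add, ← mul_assoc, ← mul_assoc, ← Complex.ofReal_mul, ← Complex.ofReal_mul,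
      h1, h2, ← mul_add] at hEL
    have h3 : ((α + 2 : ℝ) : ℂ) ≠ 0 := by exact_mod_cast (by linarith : α + 2 ≠ 0)
    have h4 := mul_left_cancel₀ h3 hEL
    rw [h4]; ring
  · intro V hV hV0 hVN hsol
    obtain ⟨hb0, ha0, hN0⟩ := W.pos hV hV0
    rw [hp] at hN0
    have hlin := hind V hV hV0 hsol (ip (α + 2) V * (2 / ‖eh s V‖ ^ 2) - (α + 2))
      (ip (α + 2) V * (α / b V) - (α + 2)) fun ψ => by
        have hEL := W.euler_lagrange G hρ hp hle hV hV0 hVN ψ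
        have h1 := hsol ψ
        push_cast at hEL ⊢
        linear_combination (-1 : ℂ) * hEL - ((α : ℂ) + 2) * h1
    have h1 := hlin.1
    have h2 : ip (α + 2) V * 2 = (α + 2) * ‖eh s V‖ ^ 2 := by
      rwa [mul_div_assoc', sub_eq_zero, div_eq_iff ha0.ne'] at h1
    rw [eq_div_iff (by positivity)]
    have h3 : (b V ^ θ * (2 * C)) * ‖eh s V‖ ^ 2 = (α + 2) * ‖eh s V‖ ^ 2 := by
      rw [← h2, hVN]; ring
    exact mul_right_cancel₀ ha0.ne' h3

end WeinsteinProblem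

/-! ### Independence of the terms of the equations -/

/-- Away from the origin, a nontrivial combination of two different powers of `|ξ|` vanishes at
most on a sphere. -/
theorem ae_combination_ne_zero (hd : 0 < d) {β₁ β₂ lam ν : ℝ} (hβ : β₁ ≠ β₂)
    (hne : ¬ (lam = 0 ∧ ν = 0)) :
    ∀ᵐ ξ : Eu d, lam * (2 * Real.pi * ‖ξ‖) ^ β₁ + ν * (2 * Real.pi * ‖ξ‖) ^ β₂ ≠ 0 := by
  by_cases hex : ∃ ξ₀ : Eu d, ξ₀ ≠ 0 ∧
      lam * (2 * Real.pi * ‖ξ₀‖) ^ β₁ + ν * (2 * Real.pi * ‖ξ₀‖) ^ β₂ = 0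
  · obtain ⟨ξ₀, h0, hξ₀⟩ := hex
    have : Nontrivial (Eu d) := ⟨ξ₀, 0, h0⟩
    have hsph : ∀ᵐ ξ : Eu d, ξ ∉ Metric.sphere (0 : Eu d) ‖ξ₀‖ :=
      measure_eq_zero_iff_ae_notMem.mp (Measure.addHaar_sphere volume (0 : Eu d) ‖ξ₀‖)
    filter_upwards [hsph, ae_ne_zero hd] with ξ h1 h2 h3
    refine h1 ?_
    have key : ∀ η : Eu d, η ≠ 0 →
        lam * (2 * Real.pi * ‖η‖) ^ β₁ + ν * (2 * Real.pi * ‖η‖) ^ β₂ = 0 →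
        lam ≠ 0 ∧ (2 * Real.pi * ‖η‖) ^ (β₁ - β₂) = -ν / lam := by
      intro η hη h
      have hpos : 0 < 2 * Real.pi * ‖η‖ := by
        have := norm_pos_iff.mpr hη
        positivity
      have hlam : lam ≠ 0 := by
        rintro rfl
        refine hne ⟨rfl, ?_⟩
        rw [zero_mul, zero_add] at h
        exact (mul_eq_zero.mp h).resolve_right (by positivity)
      refine ⟨hlam, ?_⟩
      rw [Real.rpow_sub hpos, div_eq_div_iff (by positivity) hlam]
      linarith
    have h4 := (key ξ h2 h3).2
    rw [← (key ξ₀ h0 hξ₀).2] at h4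
    have h5 := (Real.rpow_left_inj (by positivity) (by positivity) (sub_ne_zero.mpr hβ)).mp h4
    have h6 : ‖ξ‖ = ‖ξ₀‖ := mul_left_cancel₀ (by positivity) h5
    simpa using h6
  · push Not at hex
    filter_upwards [ae_ne_zero hd] with ξ hξ
    exact hex ξ hξ

theorem ft_not_ae_eq_zero {s q : ℝ} (hA : Admissible d s q) {V : Eu d → ℂ} (hV : InX s q V)
    (hV0 : ¬ V =ᵐ[volume] 0) : ¬ ft V =ᵐ[volume] 0 := by
  intro h
  refine hV0 (ae_eq_zero_of_eh_eq_zero hA.one_lt_ofReal ENNReal.ofReal_ne_top hA.hd hV.memLp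
    hV.fin (Lp.ext ?_))
  filter_upwards [coe_eh hA.hd hV.fin, h, Lp.coeFn_zero ℂ 2 (volume : Measure (Eu d))]
    with ξ h1 h2 h3
  rw [h1, h2, h3, Pi.zero_apply, mul_zero]

theorem ae_eq_zero_of_combination (hd : 0 < d) {β₁ β₂ lam ν : ℝ} (hβ : β₁ ≠ β₂)
    (hne : ¬ (lam = 0 ∧ ν = 0)) {k : Eu d → ℂ}
    (h : ∀ᵐ ξ, (lam : ℂ) * (sym β₁ ξ * k ξ) + (ν : ℂ) * (sym β₂ ξ * k ξ) = 0) :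
    k =ᵐ[volume] 0 := by
  filter_upwards [h, ae_combination_ne_zero hd hβ hne] with ξ h1 h2
  have h3 : ((lam * (2 * Real.pi * ‖ξ‖) ^ β₁ + ν * (2 * Real.pi * ‖ξ‖) ^ β₂ : ℝ) : ℂ) * k ξ = 0 := by
    rw [← h1, sym, sym]; push_cast; ring
  exact (mul_eq_zero.mp h3).resolve_left (by exact_mod_cast h2)

section
variable {s α : ℝ}

/-- `(-Δ)^s V` and `(-Δ)^{s_c} V` are linearly independent for `V ≠ 0`, as `s ≠ s_c`. -/
theorem sobolev_independent (h : Params d s α) {V : Eu d → ℂ} (hV : V ∈ sobSpace d s α)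
    (hV0 : ¬ V =ᵐ[volume] 0) {lam ν : ℝ}
    (hlin : ∀ ψ, (lam : ℂ) * pairS s V ψ + (ν : ℂ) * pairS (sc d s α) V ψ = 0) :
    lam = 0 ∧ ν = 0 := by
  by_contra hne
  have i1 := fun ψ => (inner_eh_testDir h.hd h.hs0.le h.hs1.le ψ hV.2.2).2
  have i2 := fun ψ => (inner_eh_testDir h.hd h.sc_pos.le (h.sc_lt.trans h.hs1).le ψ hV.2.1).2
  have heq : ∀ (φ : 𝓢(Eu d, ℂ)), (fun ξ => ((lam : ℂ) * (sym (2 * s) ξ * ft V ξ)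
      + (ν : ℂ) * (sym (2 * sc d s α) ξ * ft V ξ)) * φ ξ)
      = fun ξ => (lam : ℂ) * (sym (2 * s) ξ * ft V ξ * φ ξ)
        + (ν : ℂ) * (sym (2 * sc d s α) ξ * ft V ξ * φ ξ) := fun φ => by
    funext ξ; ring
  have hz := ae_eq_zero_on_of_forall_integral_mul_eq_zero isOpen_univ
    (k := fun ξ => (lam : ℂ) * (sym (2 * s) ξ * ft V ξ)
      + (ν : ℂ) * (sym (2 * sc d s α) ξ * ft V ξ))
    (fun φ _ => by
      simp only [heq]
      exact ((i1 φ).const_mul _).add ((i2 φ).const_mul _))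
    (fun φ _ => by
      simp only [heq]
      rw [integral_add ((i1 φ).const_mul _) ((i2 φ).const_mul _), integral_const_mul,
        integral_const_mul]
      exact hlin φ)
  refine ft_not_ae_eq_zero h.admissible (inX_of_sob h hV) hV0
    (ae_eq_zero_of_combination h.hd (β₁ := 2 * s) (β₂ := 2 * sc d s α) ?_ hne ?_)
  · have := h.sc_lt
    intro h0; linarith
  · filter_upwards [hz] with ξ hξ
    exact hξ trivial

/-- `(-Δ)^s V = c V` has no nonzero solution in `L^q ∩ Ḣ^s`: the Fourier transform would be
supported on a sphere. -/
theorem ae_eq_zero_of_pairS_eq (h : Params d s α) {V : Eu d → ℂ}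
    (hV : InX s (alphac d s α) V) {c : ℝ}
    (hc : ∀ ψ : 𝓢(Eu d, ℂ), pairS s V ψ = (c : ℂ) * ∫ x, V x * (𝓕 ψ) x) : V =ᵐ[volume] 0 := by
  by_contra hV0
  have hF := hasFourierAway_of_lt_top hV.fin
  have i1 := fun ψ => (inner_eh_testDir h.hd h.hs0.le h.hs1.le ψ hV.fin).2
  have heq : ∀ (φ : 𝓢(Eu d, ℂ)), (fun ξ => (((1 : ℝ) : ℂ) * (sym (2 * s) ξ * ft V ξ)
      + ((-c : ℝ) : ℂ) * (sym 0 ξ * ft V ξ)) * φ ξ)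
      = fun ξ => sym (2 * s) ξ * ft V ξ * φ ξ - (c : ℂ) * (ft V ξ * φ ξ) := fun φ => by
    funext ξ; simp only [sym, Real.rpow_zero]; push_cast; ring
  have hU : IsOpen ({0}ᶜ : Set (Eu d)) := isOpen_compl_singleton
  have hflat : ∀ φ : 𝓢(Eu d, ℂ), tsupport φ ⊆ ({0}ᶜ : Set (Eu d)) → φ ∈ flatSchwartz d :=
    fun φ hφ => flat_of_tsupport fun h0 => hφ h0 rfl
  have hz := ae_eq_zero_on_of_forall_integral_mul_eq_zero hU
    (k := fun ξ => ((1 : ℝ) : ℂ) * (sym (2 * s) ξ * ft V ξ)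
      + ((-c : ℝ) : ℂ) * (sym 0 ξ * ft V ξ))
    (fun φ hφ => by
      simp only [heq]
      exact (i1 φ).sub ((hF.integrable φ (hflat φ hφ)).const_mul _))
    (fun φ hφ => by
      simp only [heq]
      rw [integral_sub (i1 φ) ((hF.integrable φ (hflat φ hφ)).const_mul _), integral_const_mul,
        ← hF.pairing φ (hflat φ hφ), sub_eq_zero]
      exact hc φ)
  refine ft_not_ae_eq_zero h.admissible hV hV0
    (ae_eq_zero_of_combination h.hd (β₁ := 2 * s) (β₂ := 0) (lam := 1) (ν := -c) ?_ ?_ ?_)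
  · linarith [h.hs0]
  · simp
  · filter_upwards [hz, ae_ne_zero h.hd] with ξ hξ h0
    exact hξ h0

/-- `(-Δ)^s V` and `|V|^{q-2} V` are linearly independent for a nonzero solution `V` of the
equation. A relation with a nonzero coefficient of `(-Δ)^s V` would make `|V|^α V` a multiple of
`|V|^{q-2} V`; then `|V|` is constant where it is not zero, and `(-Δ)^s V` is a multiple of `V`. -/
theorem lebesgue_independent (h : Params d s α) {V : Eu d → ℂ}
    (hV : InX s (alphac d s α) V) (hV0 : ¬ V =ᵐ[volume] 0)
    (hsol : ∀ ψ, pairS s V ψ + nonl (alphac d s α - 2) V ψ - nonl α V ψ = 0) {lam ν : ℝ}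
    (hlin : ∀ ψ, (lam : ℂ) * pairS s V ψ + (ν : ℂ) * nonl (alphac d s α - 2) V ψ = 0) :
    lam = 0 ∧ ν = 0 := by
  have hA := h.admissible
  have hq2 := h.two_lt_alphac
  have hqp := hA.q_lt_pexp
  rw [h.pexp_alphac] at hqp
  have hVp := hV.memLp_pexp hA
  rw [h.pexp_alphac] at hVp
  set q := alphac d s α with hq
  -- integrability against all Schwartz functions, as each of them is a Fourier transform
  have iq : ∀ φ : 𝓢(Eu d, ℂ), Integrable (fun x => ((‖V x‖ ^ (q - 2) : ℝ) : ℂ) * V x * φ x) :=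
    fun φ => by
      have := (hasDerivAt_ip_testDir hq2 hV.memLp (𝓕⁻ φ)).1
      simpa only [FourierTransform.fourier_fourierInv_eq] using this
  have ip' : ∀ φ : 𝓢(Eu d, ℂ), Integrable (fun x => ((‖V x‖ ^ α : ℝ) : ℂ) * V x * φ x) :=
    fun φ => by
      have := (hasDerivAt_ip_testDir (p := α + 2) (by linarith) hVp (𝓕⁻ φ)).1
      simpa only [FourierTransform.fourier_fourierInv_eq, add_sub_cancel_right] using this
  by_cases hlam : lam = 0
  · refine ⟨hlam, ?_⟩
    by_contra hν
    have h1 : (fun x => ((‖V x‖ ^ (q - 2) : ℝ) : ℂ) * V x) =ᵐ[volume] 0 := by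
      refine ae_eq_zero_of_integral_mul_fourier iq fun ψ => ?_
      have := hlin ψ
      rw [hlam, Complex.ofReal_zero, zero_mul, zero_add] at this
      exact (mul_eq_zero.mp this).resolve_left (by exact_mod_cast hν)
    refine hV0 ?_
    filter_upwards [h1] with x hx
    by_contra hx0
    have : 0 < ‖V x‖ := norm_pos_iff.mpr hx0
    rcases mul_eq_zero.mp hx with h2 | h2
    · have h3 : ‖V x‖ ^ (q - 2) = 0 := by exact_mod_cast h2
      have : 0 < ‖V x‖ ^ (q - 2) := by positivity
      linarith
    · exact hx0 h2
  · exfalso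
    -- `(-Δ)^s V = c |V|^{q-2} V`
    set c : ℝ := -ν / lam with hc
    have hlam' : (lam : ℂ) ≠ 0 := by exact_mod_cast hlam
    have hA' : ∀ ψ, pairS s V ψ = (c : ℂ) * nonl (q - 2) V ψ := fun ψ => by
      have := hlin ψ
      rw [hc]; push_cast
      field_simp
      linear_combination this
    -- comparison with the equation shows that `|V|` is constant where `V ≠ 0`
    have h1 : (fun x => ((c + 1 : ℝ) : ℂ) * (((‖V x‖ ^ (q - 2) : ℝ) : ℂ) * V x)
        - ((‖V x‖ ^ α : ℝ) : ℂ) * V x) =ᵐ[volume] 0 := by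
      have heq : ∀ φ : 𝓢(Eu d, ℂ), (fun x => (((c + 1 : ℝ) : ℂ) * (((‖V x‖ ^ (q - 2) : ℝ) : ℂ) * V x)
          - ((‖V x‖ ^ α : ℝ) : ℂ) * V x) * φ x)
          = fun x => ((c + 1 : ℝ) : ℂ) * (((‖V x‖ ^ (q - 2) : ℝ) : ℂ) * V x * φ x)
            - ((‖V x‖ ^ α : ℝ) : ℂ) * V x * φ x := fun φ => by
        funext x; ring
      refine ae_eq_zero_of_integral_mul_fourier (fun φ => ?_) fun ψ => ?_
      · simp only [heq]
        exact ((iq φ).const_mul _).sub (ip' φ)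
      · simp only [heq]
        rw [integral_sub ((iq _).const_mul _) (ip' _), integral_const_mul]
        have h2 := hsol ψ
        rw [hA' ψ] at h2
        change ((c + 1 : ℝ) : ℂ) * nonl (q - 2) V ψ - nonl α V ψ = 0
        push_cast
        linear_combination h2
    set k : ℝ := (c + 1) ^ (1 / (α - (q - 2))) with hk
    have h2 : ∀ᵐ x, ((‖V x‖ ^ (q - 2) : ℝ) : ℂ) * V x = ((k ^ (q - 2) : ℝ) : ℂ) * V x := by
      filter_upwards [h1] with x hx
      by_cases hx0 : V x = 0
      · rw [hx0, mul_zero, mul_zero]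
      · have hpos : 0 < ‖V x‖ := norm_pos_iff.mpr hx0
        have h3 : (((c + 1) * ‖V x‖ ^ (q - 2) - ‖V x‖ ^ α : ℝ) : ℂ) * V x = 0 := by
          push_cast
          have : ((c + 1 : ℝ) : ℂ) * (((‖V x‖ ^ (q - 2) : ℝ) : ℂ) * V x)
            - ((‖V x‖ ^ α : ℝ) : ℂ) * V x = 0 := hx
          push_cast at this
          linear_combination this
        have h4 : (c + 1) * ‖V x‖ ^ (q - 2) - ‖V x‖ ^ α = 0 := by
          exact_mod_cast (mul_eq_zero.mp h3).resolve_right hx0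
        have h5 : ‖V x‖ ^ (α - (q - 2)) = c + 1 := by
          rw [Real.rpow_sub hpos, div_eq_iff (by positivity)]
          linarith
        have h6 : ‖V x‖ = k := by
          rw [hk, ← h5, ← Real.rpow_mul hpos.le, mul_one_div_cancel (by linarith), Real.rpow_one]
        rw [h6]
    refine hV0 (ae_eq_zero_of_pairS_eq h hV (c := c * k ^ (q - 2)) fun ψ => ?_)
    rw [hA' ψ, nonl, Complex.ofReal_mul, mul_assoc]
    congr 1
    rw [← integral_const_mul]
    refine integral_congr_ae ?_
    filter_upwards [h2] with x hx
    rw [hx, mul_assoc]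

end

/-! ### Ground states -/

section
variable {s α : ℝ}

theorem sobolevGradient (h : Params d s α) :
    IsGradient (sobSpace d s α) (fun f => ‖eh (sc d s α) f‖ ^ 2) 2 (pairS (sc d s α)) := by
  refine ⟨fun f hf ψ t => ?_, fun f hf ψ => ?_, fun f c ψ => pairS_smul _ f c ψ⟩
  · have hψ := sob_testDir h ψ
    obtain ⟨k, hk⟩ := hf.1
    exact ⟨⟨_, hk.add ((hasFourierOn_testDir ψ).smul (t : ℂ))⟩,
      hdotNorm_add_lt_top h.hd hf.2.1 (hdotNorm_smul_lt_top h.hd _ hψ.2.1),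
      hdotNorm_add_lt_top h.hd hf.2.2 (hdotNorm_smul_lt_top h.hd _ hψ.2.2)⟩
  · exact hasDerivAt_eh_testDir h.hd h.sc_pos.le (h.sc_lt.trans h.hs1).le hf.2.1 ψ

theorem lebesgueGradient (h : Params d s α) :
    IsGradient (lebSpace d s α) (ip (alphac d s α)) (alphac d s α) (nonl (alphac d s α - 2)) := by
  refine ⟨fun f hf ψ t => ?_, fun f hf ψ => ?_, fun f c ψ => nonl_smul _ f c ψ⟩
  · have hψ := inX_testDir h.admissible ψ
    exact ⟨hf.1.add (hψ.memLp.const_smul _),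
      hdotNorm_add_lt_top h.hd hf.2 (hdotNorm_smul_lt_top h.hd _ hψ.fin)⟩
  · exact (hasDerivAt_ip_testDir h.two_lt_alphac hf.1 ψ).2

theorem solvesSobolevEq_iff (hd : 0 < d) {Q : Eu d → ℂ} (hQ : hdotNorm s Q < ∞) :
    SolvesSobolevEq d s α Q ↔
      ∀ ψ, pairS s Q ψ + pairS (sc d s α) Q ψ - nonl α Q ψ = 0 := by
  constructor
  · rintro ⟨k, hk, hsol⟩ ψ
    rw [← hsol ψ]
    congr 2
    all_goals
      refine integral_congr_ae ?_
      filter_upwards [ft_ae_eq hd hk] with ξ hξ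
      rw [hξ]; rfl
  · exact fun hsol => ⟨_, hasFourierAway_of_lt_top hQ, hsol⟩

theorem solvesLebesgueEq_iff (hd : 0 < d) {Q : Eu d → ℂ} (hQ : hdotNorm s Q < ∞) :
    SolvesLebesgueEq d s α Q ↔
      ∀ ψ, pairS s Q ψ + nonl (alphac d s α - 2) Q ψ - nonl α Q ψ = 0 := by
  constructor
  · rintro ⟨k, hk, hsol⟩ ψ
    rw [← hsol ψ]
    congr 2
    refine integral_congr_ae ?_
    filter_upwards [ft_ae_eq hd hk] with ξ hξ
    rw [hξ]; rfl
  · exact fun hsol => ⟨_, hasFourierAway_of_lt_top hQ, hsol⟩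

/-- A function maximizes the quotient (in any extended-real form `F` of it) if and only if it
attains the optimal constant. -/
theorem WeinsteinProblem.maximizer_iff {q θ e m C : ℝ} {Y : Set (Eu d → ℂ)} {b : (Eu d → ℂ) → ℝ}
    (W : WeinsteinProblem d s q Y b θ e m)
    (hle : ∀ f ∈ Y, ip (α + 2) f ≤ C * (b f ^ θ * ‖eh s f‖ ^ 2))
    (hex : ∃ V ∈ Y, ¬ V =ᵐ[volume] 0 ∧ ip (α + 2) V = C * (b V ^ θ * ‖eh s V‖ ^ 2))
    {F : (Eu d → ℂ) → ℝ≥0∞} (hF : ∀ f ∈ Y, ¬ f =ᵐ[volume] 0 →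
      F f = ENNReal.ofReal (ip (α + 2) f / (b f ^ θ * ‖eh s f‖ ^ 2)))
    {g : Eu d → ℂ} (hg : g ∈ Y) (hg0 : ¬ g =ᵐ[volume] 0) :
    (∀ f ∈ Y, ¬ f =ᵐ[volume] 0 → F f ≤ F g) ↔
      ip (α + 2) g = C * (b g ^ θ * ‖eh s g‖ ^ 2) := by
  have hden : ∀ f ∈ Y, ¬ f =ᵐ[volume] 0 → 0 < b f ^ θ * ‖eh s f‖ ^ 2 := fun f hf hf0 => by
    obtain ⟨h1, h2, -⟩ := W.pos hf hf0
    positivity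
  constructor
  · intro hmax
    obtain ⟨V, hV, hV0, hVN⟩ := hex
    refine le_antisymm (hle g hg) ?_
    have h1 := hmax V hV hV0
    rw [hF V hV hV0, hF g hg hg0, hVN, mul_div_cancel_right₀ _ (hden V hV hV0).ne',
      ENNReal.ofReal_le_ofReal_iff (div_nonneg (ip_nonneg _ _) (hden g hg hg0).le),
      le_div_iff₀ (hden g hg hg0)] at h1
    exact h1
  · intro hgN f hf hf0
    rw [hF f hf hf0, hF g hg hg0, hgN, mul_div_cancel_right₀ _ (hden g hg hg0).ne']
    refine ENNReal.ofReal_le_ofReal ?_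
    rw [div_le_iff₀ (hden f hf hf0)]
    exact hle f hf

theorem hdotNorm_rpow_eq (hd : 0 < d) {γ β : ℝ} (hβ : 0 ≤ β) {f : Eu d → ℂ}
    (hf : hdotNorm γ f < ∞) : hdotNorm γ f ^ β = ENNReal.ofReal ((‖eh γ f‖ ^ 2) ^ (β / 2)) := by
  rw [hdotNorm_eq_norm_eh hd hf, ENNReal.ofReal_rpow_of_nonneg (norm_nonneg _) hβ]
  congr 1
  rw [← Real.rpow_natCast, ← Real.rpow_mul (norm_nonneg _)]
  congr 1; push_cast; ring

theorem lebNorm_rpow_eq {q β : ℝ} (hq : 0 < q) (hβ : 0 ≤ β) {f : Eu d → ℂ}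
    (hf : MemLp f (ENNReal.ofReal q) volume) :
    lebNorm q f ^ β = ENNReal.ofReal (ip q f ^ (β / q)) := by
  have := ip_nonneg q f
  rw [lebNorm_eq hq hf, ENNReal.ofReal_rpow_of_nonneg (by positivity) hβ,
    ← Real.rpow_mul (ip_nonneg _ _)]
  congr 2; ring

theorem weinsteinH_eq (h : Params d s α) {f : Eu d → ℂ} (hf : f ∈ sobSpace d s α)
    (hf0 : ¬ f =ᵐ[volume] 0) :
    weinsteinH d s α f = ENNReal.ofReal
      (ip (α + 2) f / ((‖eh (sc d s α) f‖ ^ 2) ^ (α / 2) * ‖eh s f‖ ^ 2)) := by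
  have hα := h.α_pos
  have hX := (inX_of_sob h hf).memLp_pexp h.admissible
  rw [h.pexp_alphac] at hX
  obtain ⟨h1, h2, -⟩ := (sobolevProblem h).pos hf hf0
  rw [weinsteinH, lebNorm_rpow (by linarith) hX, hdotNorm_rpow_eq h.hd hα.le hf.2.1,
    hdotNorm_eq_norm_eh h.hd hf.2.2, ← ENNReal.ofReal_pow (norm_nonneg _),
    ← ENNReal.ofReal_mul (by positivity), ← ENNReal.ofReal_div_of_pos]
  beta_reduce at h1
  positivity

theorem weinsteinK_eq (h : Params d s α) {f : Eu d → ℂ} (hf : f ∈ lebSpace d s α)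
    (hf0 : ¬ f =ᵐ[volume] 0) :
    weinsteinK d s α f = ENNReal.ofReal
      (ip (α + 2) f / (ip (alphac d s α) f ^ (2 * s / d) * ‖eh s f‖ ^ 2)) := by
  have hα := h.α_pos
  have hX := (inX_iff.mp hf).memLp_pexp h.admissible
  rw [h.pexp_alphac] at hX
  obtain ⟨h1, h2, -⟩ := (lebesgueProblem h).pos hf hf0
  have hdiv : α / alphac d s α = 2 * s / d := by
    rw [div_eq_iff h.alphac_pos.ne', mul_comm, h.alphac_mul]
  rw [weinsteinK, lebNorm_rpow (by linarith) hX, lebNorm_rpow_eq h.alphac_pos hα.le hf.1, hdiv,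
    hdotNorm_eq_norm_eh h.hd hf.2, ← ENNReal.ofReal_pow (norm_nonneg _),
    ← ENNReal.ofReal_mul (by have := ip_nonneg (alphac d s α) f; positivity),
    ← ENNReal.ofReal_div_of_pos]
  positivity

/-- The common norm `S_gs` of the Sobolev ground states and the optimal constant `C` of the
Gagliardo–Nirenberg inequality, related by `S_gs^α = (α + 2) / (2 C)`. -/
theorem exists_isSgs (h : Params d s α) : ∃ C S : ℝ, 0 < C ∧ IsSgs d s α S ∧
    S ^ α = (α + 2) / (2 * C) ∧ ∀ f ∈ sobSpace d s α,
      ip (α + 2) f ≤ C * (‖eh (sc d s α) f‖ ^ α * ‖eh s f‖ ^ 2) := by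
  have hα := h.α_pos
  have W := sobolevProblem h
  obtain ⟨C, hC, hle, ⟨V, hV, hV0, hVN, hVs⟩, huniq⟩ := W.exists_groundState (sobolevGradient h)
    (by ring) hα h.pexp_alphac
    (fun V hV hV0 _ lam ν hlin => sobolev_independent h hV hV0 hlin)
  have hmax := fun (g : Eu d → ℂ) (hg : g ∈ sobSpace d s α) (hg0 : ¬ g =ᵐ[volume] 0) =>
    W.maximizer_iff hle ⟨V, hV, hV0, hVN⟩ (fun f hf hf0 => weinsteinH_eq h hf hf0) hg hg0
  have hpow : ∀ f : Eu d → ℂ, (‖eh (sc d s α) f‖ ^ 2) ^ (α / 2) = ‖eh (sc d s α) f‖ ^ α :=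
    fun f => by
      rw [← Real.rpow_natCast, ← Real.rpow_mul (norm_nonneg _)]
      congr 1; push_cast; ring
  refine ⟨C, ((α + 2) / (2 * C)) ^ (1 / α), hC, ⟨⟨V, hV, hV0, (hmax V hV hV0).mpr hVN,
    (solvesSobolevEq_iff h.hd hV.2.2).mpr hVs⟩, fun g hg => ?_⟩, ?_, fun f hf => ?_⟩
  · have h1 := huniq g hg.mem hg.ne_zero ((hmax g hg.mem hg.ne_zero).mp hg.maximizer)
      ((solvesSobolevEq_iff h.hd hg.mem.2.2).mp hg.solves)
    rw [hpow] at h1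
    rw [toReal_hdotNorm h.hd hg.mem.2.1, ← h1, ← Real.rpow_mul (norm_nonneg _),
      mul_one_div_cancel hα.ne', Real.rpow_one]
  · rw [← Real.rpow_mul (by positivity), one_div_mul_cancel hα.ne', Real.rpow_one]
  · rw [← hpow]; exact hle f hf

/-- The common norm `L_gs` of the Lebesgue ground states and the optimal constant `C` of the
Gagliardo–Nirenberg inequality, related by `L_gs^α = (α + 2) / (2 C)`. -/
theorem exists_isLgs (h : Params d s α) : ∃ C L : ℝ, 0 < C ∧ IsLgs d s α L ∧
    L ^ α = (α + 2) / (2 * C) ∧ ∀ f ∈ lebSpace d s α,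
      ip (α + 2) f ≤ C * (ip (alphac d s α) f ^ (2 * s / d) * ‖eh s f‖ ^ 2) := by
  have hα := h.α_pos
  have W := lebesgueProblem h
  have hρ : 2 * s / d * alphac d s α = α := by rw [mul_comm, h.alphac_mul]
  obtain ⟨C, hC, hle, ⟨V, hV, hV0, hVN, hVs⟩, huniq⟩ := W.exists_groundState (lebesgueGradient h)
    hρ hα h.pexp_alphac
    (fun V hV hV0 hsol lam ν hlin => lebesgue_independent h (inX_iff.mp hV) hV0 hsol hlin)
  have hmax := fun (g : Eu d → ℂ) (hg : g ∈ lebSpace d s α) (hg0 : ¬ g =ᵐ[volume] 0) =>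
    W.maximizer_iff hle ⟨V, hV, hV0, hVN⟩ (fun f hf hf0 => weinsteinK_eq h hf hf0) hg hg0
  refine ⟨C, ((α + 2) / (2 * C)) ^ (1 / α), hC, ⟨⟨V, hV, hV0, (hmax V hV hV0).mpr hVN,
    (solvesLebesgueEq_iff h.hd hV.2).mpr hVs⟩, fun g hg => ?_⟩, ?_, hle⟩
  · have h1 := huniq g hg.mem hg.ne_zero ((hmax g hg.mem hg.ne_zero).mp hg.maximizer)
      ((solvesLebesgueEq_iff h.hd hg.mem.2).mp hg.solves)
    have h2 := ip_nonneg (alphac d s α) g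
    rw [lebNorm_eq h.alphac_pos hg.mem.1, ENNReal.toReal_ofReal (by positivity), ← h1,
      ← Real.rpow_mul h2]
    congr 1
    have := h.alphac_pos
    rw [div_mul_div_comm, div_eq_div_iff (by positivity)
      (mul_ne_zero h.d_pos.ne' hα.ne')]
    have := h.alphac_mul
    have := h.d_pos
    rw [h.alphac_eq]
    have := h.hs0
    field_simp
  · rw [← Real.rpow_mul (by positivity), one_div_mul_cancel hα.ne', Real.rpow_one]

end

/-! ### Weak convergence in `Ḣ^{s_c} ∩ Ḣ^s` and in `L^{α_c} ∩ Ḣ^s` -/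

section
variable {s α : ℝ}

theorem toReal_sobSpaceNorm (h : Params d s α) {f : Eu d → ℂ} (hf : f ∈ sobSpace d s α) :
    (sobSpaceNorm d s α f).toReal = ‖eh (sc d s α) f‖ + ‖eh s f‖ := by
  rw [sobSpaceNorm, ENNReal.toReal_add hf.2.1.ne hf.2.2.ne, toReal_hdotNorm h.hd hf.2.1,
    toReal_hdotNorm h.hd hf.2.2]

theorem toReal_lebSpaceNorm (h : Params d s α) {f : Eu d → ℂ} (hf : f ∈ lebSpace d s α) :
    (lebSpaceNorm d s α f).toReal
      = ip (alphac d s α) f ^ (1 / alphac d s α) + ‖eh s f‖ := by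
  have hfin : lebNorm (alphac d s α) f ≠ ∞ := hf.1.2.ne
  rw [lebSpaceNorm, ENNReal.toReal_add hfin hf.2.ne, toReal_hdotNorm h.hd hf.2,
    lebNorm_eq h.alphac_pos hf.1,
    ENNReal.toReal_ofReal (Real.rpow_nonneg (ip_nonneg _ _) _)]

/-- The space `Ḣ^{s_c} ∩ Ḣ^s` as a space of functions; functions that agree almost everywhere are
not identified. -/
def sobSubmodule (h : Params d s α) : Submodule ℂ (Eu d → ℂ) where
  carrier := sobSpace d s α
  add_mem' := fun {f g} hf hg => by
    obtain ⟨k, hk⟩ := hf.1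
    obtain ⟨l, hl⟩ := hg.1
    exact ⟨⟨_, hk.add hl⟩, hdotNorm_add_lt_top h.hd hf.2.1 hg.2.1,
      hdotNorm_add_lt_top h.hd hf.2.2 hg.2.2⟩
  zero_mem' := by
    have hψ := sob_testDir h (0 : 𝓢(Eu d, ℂ))
    obtain ⟨k, hk⟩ := hψ.1
    have h0 : (0 : Eu d → ℂ) = (0 : ℂ) • testDir (0 : 𝓢(Eu d, ℂ)) := (zero_smul ℂ _).symm
    rw [h0]
    exact ⟨⟨_, hk.smul 0⟩, hdotNorm_smul_lt_top h.hd _ hψ.2.1, hdotNorm_smul_lt_top h.hd _ hψ.2.2⟩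
  smul_mem' := fun c f hf => by
    obtain ⟨k, hk⟩ := hf.1
    exact ⟨⟨_, hk.smul c⟩, hdotNorm_smul_lt_top h.hd _ hf.2.1, hdotNorm_smul_lt_top h.hd _ hf.2.2⟩

/-- The map `f ↦ ((2π|ξ|)^{s_c} f̂, (2π|ξ|)^s f̂)` from `Ḣ^{s_c} ∩ Ḣ^s` to `L² × L²`. -/
def sobEmbedding (h : Params d s α) : sobSubmodule h →ₗ[ℂ] L2 d × L2 d where
  toFun f := (eh (sc d s α) f, eh s f)
  map_add' f g := Prod.ext (eh_add h.hd f.2.2.1 g.2.2.1) (eh_add h.hd f.2.2.2 g.2.2.2)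
  map_smul' c f := Prod.ext (eh_smul h.hd c f.2.2.1) (eh_smul h.hd c f.2.2.2)

theorem WeakLim.tendsto_dual {u : ℕ → L2 d} {a : L2 d} (hu : WeakLim u a) (F : L2 d →L[ℂ] ℂ) :
    Tendsto (fun n => F (u n)) atTop (𝓝 (F a)) := by
  have h1 := hu ((InnerProductSpace.toDual ℂ (L2 d)).symm F)
  simpa only [InnerProductSpace.toDual_symm_apply] using h1

/-- Bounded functionals on `Ḣ^{s_c} ∩ Ḣ^s` extend to `L² × L²` by the Hahn–Banach theorem; thus
weak convergence of the two Fourier components is weak convergence in the space. -/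
theorem weaklyConverges_sob (h : Params d s α) {u : ℕ → Eu d → ℂ} {V : Eu d → ℂ}
    (hu : ∀ n, u n ∈ sobSpace d s α) (hV : V ∈ sobSpace d s α)
    (h1 : WeakLim (fun n => eh (sc d s α) (u n)) (eh (sc d s α) V))
    (h2 : WeakLim (fun n => eh s (u n)) (eh s V)) :
    WeaklyConverges (sobSpace d s α) (sobSpaceNorm d s α) u V := by
  refine ⟨hu, hV, fun l hl => ?_⟩
  obtain ⟨C, hC⟩ := hl.bound
  set T := sobEmbedding h with hT
  let lin : sobSubmodule h →ₗ[ℂ] ℂ :=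
    { toFun := fun f => l f
      map_add' := fun f g => hl.map_add f f.2 g g.2
      map_smul' := fun c f => hl.map_smul c f f.2 }
  have hbound : ∀ f : sobSubmodule h, ‖lin f‖ ≤ (2 * |C|) * ‖T f‖ := fun f => by
    have h3 := hC f f.2
    rw [toReal_sobSpaceNorm h f.2] at h3
    have h4 : ‖eh (sc d s α) (f : Eu d → ℂ)‖ ≤ ‖T f‖ := norm_fst_le (T f)
    have h5 : ‖eh s (f : Eu d → ℂ)‖ ≤ ‖T f‖ := norm_snd_le (T f)
    calc ‖lin f‖ ≤ C * (‖eh (sc d s α) (f : Eu d → ℂ)‖ + ‖eh s (f : Eu d → ℂ)‖) := h3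
      _ ≤ |C| * (‖T f‖ + ‖T f‖) := by
          refine mul_le_mul (le_abs_self C) (add_le_add h4 h5) (by positivity) (abs_nonneg C)
      _ = _ := by ring
  have hker : LinearMap.ker T ≤ LinearMap.ker lin := fun f hf => by
    have h3 := hbound f
    rw [LinearMap.mem_ker.mp hf, norm_zero, mul_zero] at h3
    exact LinearMap.mem_ker.mpr (norm_le_zero_iff.mp h3)
  let g : LinearMap.range T →ₗ[ℂ] ℂ :=
    (Submodule.liftQ _ lin hker) ∘ₗ (T.quotKerEquivRange.symm : LinearMap.range T →ₗ[ℂ] _)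
  have hg : ∀ f, g ⟨T f, LinearMap.mem_range_self T f⟩ = lin f := fun f => by
    change Submodule.liftQ _ lin hker (T.quotKerEquivRange.symm ⟨T f, _⟩) = _
    rw [LinearMap.quotKerEquivRange_symm_apply_image]
    exact Submodule.liftQ_apply _ _ _
  have hgb : ∀ y, ‖g y‖ ≤ (2 * |C|) * ‖y‖ := by
    rintro ⟨_, f, rfl⟩
    rw [hg]
    exact hbound f
  obtain ⟨F, hF, -⟩ := exists_extension_norm_eq (LinearMap.range T) (g.mkContinuous _ hgb)
  have hF' : ∀ f (hf : f ∈ sobSpace d s α), l f = F (eh (sc d s α) f, 0) + F (0, eh s f) :=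
    fun f hf => by
      have h3 := hF ⟨T ⟨f, hf⟩, LinearMap.mem_range_self T _⟩
      rw [LinearMap.mkContinuous_apply, hg] at h3
      rw [← map_add, Prod.mk_add_mk, add_zero, zero_add]
      exact h3.symm
  simp only [hF' _ hV, hF' _ (hu _)]
  exact (h1.tendsto_dual (F.comp (ContinuousLinearMap.inl ℂ _ _))).add
    (h2.tendsto_dual (F.comp (ContinuousLinearMap.inr ℂ _ _)))

/-- `Ḣ^{s_c} ∩ Ḣ^s` embeds continuously into `L^{α_c} ∩ Ḣ^s`, so that weak convergence in the former
implies weak convergence in the latter. -/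
theorem WeaklyConverges.leb (h : Params d s α) {u : ℕ → Eu d → ℂ} {V : Eu d → ℂ}
    (hw : WeaklyConverges (sobSpace d s α) (sobSpaceNorm d s α) u V) :
    WeaklyConverges (lebSpace d s α) (lebSpaceNorm d s α) u V := by
  have hsub : ∀ f ∈ sobSpace d s α, f ∈ lebSpace d s α := fun f hf =>
    inX_iff.mpr (inX_of_sob h hf)
  refine ⟨fun n => hsub _ (hw.mem_seq n), hsub V hw.mem_limit, fun l hl => hw.tendsto l
    ⟨fun f hf g hg => hl.map_add f (hsub f hf) g (hsub g hg),
      fun c f hf => hl.map_smul c f (hsub f hf), ?_⟩⟩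
  obtain ⟨C, hC⟩ := hl.bound
  obtain ⟨D, hD, hS⟩ := exists_sobolev h.hd h.sc_pos (h.sc_lt.trans h.hs1) h.two_sc_lt
  have hq := h.alphac_pos
  refine ⟨|C| * (D ^ (1 / alphac d s α) + 1), fun f hf => ?_⟩
  rw [toReal_sobSpaceNorm h hf]
  have h1 : ip (alphac d s α) f ≤ D * ‖eh (sc d s α) f‖ ^ alphac d s α :=
    (hS f hf.1 hf.2.1).2
  have h2 : ip (alphac d s α) f ^ (1 / alphac d s α)
      ≤ D ^ (1 / alphac d s α) * ‖eh (sc d s α) f‖ := by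
    refine (Real.rpow_le_rpow (ip_nonneg _ _) h1 (by positivity)).trans_eq ?_
    rw [Real.mul_rpow hD (by positivity), ← Real.rpow_mul (norm_nonneg _),
      mul_one_div_cancel hq.ne', Real.rpow_one]
  have h3 := hC f (hsub f hf)
  rw [toReal_lebSpaceNorm h (hsub f hf)] at h3
  have h4 := Real.rpow_nonneg (ip_nonneg (alphac d s α) f) (1 / alphac d s α)
  have h5 := Real.rpow_nonneg hD (1 / alphac d s α)
  calc ‖l f‖ ≤ |C| * (ip (alphac d s α) f ^ (1 / alphac d s α) + ‖eh s f‖) :=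
        h3.trans (by gcongr; exact le_abs_self C)
    _ ≤ |C| * (D ^ (1 / alphac d s α) * ‖eh (sc d s α) f‖ + ‖eh s f‖) := by gcongr
    _ ≤ |C| * ((D ^ (1 / alphac d s α) + 1) * (‖eh (sc d s α) f‖ + ‖eh s f‖)) := by
        gcongr
        nlinarith [norm_nonneg (eh (sc d s α) f), norm_nonneg (eh s f),
          mul_nonneg h5 (norm_nonneg (eh s f))]
    _ = _ := by ring

/-! ### The compactness lemma -/

/-- The maximum with `0` covers negative `C`, for which `ENNReal.ofReal C = 0`. -/
theorem norm_eh_le_of_hdotNorm_le (hd : 0 < d) {γ C : ℝ} {f : Eu d → ℂ} (hf : hdotNorm γ f < ∞)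
    (hC : hdotNorm γ f ≤ ENNReal.ofReal C) : ‖eh γ f‖ ≤ max C 0 := by
  rw [hdotNorm_eq_norm_eh hd hf] at hC
  rcases le_total 0 C with h0 | h0
  · exact ((ENNReal.ofReal_le_ofReal_iff h0).mp hC).trans (le_max_left _ _)
  · rw [ENNReal.ofReal_of_nonpos h0, nonpos_iff_eq_zero, ENNReal.ofReal_eq_zero] at hC
    exact hC.trans (le_max_right _ _)

/-- A subsequence along which the upper limit of the `L^{α+2}` norms is attained, at least up to
the given lower bound `m`, and all relevant norms converge. -/
theorem exists_convSeq (h : Params d s α) {v : ℕ → Eu d → ℂ} {M m B : ℝ} (hM : 0 < M) (hm : 0 ≤ m)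
    (hv : ∀ n, v n ∈ sobSpace d s α) (hB1 : ∀ n, ‖eh (sc d s α) (v n)‖ ≤ B)
    (hB2 : ∀ n, ‖eh s (v n)‖ ≤ B)
    (hlimM : limsup (fun n => hdotNorm s (v n)) atTop ≤ ENNReal.ofReal M)
    (hlimm : ENNReal.ofReal m ≤ limsup (fun n => lebNorm (α + 2) (v n)) atTop) :
    ∃ (φ : ℕ → ℕ) (Q L M' : ℝ), StrictMono φ ∧
      ConvSeq s (alphac d s α) (fun n => v (φ n)) Q L M' ∧ M' ≤ M ^ 2 ∧ m ^ (α + 2) ≤ L := by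
  have hα := h.α_pos
  have hA := h.admissible
  have hp : (0 : ℝ) < α + 2 := by linarith
  have hB0 : 0 ≤ B := (norm_nonneg _).trans (hB1 0)
  have hX := fun n => inX_of_sob h (hv n)
  have hXp : ∀ n, MemLp (v n) (ENNReal.ofReal (α + 2)) volume := fun n => by
    have := (hX n).memLp_pexp hA
    rwa [h.pexp_alphac] at this
  -- indices at which the norm almost reaches `m`
  obtain ⟨φ₀, hφ₀, hlow⟩ : ∃ φ₀ : ℕ → ℕ, StrictMono φ₀ ∧
      ∀ k : ℕ, m - 1 / ((k : ℝ) + 1) ≤ ip (α + 2) (v (φ₀ k)) ^ (1 / (α + 2)) := by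
    rcases hm.eq_or_lt with hm0 | hm0
    · refine ⟨id, strictMono_id, fun k => ?_⟩
      have h1 : (0 : ℝ) ≤ 1 / ((k : ℝ) + 1) := by positivity
      have h2 := Real.rpow_nonneg (ip_nonneg (α + 2) (v (id k))) (1 / (α + 2))
      linarith
    · refine extraction_forall_of_frequently (P := fun k n =>
        m - 1 / ((k : ℝ) + 1) ≤ ip (α + 2) (v n) ^ (1 / (α + 2))) fun k => ?_
      have h1 : ENNReal.ofReal (m - 1 / ((k : ℝ) + 1)) < ENNReal.ofReal m := by
        rw [ENNReal.ofReal_lt_ofReal_iff hm0]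
        have : (0 : ℝ) < 1 / ((k : ℝ) + 1) := by positivity
        linarith
      refine (frequently_lt_of_lt_limsup (by isBoundedDefault) (h1.trans_le hlimm)).mono fun n hn => ?_
      rw [lebNorm_eq hp (hXp n)] at hn
      exact (ENNReal.ofReal_lt_ofReal_iff'.mp hn).1.le
  obtain ⟨D, hD, hS⟩ := exists_sobolev h.hd h.sc_pos (h.sc_lt.trans h.hs1) h.two_sc_lt
  have hq := h.alphac_pos
  have hbq : ∀ n, ip (alphac d s α) (v n) ≤ D * B ^ alphac d s α := fun n => by
    refine (hS (v n) (hv n).1 (hv n).2.1).2.trans ?_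
    have := Real.rpow_le_rpow (norm_nonneg _) (hB1 n) hq.le
    exact mul_le_mul_of_nonneg_left this hD
  obtain ⟨C, -, hC, -, -, hgn⟩ := exists_isSgs h
  have hbp : ∀ n, ip (α + 2) (v n) ≤ C * (B ^ α * B ^ 2) := fun n => by
    refine (hgn (v n) (hv n)).trans ?_
    have := hB1 n
    have := hB2 n
    gcongr
  obtain ⟨⟨Q, L, M'⟩, -, φ₁, hφ₁, hlim⟩ := tendsto_subseq_of_bounded
    (s := Set.Icc (0 : ℝ) (D * B ^ alphac d s α) ×ˢ
      (Set.Icc (0 : ℝ) (C * (B ^ α * B ^ 2)) ×ˢ Set.Icc (0 : ℝ) (B ^ 2)))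
    ((Metric.isBounded_Icc _ _).prod ((Metric.isBounded_Icc _ _).prod (Metric.isBounded_Icc _ _)))
    (x := fun n => (ip (alphac d s α) (v (φ₀ n)), ip (α + 2) (v (φ₀ n)), ‖eh s (v (φ₀ n))‖ ^ 2))
    (fun n => ⟨⟨ip_nonneg _ _, hbq _⟩, ⟨ip_nonneg _ _, hbp _⟩, by positivity,
      pow_le_pow_left₀ (norm_nonneg _) (hB2 (φ₀ n)) 2⟩)
  have hlimQ := (continuous_fst.tendsto _).comp hlim
  have hlimL := ((continuous_fst.comp continuous_snd).tendsto _).comp hlim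
  have hlimM' := ((continuous_snd.comp continuous_snd).tendsto _).comp hlim
  refine ⟨φ₀ ∘ φ₁, Q, L, M', hφ₀.comp hφ₁, ⟨fun n => hX _, hlimQ, ?_, hlimM'⟩, ?_, ?_⟩
  · rw [h.pexp_alphac]
    exact hlimL
  · have h1 : ∀ ε > 0, M' ≤ (M + ε) ^ 2 := fun ε hε => by
      have h2 : limsup (fun n => hdotNorm s (v n)) atTop < ENNReal.ofReal (M + ε) :=
        hlimM.trans_lt ((ENNReal.ofReal_lt_ofReal_iff (by linarith)).mpr (by linarith))
      have h3 := (hφ₀.comp hφ₁).tendsto_atTop.eventually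
        (eventually_lt_of_limsup_lt h2 (by isBoundedDefault))
      refine le_of_tendsto hlimM' (h3.mono fun n hn => ?_)
      have h4 := norm_eh_le_of_hdotNorm_le h.hd (hv _).2.2 hn.le
      rw [max_eq_left (by linarith)] at h4
      exact pow_le_pow_left₀ (norm_nonneg _) h4 2
    have h5 : Tendsto (fun ε : ℝ => (M + ε) ^ 2) (𝓝[>] 0) (𝓝 ((M + 0) ^ 2)) :=
      Tendsto.mono_left ((tendsto_const_nhds.add tendsto_id).pow 2) nhdsWithin_le_nhds
    rw [add_zero] at h5
    exact ge_of_tendsto h5 (eventually_mem_nhdsWithin.mono fun ε hε => h1 ε hε)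
  · have h1 : Tendsto (fun n => ip (α + 2) (v (φ₀ (φ₁ n))) ^ (1 / (α + 2))) atTop
        (𝓝 (L ^ (1 / (α + 2)))) := hlimL.rpow_const (Or.inr (by positivity))
    have h2 : Tendsto (fun n => m - 1 / ((φ₁ n : ℝ) + 1)) atTop (𝓝 (m - 0)) :=
      (tendsto_one_div_add_atTop_nhds_zero_nat.comp hφ₁.tendsto_atTop).const_sub m
    rw [sub_zero] at h2
    have h3 := le_of_tendsto_of_tendsto' h2 h1 fun n => hlow (φ₁ n)
    have hL0 : 0 ≤ L := ge_of_tendsto hlimL (Eventually.of_forall fun n => ip_nonneg _ _)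
    have h4 := Real.rpow_le_rpow hm h3 hp.le
    rwa [← Real.rpow_mul hL0, one_div_mul_cancel hp.ne', Real.rpow_one] at h4

/-- Some translates of a subsequence of `v` converge weakly to a function `V` with
`‖V‖_{α+2}^{α+2} ≥ (m^{α+2} / M²) ‖V‖_{Ḣ^s}²`, which is nonzero unless `m = 0`. -/
theorem exists_concentrating_profile (h : Params d s α) {v : ℕ → Eu d → ℂ} {M m : ℝ} (hM : 0 < M)
    (hm : 0 ≤ m) (hv : ∀ n, v n ∈ sobSpace d s α)
    (hbd : ∃ C : ℝ, ∀ n, sobSpaceNorm d s α (v n) ≤ ENNReal.ofReal C)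
    (hlimM : limsup (fun n => hdotNorm s (v n)) atTop ≤ ENNReal.ofReal M)
    (hlimm : ENNReal.ofReal m ≤ limsup (fun n => lebNorm (α + 2) (v n)) atTop) :
    ∃ (x : ℕ → Eu d) (σ : ℕ → ℕ) (V : Eu d → ℂ), StrictMono σ ∧
      WeaklyConverges (sobSpace d s α) (sobSpaceNorm d s α) (fun n y => v (σ n) (y + x (σ n))) V ∧
      (m = 0 ∨ 0 < ‖eh s V‖ ^ 2) ∧
      m ^ (α + 2) / M ^ 2 * ‖eh s V‖ ^ 2 ≤ ip (α + 2) V := by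
  have hα := h.α_pos
  have hA := h.admissible
  obtain ⟨C, hC⟩ := hbd
  have hB1 : ∀ n, ‖eh (sc d s α) (v n)‖ ≤ max C 0 := fun n =>
    norm_eh_le_of_hdotNorm_le h.hd (hv n).2.1 (le_self_add.trans (hC n))
  have hB2 : ∀ n, ‖eh s (v n)‖ ≤ max C 0 := fun n =>
    norm_eh_le_of_hdotNorm_le h.hd (hv n).2.2 (le_add_self.trans (hC n))
  obtain ⟨φ, Q, L, M', hφ, hconv, hM', hL⟩ := exists_convSeq h hM hm hv hB1 hB2 hlimM hlimm
  obtain ⟨V, ⟨hVX, σ, x, hσ, hlim⟩, hV0, hVN⟩ : ∃ V,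
      IsProfile s (alphac d s α) (fun n => v (φ n)) V ∧ (m = 0 ∨ 0 < ‖eh s V‖ ^ 2) ∧
      m ^ (α + 2) / M ^ 2 * ‖eh s V‖ ^ 2 ≤ ip (α + 2) V := by
    rcases hm.eq_or_lt with hm0 | hm0
    -- For `m = 0` any weak limit will do.
    · obtain ⟨ψ, V, hψ, hVX, hlim, -⟩ := hconv.exists_limit hA
      refine ⟨V, ⟨hVX, ψ, 0, hψ, by simpa using hlim⟩, Or.inl hm0.symm, ?_⟩
      rw [← hm0, Real.zero_rpow (by linarith), zero_div, zero_mul]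
      exact ip_nonneg _ _
    · have hmp : 0 < m ^ (α + 2) := by positivity
      obtain ⟨V, hV, hV0, hVN⟩ := hconv.exists_profile hA (Λ := m ^ (α + 2) / M ^ 2) (by positivity)
        (hmp.trans_le hL) (by
          rw [div_mul_eq_mul_div, div_le_iff₀ (by positivity)]
          exact mul_le_mul hL hM' (ge_of_tendsto hconv.limM
            (Eventually.of_forall fun n => by positivity)) (hmp.le.trans hL))
      rw [h.pexp_alphac] at hVN
      exact ⟨V, hV, Or.inr ((lebesgueProblem h).pos (inX_iff.mpr hV.1) hV0).2.1, hVN⟩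
  have htr := fun n => (sobolevProblem h).translate _ (hv (φ (σ n))) (x n)
  obtain ⟨hVY, ψ, hψ, hlim'⟩ := sob_of_weakLim h (fun n => (htr n).1) (B := max C 0)
    (B' := max C 0)
    (fun n => by rw [eh_translate h.hd (hv _).2.1, norm_chrL2]; exact hB1 _)
    (fun n => by rw [eh_translate h.hd (hv _).2.2, norm_chrL2]; exact hB2 _) hVX hlim
  have hτ : StrictMono (φ ∘ σ ∘ ψ) := hφ.comp (hσ.comp hψ)
  -- The translations are to be indexed by the original sequence; they are `0` off the subsequence.
  have hx : ∀ n, Function.extend (φ ∘ σ ∘ ψ) (x ∘ ψ) 0 ((φ ∘ σ ∘ ψ) n) = x (ψ n) := fun n =>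
    hτ.injective.extend_apply _ _ n
  refine ⟨Function.extend (φ ∘ σ ∘ ψ) (x ∘ ψ) 0, φ ∘ σ ∘ ψ, V, hτ, ?_, hV0, hVN⟩
  simp only [hx]
  exact weaklyConverges_sob h (fun n => (htr (ψ n)).1) hVY hlim' (hlim.comp hψ)

/-- From `Λ a ≤ N ≤ C X a` and `Sα = (α + 2) / (2 C)` follows the lower bound for `X`. In the
application, `a = ‖V‖_{Ḣ^s}²`, `N = ‖V‖_{α+2}^{α+2}`, and `X` is the power `α` of the other norm of
`V`. -/
theorem lower_bound_of_optimal {Λ a N C X Sα : ℝ} (hα : 0 < α) (hC : 0 < C) (hX : 0 ≤ X)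
    (hS : Sα = (α + 2) / (2 * C)) (ha : Λ = 0 ∨ 0 < a) (h1 : Λ * a ≤ N)
    (h2 : N ≤ C * (X * a)) : 2 / (α + 2) * Λ * Sα ≤ X := by
  have h3 : 2 / (α + 2) * Λ * Sα = Λ / C := by
    rw [hS]; field_simp
  rw [h3, div_le_iff₀ hC]
  rcases ha with h0 | h0
  · rw [h0]; positivity
  · refine le_of_mul_le_mul_right ?_ h0
    linarith

end

end FracNLS

end

theorem mainTheorem3 (d : ℕ) (hd : 1 ≤ d) (s α : ℝ) (hs0 : 0 < s) (hs1 : s < 1)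
    (hα : 4 * s / d < α) (hα' : 2 * s < d → α < 4 * s / (d - 2 * s)) :
    ∃ Sgs Lgs : ℝ, FracNLS.IsSgs d s α Sgs ∧ FracNLS.IsLgs d s α Lgs ∧
      ∀ (v : ℕ → EuclideanSpace ℝ (Fin d) → ℂ) (M m : ℝ), 0 < M → 0 ≤ m →
        (∀ n, v n ∈ FracNLS.sobSpace d s α) →
        (∃ C : ℝ, ∀ n, FracNLS.sobSpaceNorm d s α (v n) ≤ ENNReal.ofReal C) →
        limsup (fun n => FracNLS.hdotNorm s (v n)) atTop ≤ ENNReal.ofReal M →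
        ENNReal.ofReal m ≤ limsup (fun n => FracNLS.lebNorm (α + 2) (v n)) atTop →
        (∃ (x : ℕ → EuclideanSpace ℝ (Fin d)) (σ : ℕ → ℕ)
            (V : EuclideanSpace ℝ (Fin d) → ℂ), StrictMono σ ∧
            FracNLS.WeaklyConverges (FracNLS.sobSpace d s α) (FracNLS.sobSpaceNorm d s α)
              (fun n y => v (σ n) (y + x (σ n))) V ∧
            2 / (α + 2) * (m ^ (α + 2) / M ^ 2) * Sgs ^ α
              ≤ (FracNLS.hdotNorm (FracNLS.sc d s α) V).toReal ^ α) ∧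
        (∃ (y : ℕ → EuclideanSpace ℝ (Fin d)) (τ : ℕ → ℕ)
            (W : EuclideanSpace ℝ (Fin d) → ℂ), StrictMono τ ∧
            FracNLS.WeaklyConverges (FracNLS.lebSpace d s α) (FracNLS.lebSpaceNorm d s α)
              (fun n z => v (τ n) (z + y (τ n))) W ∧
            2 / (α + 2) * (m ^ (α + 2) / M ^ 2) * Lgs ^ α
              ≤ (FracNLS.lebNorm (FracNLS.alphac d s α) W).toReal ^ α) := by
  have h : FracNLS.Params d s α := ⟨hd, hs0, hs1, hα, hα'⟩
  obtain ⟨C, S, hC, hS, hSα, hle⟩ := FracNLS.exists_isSgs h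
  obtain ⟨D, L, hD, hL, hLα, hle'⟩ := FracNLS.exists_isLgs h
  refine ⟨S, L, hS, hL, fun v M m hM hm hv hbd hlimM hlimm => ?_⟩
  obtain ⟨x, σ, V, hσ, hweak, hV0, hVN⟩ :=
    FracNLS.exists_concentrating_profile h hM hm hv hbd hlimM hlimm
  have hVs := hweak.mem_limit
  have hVl := (hweak.leb h).mem_limit
  have hα0 := h.α_pos
  have hΛ : m ^ (α + 2) / M ^ 2 = 0 ∨ 0 < ‖FracNLS.eh s V‖ ^ 2 := hV0.imp_left fun h0 => by
    rw [h0, Real.zero_rpow (by linarith), zero_div]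
  have hip := FracNLS.ip_nonneg (FracNLS.alphac d s α) V
  -- One weak limit serves both parts: only the Gagliardo–Nirenberg inequality differs.
  refine ⟨⟨x, σ, V, hσ, hweak, ?_⟩, ⟨x, σ, V, hσ, hweak.leb h, ?_⟩⟩
  · rw [FracNLS.toReal_hdotNorm h.hd hVs.2.1]
    exact FracNLS.lower_bound_of_optimal hα0 hC (by positivity) hSα hΛ hVN (hle V hVs)
  · have hdiv : 1 / FracNLS.alphac d s α * α = 2 * s / d := by
      have := h.alphac_pos
      rw [one_div_mul_eq_div, div_eq_iff this.ne', mul_comm, h.alphac_mul]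
    rw [FracNLS.lebNorm_eq h.alphac_pos hVl.1, ENNReal.toReal_ofReal (by positivity),
      ← Real.rpow_mul hip, hdiv]
    exact FracNLS.lower_bound_of_optimal hα0 hD (by positivity) hLα hΛ hVN (hle' V hVl)
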